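/- **Setting.** For an integer $k\ge 1$ and a function $f$ on $[0,1]$ write $\Delta_i^k f=f(i/k)-f((i-1)/k)$, $i=1,\dots,k$. Let $X=(X(t))_{t\ge 0}$ be a real-valued Lévy process (independent and stationary increments, $X(0)=0$, càdlàg paths). Let $U,U_1,\dots,U_k$ be standard uniform random variables, $B$ a standard Brownian bridge on $[0,1]$ and $\beta_1,\dots,\beta_k$ standard Brownian bridges on $[0,1/k]$, such that $X,U,U_1,\dots,U_k,B,\beta_1,\dots,\beta_k$ are mutually independent. *Reordering coupling.* Let $h$ be any measurable function such that $h(X(1),U)$ is standard normal, and put $W'(t)=B(t)+t\,h(X(1),U)$, $t\in[0,1]$. Let $\pi$ be the a.s. unique random permutation of $\{1,\dots,k\}$ such that for all $i\ne j$ $$\Delta^k_{\pi(i)}W'<\Delta^k_{\pi(j)}W'\iff \Delta_i^kX<\Delta_j^kX\ \text{ or }\ (\Delta_i^kX=\Delta_j^kX\text{ and }U_i<U_j).$$ Define $W(0)=0$ and, for $\frac{i-1}k<t\le\frac ik$, $i=1,\dots,k$, $$W(t)=W\big(\tfrac{i-1}k\big)+W'\big(\tfrac{\pi(i)-1}k+t-\tfrac{i-1}k\big)-W'\big(\tfrac{\pi(i)-1}k\big).$$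 *Auxiliary coupling.* Let $F$ be the distribution function of $\mathcal N(0,1/k)$, $F^{-1}(p)=\inf\{x: F(x)\ge p\}$, $h_k(x,u)=F^{-1}\big(\mathbb P(X(1/k)<x)+u\,\mathbb P(X(1/k)=x)\big)$ and $\xi_i=h_k(\Delta_i^kX,U_i)$. Define $\widehat W(0)=0$ and, for $\frac{i-1}k<t\le\frac ik$, $i=1,\dots,k$, $$\widehat W(t)=\widehat W\big(\tfrac{i-1}k\big)+\beta_i\big(t-\tfrac{i-1}k\big)+k\big(t-\tfrac{i-1}k\big)\xi_i.$$ **Theorem.** Let $(X_n)$ be a sequence of Lévy processes and $k_n\ge1$ integers with $k_n\to\infty$. For each $n$ let $W_n$ and $\widehat W_n$ be constructed as above from $X_n$ with $k=k_n$ increments and some choice of $h=h_n$ (the probability space may depend on $n$). Let $\varepsilon_n\downarrow0$ be such that $\varepsilon_nk_n/\log k_n$ is bounded away from $0$ for all large $n$. If, as $n\to\infty$, $$\mathbb E|X_n(1)-W_n(1)|^2=\mathrm O(\varepsilon_n)\quad\text{and}\quad \mathbb E\sup_{t\in[0,1]}|X_n(t)-\widehat W_n(t)|^2=\mathrm O(\varepsilon_n),$$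 then also $\mathbb E\sup_{t\in[0,1]}|X_n(t)-W_n(t)|^2=\mathrm O(\varepsilon_n)$. Likewise, if $$\mathbb E|X_n(1)-\widehat W_n(1)|^2=\mathrm O(\varepsilon_n)\quad\text{and}\quad \mathbb E\sup_{t\in[0,1]}|X_n(t)-W_n(t)|^2=\mathrm O(\varepsilon_n),$$ then also $\mathbb E\sup_{t\in[0,1]}|X_n(t)-\widehat W_n(t)|^2=\mathrm O(\varepsilon_n)$. -/

import Mathlib

open MeasureTheory ProbabilityTheory Filter Topology
open scoped NNReal ENNReal

namespace LevyCoupling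

/-- Right-continuous with left limits at every point of `[0, ∞)`. -/
def IsCadlag (f : ℝ≥0 → ℝ) : Prop :=
  ∀ t, ContinuousWithinAt f (Set.Ici t) t ∧ ∃ l, Tendsto f (𝓝[<] t) (𝓝 l)

/-- Real-valued Lévy processes on `[0, ∞)`. -/
structure IsLevyProcess {Ω : Type*} [MeasurableSpace Ω] (X : ℝ≥0 → Ω → ℝ) (P : Measure Ω) :
    Prop where
  measurable : ∀ t, Measurable (X t)
  zero : ∀ᵐ ω ∂P, X 0 ω = 0
  indep : HasIndepIncrements X P
  stationary : ∀ s t, IdentDistrib (fun ω => X (s + t) ω - X s ω) (X t) P P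
  cadlag : ∀ᵐ ω ∂P, IsCadlag (fun t => X t ω)

/-- Standard Brownian bridges on the time interval `[0, T]` (from `0` to `0`). Nothing is required
of the values at times larger than `T`. -/
structure IsBrownianBridge {Ω : Type*} [MeasurableSpace Ω] (T : ℝ≥0) (β : ℝ≥0 → Ω → ℝ)
    (P : Measure Ω) : Prop where
  measurable : ∀ t ≤ T, Measurable (β t)
  gaussian : IsGaussianProcess (fun t : Set.Iic T => β t) P
  mean : ∀ t ≤ T, ∫ ω, β t ω ∂P = 0
  cov : ∀ s t : ℝ≥0, s ≤ t → t ≤ T → cov[β s, β t; P] = (s : ℝ) * (T - t) / T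
  continuous : ∀ᵐ ω ∂P, ContinuousOn (fun t => β t ω) (Set.Iic T)

/-- The left inverse `F⁻¹(p) = inf {x | p ≤ F(x)}` of the distribution function of `ν`. -/
noncomputable def leftInverse (ν : Measure ℝ) (p : ℝ) : ℝ :=
  sInf {x | p ≤ cdf ν x}

/-- The comonotonic coupling function: if `ζ ∼ μ` and `U` is an independent standard uniform, then
`comonotone μ ν ζ U ∼ ν` is coupled comonotonically with `ζ`. -/
noncomputable def comonotone (μ ν : Measure ℝ) (x u : ℝ) : ℝ :=
  leftInverse ν (μ.real (Set.Iio x) + u * μ.real {x})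

/-- The increment of `f` over `[i/k, (i+1)/k]`, where `i = 0, …, k-1`. -/
noncomputable def incr (k : ℕ) (f : ℝ≥0 → ℝ) (i : Fin k) : ℝ :=
  f (((i : ℕ) + 1) / k) - f ((i : ℕ) / k)

/-- The permutation `σ` arranges the numbers `w i` in the order of the numbers `x i`, where
the ties among the latter are resolved by means of `u i`. -/
def IsReordering {k : ℕ} (x u w : Fin k → ℝ) (σ : Equiv.Perm (Fin k)) : Prop :=
  ∀ i j, i ≠ j → (w (σ i) < w (σ j) ↔ x i < x j ∨ (x i = x j ∧ u i < u j))

theorem existsUnique_isReordering {k : ℕ} (x u w : Fin k → ℝ) (hw : Function.Injective w)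
    (hu : Function.Injective u) : ∃! σ, IsReordering x u w σ := by
  have key : ∀ f : Fin k → ℝ ×ₗ ℝ, Function.Injective f →
      StrictMono (f ∘ Tuple.sort f) := fun f hf =>
    (Tuple.monotone_sort f).strictMono_of_injective (hf.comp (Equiv.injective _))
  have hws : StrictMono (w ∘ Tuple.sort w) :=
    (Tuple.monotone_sort w).strictMono_of_injective (hw.comp (Equiv.injective _))
  set g : Fin k → ℝ ×ₗ ℝ := fun i => toLex (x i, u i) with hg
  have hgi : Function.Injective g := by
    intro i j h
    have : (x i, u i) = (x j, u j) := toLex.injective h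
    exact hu (Prod.ext_iff.1 this).2
  have hlex : ∀ i j, g i < g j ↔ x i < x j ∨ (x i = x j ∧ u i < u j) := by
    intro i j
    simp [hg, Prod.Lex.toLex_lt_toLex]
  refine ⟨(Tuple.sort g).symm.trans (Tuple.sort w), ?_, ?_⟩
  · intro i j _
    rw [← hlex]
    have h1 := hws.lt_iff_lt (a := (Tuple.sort g).symm i) (b := (Tuple.sort g).symm j)
    have h2 := (key g hgi).lt_iff_lt (a := (Tuple.sort g).symm i) (b := (Tuple.sort g).symm j)
    simp only [Function.comp_apply, Equiv.apply_symm_apply] at h1 h2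
    rw [h2]
    exact h1
  · intro σ hσ
    have hm : StrictMono (w ∘ σ ∘ Tuple.sort g) := by
      intro a b hab
      have h := key g hgi hab
      exact (hσ _ _ fun he => hab.ne ((Tuple.sort g).injective he)).2 ((hlex _ _).1 h)
    have hr : Set.range (w ∘ σ ∘ Tuple.sort g) = Set.range (w ∘ Tuple.sort w) := by
      have h1 : Set.range (w ∘ (σ ∘ Tuple.sort g)) = Set.range w :=
        (σ.surjective.comp (Tuple.sort g).surjective).range_comp w
      rw [h1]
      exact ((Tuple.sort w).surjective.range_comp w).symm
    have he := (hm.range_inj hws).1 hr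
    ext i
    have h := congrFun he ((Tuple.sort g).symm i)
    simp only [Function.comp_apply, Equiv.apply_symm_apply] at h
    simp [hw h]

open Classical in
/-- The permutation satisfying `IsReordering`; it exists and is unique when there are no ties
among the `u i` and none among the `w i`. The identity is a placeholder otherwise. -/
noncomputable def reordering {k : ℕ} (x u w : Fin k → ℝ) : Equiv.Perm (Fin k) :=
  if h : ∃ σ, IsReordering x u w σ then h.choose else 1

/-- Concatenation of path segments `f i` of duration `1/k`: the path on `[0, 1]` that starts at `0`
and continues on `(i/k, (i+1)/k]` from its value at `i/k` by adding `f i (t - i/k)`, for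
`i = 0, …, k-1`; see `concat_zero` and `concat_step`. -/
noncomputable def concat {k : ℕ} (f : Fin k → ℝ≥0 → ℝ) (t : ℝ≥0) : ℝ :=
  ∑ j : Fin k, if ((j : ℕ) + 1 : ℝ≥0) / k ≤ t then f j (1 / k)
    else if ((j : ℕ) : ℝ≥0) / k < t then f j (t - (j : ℕ) / k) else 0

theorem concat_zero {k : ℕ} (f : Fin k → ℝ≥0 → ℝ) : concat f 0 = 0 := by
  refine Finset.sum_eq_zero fun j _ => ?_
  have hk : (0 : ℝ≥0) < k := by exact_mod_cast j.pos
  have : ¬ ((j : ℕ) + 1 : ℝ≥0) / k ≤ 0 := not_le.2 (by positivity)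
  rw [if_neg this, if_neg (by simp)]

theorem concat_step {k : ℕ} (f : Fin k → ℝ≥0 → ℝ) (i : Fin k) (t : ℝ≥0)
    (h1 : ((i : ℕ) : ℝ≥0) / k < t) (h2 : t ≤ ((i : ℕ) + 1) / k) :
    concat f t = concat f ((i : ℕ) / k) + f i (t - (i : ℕ) / k) := by
  have hk : (0 : ℝ≥0) < k := by exact_mod_cast i.pos
  have hle : ∀ a b : ℕ, a ≤ b → (a : ℝ≥0) / k ≤ b / k := fun a b h => by gcongr
  have hlt : ∀ a b : ℕ, a < b → (a : ℝ≥0) / k < b / k := fun a b h => by gcongr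
  have hi : ∑ j : Fin k, (if j = i then f i (t - (i : ℕ) / k) else 0)
      = f i (t - (i : ℕ) / k) := by simp
  unfold concat
  rw [← hi, ← Finset.sum_add_distrib]
  refine Finset.sum_congr rfl fun j _ => ?_
  have hc : ∀ a : ℕ, ((a : ℝ≥0) + 1) / k = ((a + 1 : ℕ) : ℝ≥0) / k := fun a => by push_cast; rfl
  rw [hc] at h2 ⊢
  rcases lt_trichotomy (j : ℕ) i with h | h | h
  · have hne : j ≠ i := fun e => by simp [e] at h
    rw [if_pos ((hle _ _ h).trans h1.le), if_pos (hle _ _ h), if_neg hne, add_zero]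
  · have he : j = i := Fin.ext h
    subst he
    have h3 := not_le.2 (hlt (j : ℕ) (j + 1) (Nat.lt_succ_self _))
    rw [if_neg h3, if_neg (lt_irrefl _), if_pos rfl, zero_add]
    by_cases h4 : (((j : ℕ) + 1 : ℕ) : ℝ≥0) / k ≤ t
    · rw [if_pos h4, le_antisymm h2 h4, ← tsub_div]
      congr 2
      push_cast
      exact (add_tsub_cancel_left _ _).symm
    · rw [if_neg h4, if_pos h1]
  · have hne : j ≠ i := fun e => by simp [e] at h
    have h5 : t ≤ ((j : ℕ) : ℝ≥0) / k := h2.trans (hle _ _ h)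
    have h6 : t < (((j : ℕ) + 1 : ℕ) : ℝ≥0) / k := h5.trans_lt (hlt _ _ (Nat.lt_succ_self _))
    rw [if_neg (not_le.2 h6), if_neg (not_lt.2 h5),
      if_neg (not_le.2 (hlt _ _ (h.trans (Nat.lt_succ_self _)))),
      if_neg (not_lt.2 (hle _ _ h.le)), if_neg hne, add_zero]

/-- The ingredients, besides the process `X`, of the two couplings with `k` increments: the function
`h` coupling the end-points, the uniforms `U` and `Us i`, the Brownian bridge `bridge` on `[0, 1]`,
and the Brownian bridges `bridges i` on `[0, 1/k]`. Their laws and their independence are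
in `Ingredients.Valid`. -/
structure Ingredients (Ω : Type*) (k : ℕ) where
  h : ℝ → ℝ → ℝ
  U : Ω → ℝ
  Us : Fin k → Ω → ℝ
  bridge : ℝ≥0 → Ω → ℝ
  bridges : Fin k → ℝ≥0 → Ω → ℝ

/-- Labels of the mutually independent sources of randomness. -/
inductive Source (k : ℕ)
  | levy
  | uniform
  | uniforms (i : Fin k)
  | bridge
  | bridges (i : Fin k)

namespace Ingredients

/-- The σ-algebra generated by each of the sources of randomness. -/
@[reducible]
def sigma {Ω : Type*} {k : ℕ} (R : Ingredients Ω k) (X : ℝ≥0 → Ω → ℝ) :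
    Source k → MeasurableSpace Ω
  | .levy => MeasurableSpace.comap (fun ω (t : ℝ≥0) => X t ω) inferInstance
  | .uniform => MeasurableSpace.comap R.U inferInstance
  | .uniforms i => MeasurableSpace.comap (R.Us i) inferInstance
  | .bridge => MeasurableSpace.comap (fun ω (t : Set.Iic (1 : ℝ≥0)) => R.bridge t ω) inferInstance
  | .bridges i =>
      MeasurableSpace.comap (fun ω (t : Set.Iic (1 / k : ℝ≥0)) => R.bridges i t ω) inferInstance

/-- The requirements on the ingredients. The function `h` is arbitrary up to the requirement that
`h (X 1) U` be standard normal, so that any coupling of the end-points is allowed. -/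
structure Valid {Ω : Type*} [MeasurableSpace Ω] {k : ℕ} (R : Ingredients Ω k)
    (X : ℝ≥0 → Ω → ℝ) (P : Measure Ω) : Prop where
  measurable_h : Measurable (Function.uncurry R.h)
  measurable_U : Measurable R.U
  measurable_Us : ∀ i, Measurable (R.Us i)
  uniform : pdf.IsUniform R.U (Set.Icc 0 1) P
  uniforms : ∀ i, pdf.IsUniform (R.Us i) (Set.Icc 0 1) P
  bridge : IsBrownianBridge 1 R.bridge P
  bridges : ∀ i, IsBrownianBridge (1 / k) (R.bridges i) P
  indep : iIndep (R.sigma X) P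
  endpoint : HasLaw (fun ω => R.h (X 1 ω) (R.U ω)) (gaussianReal 0 1) P

/-- The Brownian motion `W'` on `[0, 1]` with `W'(1) = h(X(1), U)` and with an independent bridge,
before reordering. -/
noncomputable def W' {Ω : Type*} {k : ℕ} (R : Ingredients Ω k) (X : ℝ≥0 → Ω → ℝ)
    (t : ℝ≥0) (ω : Ω) : ℝ :=
  R.bridge t ω + t * R.h (X 1 ω) (R.U ω)

/-- The random permutation `π`. -/
noncomputable def perm {Ω : Type*} {k : ℕ} (R : Ingredients Ω k) (X : ℝ≥0 → Ω → ℝ)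
    (ω : Ω) : Equiv.Perm (Fin k) :=
  reordering (incr k fun t => X t ω) (fun i => R.Us i ω) (incr k fun t => R.W' X t ω)

/-- The reordering coupling `W` on `[0, 1]`. -/
noncomputable def W {Ω : Type*} {k : ℕ} (R : Ingredients Ω k) (X : ℝ≥0 → Ω → ℝ)
    (t : ℝ≥0) (ω : Ω) : ℝ :=
  concat (fun (i : Fin k) s =>
    R.W' X ((R.perm X ω i : ℕ) / k + s) ω - R.W' X ((R.perm X ω i : ℕ) / k) ω) t

/-- The Brownian increments `ξ i` coupled comonotonically with the increments of `X`. -/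
noncomputable def xi {Ω : Type*} [MeasurableSpace Ω] {k : ℕ} (R : Ingredients Ω k)
    (X : ℝ≥0 → Ω → ℝ) (P : Measure Ω) (i : Fin k) (ω : Ω) : ℝ :=
  comonotone (P.map (X (1 / k))) (gaussianReal 0 (1 / k)) (incr k (fun t => X t ω) i) (R.Us i ω)

/-- The auxiliary coupling `Ŵ` on `[0, 1]`, by comonotonic coupling of increments. -/
noncomputable def What {Ω : Type*} [MeasurableSpace Ω] {k : ℕ} (R : Ingredients Ω k)
    (X : ℝ≥0 → Ω → ℝ) (P : Measure Ω) (t : ℝ≥0) (ω : Ω) : ℝ :=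
  concat (fun (i : Fin k) s => R.bridges i s ω + k * s * R.xi X P i ω) t

end Ingredients

/-- `E |Y(1) - Z(1)|²`, possibly infinite. -/
noncomputable def endError {Ω : Type*} [MeasurableSpace Ω] (P : Measure Ω)
    (Y Z : ℝ≥0 → Ω → ℝ) : ℝ≥0∞ :=
  ∫⁻ ω, ENNReal.ofReal (|Y 1 ω - Z 1 ω| ^ 2) ∂P

/-- `E sup_{t ∈ [0, 1]} |Y(t) - Z(t)|²`, possibly infinite. -/
noncomputable def supError {Ω : Type*} [MeasurableSpace Ω] (P : Measure Ω)
    (Y Z : ℝ≥0 → Ω → ℝ) : ℝ≥0∞ :=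
  ∫⁻ ω, ⨆ t ∈ Set.Icc (0 : ℝ≥0) 1, ENNReal.ofReal (|Y t ω - Z t ω| ^ 2) ∂P

/-- `a n = O(ε n)` as `n → ∞`, for a sequence of extended nonnegative numbers `a`. -/
def IsBigOSeq (a : ℕ → ℝ≥0∞) (ε : ℕ → ℝ) : Prop :=
  ∃ C : ℝ≥0, ∀ᶠ n in atTop, a n ≤ C * ENNReal.ofReal (ε n)

end LevyCoupling

namespace LevyCoupling

/-! ### Maxima of finitely many Gaussian variables. -/

section GaussianMaxima

/-! Both couplings arrange `k` Gaussian increments in the order of the increments of `X`: `W` uses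
those of `W'`, permuted, and `Ŵ` uses the `ξ i`. Everything reduces to one estimate,
`Ingredients.Valid.exists_majorant_sub`: E sup |W - Ŵ|² is at most a constant times (log k)/k plus
the mean squared errors of both couplings at time 1. The end error is dominated by the supremum
error, so the triangle inequality yields both implications, and the lower bound on ε k / log k
absorbs (log k)/k.

Let d_i be the difference of the i-th increments of W and Ŵ. At grid points W - Ŵ is a partial sum
of d. Between them it is the linear interpolation of these sums plus oscillations of Brownian
bridges over intervals of length 1/k; the maximum of the latter costs (log k)/k in mean square, by
exponential moments and dyadic chaining.

The partial sums are handled by exchangeability. Since X(1) is the sum of the increments of X,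
permuting these together with their tie-breaking uniforms leaves the increments of W' unchanged and
permutes d. For a centred exchangeable vector, the partial sums divided by the number of remaining
terms form a martingale, and Doob's inequality bounds the maximal squared partial sum by E Σ d_i²
and E (Σ d_i)² (`Exchangeable.exists_majorant`). The total Σ d_i is W(1) - Ŵ(1), which the end
errors control.

It remains to bound E Σ d_i². Both families of increments are i.i.d. N(0, 1/k) samples arranged in
the same order, so Σ d_i² is the squared distance of their vectors of order statistics. Their joint
law is irrelevant: each vector is within O((log k)/k), in mean square, of the same deterministic
vector of normal quantiles (`exists_lintegral_sum_ordStat_sub_sq_le_of_var`). Indeed, the positive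
parts of the order statistics have means at least the positive parts of the quantiles, while their
second moments add up to that of the sample, which the sum of the squared quantiles matches as a
Riemann sum up to O(log k) for unit variance. -/

theorem lintegral_exp_sq_gaussianReal :
    ∫⁻ x, ENNReal.ofReal (Real.exp (x ^ 2 / 4)) ∂(gaussianReal 0 1) ≤ 2 := by
  rw [gaussianReal_of_var_ne_zero _ one_ne_zero,
    lintegral_withDensity_eq_lintegral_mul _ (measurable_gaussianPDF 0 1) (by fun_prop)]
  have h : ∀ x : ℝ, (gaussianPDF 0 1 * fun x => ENNReal.ofReal (Real.exp (x ^ 2 / 4))) x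
      = ENNReal.ofReal ((√(2 * Real.pi))⁻¹ * Real.exp (-(1 / 4) * x ^ 2)) := by
    intro x
    simp only [Pi.mul_apply, gaussianPDF, gaussianPDFReal]
    rw [← ENNReal.ofReal_mul (by positivity), mul_assoc, ← Real.exp_add]
    congr 2
    · simp
    · congr 1
      simp
      ring
  rw [lintegral_congr h, ← ofReal_integral_eq_lintegral_ofReal
    ((integrable_exp_neg_mul_sq (by norm_num)).const_mul _)
    (ae_of_all _ fun x => by positivity), integral_const_mul, integral_gaussian]
  rw [← Real.sqrt_inv, ← Real.sqrt_mul (by positivity)]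
  -- The exact value of the integral is √2; the bound 2 is kept for simplicity.
  have : (2 * Real.pi)⁻¹ * (Real.pi / (1 / 4)) = 2 := by
    have := Real.pi_ne_zero
    field_simp
    norm_num
  rw [this, show (2 : ℝ≥0∞) = ENNReal.ofReal 2 by simp]
  exact ENNReal.ofReal_le_ofReal (Real.sqrt_le_left (by norm_num) |>.2 (by norm_num))

theorem lintegral_exp_sq_div_gaussianReal {v : ℝ≥0} {s : ℝ} (hs : 0 < s) (hv : (v : ℝ) ≤ s) :
    ∫⁻ x, ENNReal.ofReal (Real.exp (x ^ 2 / (4 * s))) ∂(gaussianReal 0 v) ≤ 2 := by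
  have h := gaussianReal_map_const_mul (μ := 0) (v := 1) (√(v : ℝ))
  have hv' : NNReal.mk (√(v : ℝ) ^ 2) (sq_nonneg _) * 1 = v := by
    ext; simp
  rw [hv', mul_zero] at h
  rw [← h, lintegral_map (by fun_prop) (by fun_prop)]
  refine le_trans (lintegral_mono fun x => ENNReal.ofReal_le_ofReal (Real.exp_le_exp.2 ?_))
    lintegral_exp_sq_gaussianReal
  rw [mul_pow, Real.sq_sqrt v.coe_nonneg, div_le_div_iff₀ (by positivity) (by positivity)]
  nlinarith [sq_nonneg x]

/-- The inequality 1 + x ≤ exp x at x = y - log N. Used for N values of y at once, it bounds their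
maximum by log N plus the average of the exponentials. -/
theorem le_log_add_exp_div {N : ℝ} (hN : 0 < N) (y : ℝ) : y ≤ Real.log N + Real.exp y / N := by
  have h := Real.add_one_le_exp (y - Real.log N)
  rw [Real.exp_sub, Real.exp_log hN] at h
  linarith

/-- The expected maximal square of finitely many centered Gaussian variables, whatever their
dependence. -/
theorem lintegral_iSup_sq_le {Ω ι : Type*} [MeasurableSpace Ω] {P : Measure Ω}
    [IsProbabilityMeasure P] [Fintype ι] [Nonempty ι] {Z : ι → Ω → ℝ} (hZ : ∀ i, Measurable (Z i))
    {s : ℝ} (hs : 0 < s)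
    (hlaw : ∀ i, ∃ v : ℝ≥0, (v : ℝ) ≤ s ∧ P.map (Z i) = gaussianReal 0 v) :
    ∫⁻ ω, ⨆ i, ENNReal.ofReal (Z i ω ^ 2) ∂P
      ≤ ENNReal.ofReal (4 * s * (Real.log (Fintype.card ι) + 2)) := by
  set N : ℝ := (Fintype.card ι : ℝ) with hN
  have hN1 : 1 ≤ N := by
    rw [hN]; exact_mod_cast Fintype.card_pos
  have hlog : 0 ≤ Real.log N := Real.log_nonneg hN1
  -- Apply `le_log_add_exp_div` with y = Z²/(4s) and enlarge the single exponential to the sum over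
  -- all indices. Each exponential has mean at most 2, so the N terms divided by N contribute 4s ·
  -- 2.
  have hpt : ∀ ω, ⨆ i, ENNReal.ofReal (Z i ω ^ 2) ≤ ENNReal.ofReal (4 * s * Real.log N)
      + ENNReal.ofReal (4 * s / N) * ∑ i, ENNReal.ofReal (Real.exp (Z i ω ^ 2 / (4 * s))) := by
    intro ω
    refine iSup_le fun i => ?_
    calc ENNReal.ofReal (Z i ω ^ 2)
        ≤ ENNReal.ofReal (4 * s * Real.log N
            + 4 * s / N * Real.exp (Z i ω ^ 2 / (4 * s))) := by
          refine ENNReal.ofReal_le_ofReal ?_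
          have h := le_log_add_exp_div (by positivity : 0 < N) (Z i ω ^ 2 / (4 * s))
          rw [div_le_iff₀ (by positivity)] at h
          calc _ ≤ _ := h
            _ = _ := by ring
      _ = ENNReal.ofReal (4 * s * Real.log N)
            + ENNReal.ofReal (4 * s / N) * ENNReal.ofReal (Real.exp (Z i ω ^ 2 / (4 * s))) := by
          rw [ENNReal.ofReal_add (by positivity) (by positivity),
            ENNReal.ofReal_mul (by positivity : 0 ≤ 4 * s / N)]
      _ ≤ _ := by
          gcongr
          exact Finset.single_le_sum
            (f := fun i => ENNReal.ofReal (Real.exp (Z i ω ^ 2 / (4 * s))))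
            (fun _ _ => zero_le) (Finset.mem_univ i)
  have hinteg : ∀ i, ∫⁻ ω, ENNReal.ofReal (Real.exp (Z i ω ^ 2 / (4 * s))) ∂P ≤ 2 := by
    intro i
    obtain ⟨v, hv, h⟩ := hlaw i
    have := lintegral_exp_sq_div_gaussianReal hs hv
    rwa [← h, lintegral_map (by fun_prop) (hZ i)] at this
  calc ∫⁻ ω, ⨆ i, ENNReal.ofReal (Z i ω ^ 2) ∂P
      ≤ ∫⁻ ω, (ENNReal.ofReal (4 * s * Real.log N) + ENNReal.ofReal (4 * s / N) *
          ∑ i, ENNReal.ofReal (Real.exp (Z i ω ^ 2 / (4 * s)))) ∂P := lintegral_mono hpt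
    _ = ENNReal.ofReal (4 * s * Real.log N) + ENNReal.ofReal (4 * s / N) *
          ∑ i, ∫⁻ ω, ENNReal.ofReal (Real.exp (Z i ω ^ 2 / (4 * s))) ∂P := by
        rw [lintegral_add_left measurable_const, lintegral_const, measure_univ, mul_one,
          lintegral_const_mul _ (Finset.measurable_fun_sum _ fun i _ => by fun_prop),
          lintegral_finsetSum _ fun i _ => by fun_prop]
    _ ≤ ENNReal.ofReal (4 * s * Real.log N) + ENNReal.ofReal (4 * s / N) * ∑ _i : ι, 2 := by
        gcongr with i
        exact hinteg i
    _ = ENNReal.ofReal (4 * s * (Real.log N + 2)) := by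
        have : (∑ _i : ι, 2 : ℝ≥0∞) = ENNReal.ofReal (N * 2) := by
          rw [ENNReal.ofReal_mul (by positivity), hN]
          simp
        rw [this, ← ENNReal.ofReal_mul (by positivity), ← ENNReal.ofReal_add (by positivity)
          (by positivity)]
        congr 1
        field_simp

end GaussianMaxima

/-! ### Dyadic chaining for continuous paths. -/

section Chaining

/-- Chaining along dyadic points: a continuous function on `[0, T]` is bounded in terms of its
dyadic increments. -/
theorem ofReal_sq_le_tsum_dyadic {T : ℝ≥0} (hT : 0 < T) {f : ℝ≥0 → ℝ} (h0 : f 0 = 0)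
    (hf : ContinuousOn f (Set.Iic T)) {D : ℕ → ℝ≥0∞}
    (hD : ∀ m j : ℕ, j < 2 ^ m →
      ENNReal.ofReal ((f (T * ((j : ℝ≥0) + 1) / 2 ^ m) - f (T * (j : ℝ≥0) / 2 ^ m)) ^ 2) ≤ D m)
    {t : ℝ≥0} (ht : t ≤ T) :
    ENNReal.ofReal (f t ^ 2) ≤ 4 * ∑' m, ENNReal.ofReal ((4 / 3) ^ m) * D m := by
  -- The point `q m` is the last point of the dyadic grid of level m, scaled to [0, T], that does
  -- not exceed t.
  set c : ℕ → ℕ := fun m => ⌊t * 2 ^ m / T⌋₊ with hc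
  set q : ℕ → ℝ≥0 := fun m => T * (c m : ℝ≥0) / 2 ^ m with hq
  have hqt : ∀ m, q m ≤ t := by
    intro m
    have h : (c m : ℝ≥0) ≤ t * 2 ^ m / T := Nat.floor_le zero_le
    calc q m ≤ T * (t * 2 ^ m / T) / 2 ^ m := by simp only [hq]; gcongr
      _ = t := by field_simp
  have hcle : ∀ m, c m ≤ 2 ^ m := by
    intro m
    have h : (c m : ℝ≥0) ≤ t * 2 ^ m / T := Nat.floor_le zero_le
    have h2 : t * 2 ^ m / T ≤ 2 ^ m := by
      rw [div_le_iff₀ hT, mul_comm]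
      gcongr
    exact_mod_cast h.trans h2
  have hlim : Tendsto q atTop (𝓝 t) := by
    have hlow : ∀ m, t ≤ q m + T * (1 / 2) ^ m := by
      intro m
      have h : t * 2 ^ m / T < c m + 1 := Nat.lt_floor_add_one _
      calc t = T * (t * 2 ^ m / T) / 2 ^ m := by field_simp
        _ ≤ T * (c m + 1) / 2 ^ m := by gcongr
        _ = q m + T * (1 / 2) ^ m := by
          simp only [hq]
          rw [div_pow, one_pow]
          field_simp
    have hz : Tendsto (fun m : ℕ => T * (1 / 2 : ℝ≥0) ^ m) atTop (𝓝 0) := by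
      have h := (tendsto_pow_atTop_nhds_zero_of_lt_one (𝕜 := ℝ) (r := 1 / 2) (by norm_num)
        (by norm_num)).const_mul (T : ℝ)
      rw [mul_zero] at h
      rw [← NNReal.tendsto_coe]
      simpa using h
    rw [← NNReal.tendsto_coe]
    rw [← NNReal.tendsto_coe] at hz
    have h1 := (tendsto_const_nhds (x := (t : ℝ))).sub hz
    simp only [NNReal.coe_zero, sub_zero] at h1
    refine tendsto_of_tendsto_of_tendsto_of_le_of_le h1 tendsto_const_nhds (fun m => ?_)
      (fun m => by exact_mod_cast hqt m)
    have := hlow m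
    have h2 : (t : ℝ) ≤ q m + (T * (1 / 2) ^ m : ℝ≥0) := by exact_mod_cast this
    exact sub_le_iff_le_add.2 h2
  -- Telescoping links of the chain: each is zero or a single dyadic increment of level m.
  set r : ℕ → ℝ := fun m => f (q m) - if m = 0 then 0 else f (q (m - 1)) with hr
  have hsum : ∀ n, f (q n) = ∑ m ∈ Finset.range (n + 1), r m := by
    intro n
    induction n with
    | zero => simp [hr]
    | succ n ih => rw [Finset.sum_range_succ, ← ih]; simp [hr]
  have hstep : ∀ m, q (m + 1) = q m ∨ ∃ j : ℕ, j < 2 ^ (m + 1) ∧ q m = T * (j : ℝ≥0) / 2 ^ (m + 1)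
      ∧ q (m + 1) = T * ((j : ℝ≥0) + 1) / 2 ^ (m + 1) := by
    intro m
    have hq2 : q m = T * ((2 * c m : ℕ) : ℝ≥0) / 2 ^ (m + 1) := by
      simp only [hq]
      rw [pow_succ]
      push_cast
      field_simp
    have hlo : 2 * c m ≤ c (m + 1) := by
      refine Nat.le_floor ?_
      have h : (c m : ℝ≥0) ≤ t * 2 ^ m / T := Nat.floor_le zero_le
      calc ((2 * c m : ℕ) : ℝ≥0) = 2 * c m := by push_cast; rfl
        _ ≤ 2 * (t * 2 ^ m / T) := by gcongr
        _ = t * 2 ^ (m + 1) / T := by rw [pow_succ]; ring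
    have hhi : c (m + 1) < 2 * c m + 2 := by
      refine (Nat.floor_lt zero_le).2 ?_
      have h : t * 2 ^ m / T < c m + 1 := Nat.lt_floor_add_one _
      calc t * 2 ^ (m + 1) / T = 2 * (t * 2 ^ m / T) := by rw [pow_succ]; ring
        _ < 2 * (c m + 1) := by gcongr
        _ = _ := by push_cast; ring
    rcases (by omega : c (m + 1) = 2 * c m ∨ c (m + 1) = 2 * c m + 1) with h | h
    · left
      rw [hq2]
      simp only [hq, h]
    · right
      refine ⟨2 * c m, ?_, hq2, ?_⟩
      · have := hcle (m + 1)
        omega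
      · simp only [hq, h]
        push_cast
        rfl
  have hrD : ∀ m, ENNReal.ofReal (r m ^ 2) ≤ D m := by
    intro m
    rcases m with _ | m
    · simp only [hr, if_true, sub_zero]
      -- At level zero the chain starts at 0, or at T when t = T; `h0` turns the value f(T) into an
      -- increment.
      rcases (by have := hcle 0; simp at this; omega : c 0 = 0 ∨ c 0 = 1) with h | h
      · simp [hq, h, h0]
      · have := hD 0 0 (by norm_num)
        simpa [hq, h, h0] using this
    · simp only [hr, Nat.add_sub_cancel, Nat.succ_ne_zero, if_false]
      rcases hstep m with h | ⟨j, hj, h1, h2⟩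
      · simp [h]
      · rw [h1, h2]
        exact hD _ _ hj
  have hfin : ∀ n, ENNReal.ofReal (f (q n) ^ 2) ≤ 4 * ∑' m, ENNReal.ofReal ((4 / 3) ^ m) * D m := by
    intro n
    -- Cauchy–Schwarz with weights (3/4)^m, of total mass 4. The inverse weights (4/3)^m grow more
    -- slowly than 2^m, the rate at which the variances of the dyadic increments decay.
    have hcs := Finset.sum_sq_le_sum_mul_sum_of_sq_le_mul (Finset.range (n + 1)) (r := r)
      (f := fun m => (3 / 4 : ℝ) ^ m) (g := fun m => (4 / 3 : ℝ) ^ m * r m ^ 2)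
      (fun _ _ => by positivity) (fun _ _ => by positivity) (fun m _ => by
        rw [← mul_assoc, ← mul_pow]; norm_num)
    have hgeo : ∑ m ∈ Finset.range (n + 1), (3 / 4 : ℝ) ^ m ≤ 4 := by
      rw [geom_sum_eq (by norm_num)]
      have : (0 : ℝ) ≤ (3 / 4) ^ (n + 1) := by positivity
      rw [div_le_iff_of_neg (by norm_num)]
      linarith
    rw [hsum]
    calc ENNReal.ofReal ((∑ m ∈ Finset.range (n + 1), r m) ^ 2)
        ≤ ENNReal.ofReal (4 * ∑ m ∈ Finset.range (n + 1), (4 / 3 : ℝ) ^ m * r m ^ 2) := by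
          refine ENNReal.ofReal_le_ofReal (hcs.trans ?_)
          gcongr
      _ = 4 * ∑ m ∈ Finset.range (n + 1), ENNReal.ofReal ((4 / 3) ^ m) *
            ENNReal.ofReal (r m ^ 2) := by
          rw [ENNReal.ofReal_mul (by norm_num), ENNReal.ofReal_sum_of_nonneg
            (fun _ _ => by positivity)]
          simp_rw [ENNReal.ofReal_mul (by positivity : (0 : ℝ) ≤ (4 / 3) ^ _)]
          simp
      _ ≤ 4 * ∑ m ∈ Finset.range (n + 1), ENNReal.ofReal ((4 / 3) ^ m) * D m := by
          gcongr with m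
          exact hrD m
      _ ≤ _ := by
          gcongr
          exact ENNReal.sum_le_tsum _
  have hft : Tendsto (fun n => f (q n)) atTop (𝓝 (f t)) :=
    (hf t ht).tendsto.comp (tendsto_nhdsWithin_iff.2
      ⟨hlim, Eventually.of_forall fun n => (hqt n).trans ht⟩)
  exact le_of_tendsto ((ENNReal.continuous_ofReal.tendsto _).comp (hft.pow 2))
    (Eventually.of_forall hfin)

/-- The expected maximum over finitely many centered processes with Gaussian increments of Brownian
size on `[0, T]`, bounded through a measurable majorant. -/
theorem exists_majorant_of_gaussian_increments {Ω ι : Type*} [MeasurableSpace Ω] {P : Measure Ω}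
    [IsProbabilityMeasure P] [Fintype ι] [Nonempty ι] {T : ℝ≥0} (hT : 0 < T)
    {Y : ι → ℝ≥0 → Ω → ℝ} (hY : ∀ i, ∀ t ≤ T, Measurable (Y i t))
    (h0 : ∀ i, ∀ᵐ ω ∂P, Y i 0 ω = 0)
    (hcont : ∀ i, ∀ᵐ ω ∂P, ContinuousOn (fun t => Y i t ω) (Set.Iic T))
    (hlaw : ∀ i, ∀ s t : ℝ≥0, s ≤ t → t ≤ T → ∃ v : ℝ≥0, (v : ℝ) ≤ t - s ∧
      P.map (fun ω => Y i t ω - Y i s ω) = gaussianReal 0 v) :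
    ∃ G : Ω → ℝ≥0∞, Measurable G ∧
      (∀ᵐ ω ∂P, ∀ i, ∀ t ≤ T, ENNReal.ofReal (Y i t ω ^ 2) ≤ G ω) ∧
      ∫⁻ ω, G ω ∂P ≤ ENNReal.ofReal (144 * T * (Real.log (Fintype.card ι) + 2)) := by
  set D : ℕ → Ω → ℝ≥0∞ := fun m ω => ⨆ p : ι × Fin (2 ^ m), ENNReal.ofReal
    ((Y p.1 (T * (((p.2 : ℕ) : ℝ≥0) + 1) / 2 ^ m) ω - Y p.1 (T * ((p.2 : ℕ) : ℝ≥0) / 2 ^ m) ω) ^ 2)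
    with hD
  have hle1 : ∀ m (j : Fin (2 ^ m)), T * (((j : ℕ) : ℝ≥0) + 1) / 2 ^ m ≤ T := by
    intro m j
    have h : ((j : ℕ) : ℝ≥0) + 1 ≤ 2 ^ m := by exact_mod_cast j.2
    calc _ ≤ T * 2 ^ m / 2 ^ m := by gcongr
      _ = T := by field_simp
  have hle2 : ∀ m (j : Fin (2 ^ m)),
      T * ((j : ℕ) : ℝ≥0) / 2 ^ m ≤ T * (((j : ℕ) : ℝ≥0) + 1) / 2 ^ m := by
    intro m j
    gcongr
    exact le_self_add
  have hmeas : ∀ m (p : ι × Fin (2 ^ m)), Measurable fun ω =>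
      Y p.1 (T * (((p.2 : ℕ) : ℝ≥0) + 1) / 2 ^ m) ω - Y p.1 (T * ((p.2 : ℕ) : ℝ≥0) / 2 ^ m) ω :=
    fun m p => (hY _ _ (hle1 m p.2)).sub (hY _ _ ((hle2 m p.2).trans (hle1 m p.2)))
  have hDm : ∀ m, Measurable (D m) := fun m =>
    Measurable.iSup fun p => ENNReal.measurable_ofReal.comp ((hmeas m p).pow_const 2)
  have hDint : ∀ m, ∫⁻ ω, D m ω ∂P
      ≤ ENNReal.ofReal (4 * (T / 2 ^ m) * (Real.log (Fintype.card (ι × Fin (2 ^ m))) + 2)) := by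
    intro m
    refine lintegral_iSup_sq_le (hmeas m) (by positivity) fun p => ?_
    obtain ⟨v, hv, h⟩ := hlaw p.1 _ _ (hle2 m p.2) (hle1 m p.2)
    refine ⟨v, hv.trans (le_of_eq ?_), h⟩
    push_cast
    ring
  set L : ℝ := Real.log (Fintype.card ι : ℝ) with hL
  have hL0 : 0 ≤ L := Real.log_nonneg (by exact_mod_cast Fintype.card_pos)
  have hlogle : ∀ m : ℕ, Real.log (Fintype.card (ι × Fin (2 ^ m))) + 2 ≤ (L + 2) * (m + 1) := by
    intro m
    rw [Fintype.card_prod, Fintype.card_fin]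
    push_cast
    rw [Real.log_mul (by simp) (by positivity), Real.log_pow]
    have : Real.log 2 ≤ 1 := by
      have := Real.log_le_sub_one_of_pos (show (0 : ℝ) < 2 by norm_num)
      linarith
    nlinarith [mul_nonneg hL0 (Nat.cast_nonneg (α := ℝ) m), Nat.cast_nonneg (α := ℝ) m]
  -- The ratio 2/3 is (4/3)/2: chaining weight times decay of variance. The final constant is 4 · 4
  -- · 9 = 144.
  have hser : HasSum (fun m : ℕ => ((m : ℝ) + 1) * (2 / 3) ^ m) 9 := by
    have h1 := hasSum_coe_mul_geometric_of_norm_lt_one (𝕜 := ℝ) (r := 2 / 3) (by norm_num)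
    have h2 := hasSum_geometric_of_lt_one (r := (2 / 3 : ℝ)) (by norm_num) (by norm_num)
    have h3 := h1.add h2
    norm_num at h3
    refine h3.congr_fun ?_ |> fun h => h
    intro m
    ring
  refine ⟨fun ω => 4 * ∑' m, ENNReal.ofReal ((4 / 3) ^ m) * D m ω, ?_, ?_, ?_⟩
  · exact (Measurable.tsum fun m => (hDm m).const_mul _).const_mul _
  · filter_upwards [ae_all_iff.2 h0, ae_all_iff.2 hcont] with ω h1 h2 i t ht
    refine ofReal_sq_le_tsum_dyadic hT (h1 i) (h2 i) (fun m j hj => ?_) ht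
    exact le_iSup (fun p : ι × Fin (2 ^ m) => ENNReal.ofReal
      ((Y p.1 (T * (((p.2 : ℕ) : ℝ≥0) + 1) / 2 ^ m) ω
        - Y p.1 (T * ((p.2 : ℕ) : ℝ≥0) / 2 ^ m) ω) ^ 2)) (i, ⟨j, hj⟩)
  · rw [lintegral_const_mul _ (Measurable.tsum fun m => (hDm m).const_mul _),
      lintegral_tsum fun m => ((hDm m).const_mul _).aemeasurable]
    calc 4 * ∑' m, ∫⁻ ω, ENNReal.ofReal ((4 / 3) ^ m) * D m ω ∂P
        ≤ 4 * ∑' m : ℕ, ENNReal.ofReal (4 * T * (L + 2) * (((m : ℝ) + 1) * (2 / 3) ^ m)) := by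
          gcongr with m
          rw [lintegral_const_mul _ (hDm m)]
          calc _ ≤ ENNReal.ofReal ((4 / 3) ^ m) *
                ENNReal.ofReal (4 * (T / 2 ^ m) * ((L + 2) * (m + 1))) := by
                gcongr
                refine (hDint m).trans (ENNReal.ofReal_le_ofReal ?_)
                gcongr
                exact hlogle m
            _ = _ := by
                rw [← ENNReal.ofReal_mul (by positivity)]
                congr 1
                rw [show (2 / 3 : ℝ) = (4 / 3) / 2 by norm_num, div_pow (4 / 3 : ℝ) 2]
                ring
      _ = 4 * ENNReal.ofReal (4 * T * (L + 2) * 9) := by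
          rw [← ENNReal.ofReal_tsum_of_nonneg (fun m => by positivity)
            (hser.mul_left _).summable, (hser.mul_left _).tsum_eq]
      _ = ENNReal.ofReal (144 * T * (L + 2)) := by
          rw [show (4 : ℝ≥0∞) = ENNReal.ofReal 4 by simp, ← ENNReal.ofReal_mul (by norm_num)]
          congr 1
          ring

end Chaining

/-! ### Maximal inequalities for exchangeable vectors. -/

section Exchangeable

/-- The sum of the first `m` coordinates. -/
def partialSum {k : ℕ} (y : Fin k → ℝ) (m : ℕ) : ℝ :=
  ∑ i ∈ Finset.univ.filter (fun i : Fin k => (i : ℕ) < m), y i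

/-- Invariance of a law on `Fin k → ℝ` under permutations of the coordinates. -/
def Exchangeable {k : ℕ} (ρ : Measure (Fin k → ℝ)) : Prop :=
  ∀ τ : Equiv.Perm (Fin k), ρ.map (fun y => y ∘ τ) = ρ

theorem measurable_comp_perm {k : ℕ} (τ : Equiv.Perm (Fin k)) :
    Measurable fun y : Fin k → ℝ => y ∘ τ :=
  measurable_pi_lambda _ fun i => measurable_pi_apply (τ i)

@[fun_prop]
theorem measurable_partialSum {k : ℕ} (m : ℕ) :
    Measurable fun y : Fin k → ℝ => partialSum y m := by
  unfold partialSum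
  fun_prop

theorem partialSum_comp_of_fix {k : ℕ} (y : Fin k → ℝ) {m : ℕ} {τ : Equiv.Perm (Fin k)}
    (hτ : ∀ a : Fin k, (a : ℕ) < m → τ a = a) : partialSum (y ∘ τ) m = partialSum y m :=
  Finset.sum_congr rfl fun a ha => by
    rw [Function.comp_apply, hτ a (by simpa using ha)]

theorem partialSum_zero {k : ℕ} (y : Fin k → ℝ) : partialSum y 0 = 0 := by
  simp [partialSum]

theorem partialSum_self {k : ℕ} (y : Fin k → ℝ) : partialSum y k = ∑ i, y i := by
  simp [partialSum]

theorem partialSum_succ {k : ℕ} (y : Fin k → ℝ) (i : Fin k) :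
    partialSum y (i + 1) = partialSum y i + y i := by
  unfold partialSum
  have : (Finset.univ.filter fun a : Fin k => (a : ℕ) < i + 1)
      = insert i (Finset.univ.filter fun a : Fin k => (a : ℕ) < i) := by
    ext a
    simp only [Finset.mem_filter, Finset.mem_univ, true_and, Finset.mem_insert, Fin.ext_iff]
    omega
  rw [this, Finset.sum_insert (by simp), add_comm]

theorem partialSum_add_sum_ge {k : ℕ} (y : Fin k → ℝ) (m : ℕ) :
    partialSum y m + ∑ i ∈ Finset.univ.filter (fun i : Fin k => m ≤ (i : ℕ)), y i = ∑ i, y i := by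
  unfold partialSum
  rw [← Finset.sum_filter_add_sum_filter_not Finset.univ (fun i : Fin k => (i : ℕ) < m) y]
  simp only [not_lt]

theorem partialSum_rev {k : ℕ} (y : Fin k → ℝ) {m : ℕ} (hm : m ≤ k) :
    partialSum (y ∘ Fin.revPerm) m
      = ∑ i ∈ Finset.univ.filter (fun i : Fin k => k - m ≤ (i : ℕ)), y i := by
  unfold partialSum
  refine Finset.sum_nbij' (fun i => Fin.rev i) (fun i => Fin.rev i) ?_ ?_ ?_ ?_ ?_
  · intro a ha
    simp only [Finset.mem_filter, Finset.mem_univ, true_and, Fin.val_rev] at ha ⊢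
    omega
  · intro a ha
    simp only [Finset.mem_filter, Finset.mem_univ, true_and, Fin.val_rev] at ha ⊢
    omega
  · simp
  · simp
  · simp

theorem Exchangeable.integral_comp {k : ℕ} {ρ : Measure (Fin k → ℝ)} (hρ : Exchangeable ρ)
    (τ : Equiv.Perm (Fin k)) {g : (Fin k → ℝ) → ℝ} (hg : Measurable g) :
    ∫ y, g (y ∘ τ) ∂ρ = ∫ y, g y ∂ρ := by
  conv_rhs => rw [← hρ τ]
  rw [integral_map (measurable_comp_perm τ).aemeasurable hg.aestronglyMeasurable]

theorem memLp_partialSum {k : ℕ} {ρ : Measure (Fin k → ℝ)} (h2 : ∀ i, MemLp (fun y => y i) 2 ρ)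
    (m : ℕ) : MemLp (fun y => partialSum y m) 2 ρ :=
  memLp_finsetSum _ fun i _ => h2 i

/-- Given the first `i` coordinates, the conditional expectation of the next one is the average of
the remaining ones. -/
theorem Exchangeable.integral_mul_next {k : ℕ} {ρ : Measure (Fin k → ℝ)} (hρ : Exchangeable ρ)
    (h2 : ∀ i, MemLp (fun y => y i) 2 ρ) (hz : ∀ᵐ y ∂ρ, ∑ i, y i = 0) (i : Fin k)
    {g : (Fin k → ℝ) → ℝ} (hgm : Measurable g) (hg : MemLp g 2 ρ)
    (hinv : ∀ τ : Equiv.Perm (Fin k), (∀ a : Fin k, a < i → τ a = a) → ∀ y, g (y ∘ τ) = g y) :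
    ((k : ℝ) - (i : ℕ)) * ∫ y, g y * y i ∂ρ = -∫ y, g y * partialSum y i ∂ρ := by
  -- Swapping i with a later index j does not affect g, so all later coordinates have the same
  -- integral against g; by `hz` they sum to minus the partial sum.
  have hswap : ∀ j : Fin k, i ≤ j → ∫ y, g y * y j ∂ρ = ∫ y, g y * y i ∂ρ := by
    intro j hj
    have h := hρ.integral_comp (Equiv.swap i j) (g := fun y => g y * y i)
      (hgm.mul (measurable_pi_apply i))
    rw [← h]
    refine integral_congr_ae (ae_of_all _ fun y => ?_)
    have : g (y ∘ Equiv.swap i j) = g y := hinv _ (fun a ha =>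
      Equiv.swap_apply_of_ne_of_ne ha.ne (ha.trans_le hj).ne) y
    simp [this]
  have hcard : ((Finset.univ.filter fun j : Fin k => (i : ℕ) ≤ j).card : ℝ) = k - (i : ℕ) := by
    have h1 : (Finset.univ.filter fun j : Fin k => (i : ℕ) ≤ j) = Finset.Ici i := by
      ext j; simp
    rw [h1, Fin.card_Ici, Nat.cast_sub i.2.le]
  have hsum : ∑ j ∈ Finset.univ.filter (fun j : Fin k => (i : ℕ) ≤ (j : ℕ)), ∫ y, g y * y j ∂ρ
      = ((k : ℝ) - (i : ℕ)) * ∫ y, g y * y i ∂ρ := by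
    rw [Finset.sum_congr rfl fun j hj => hswap j (by simpa using hj), Finset.sum_const,
      nsmul_eq_mul, hcard]
  have hinteg : ∀ j, Integrable (fun y : Fin k → ℝ => g y * y j) ρ := fun j =>
    hg.integrable_mul (h2 j)
  rw [← hsum, ← integral_finsetSum _ fun j _ => hinteg j, ← integral_neg]
  refine integral_congr_ae ?_
  filter_upwards [hz] with y hy
  have := partialSum_add_sum_ge y i
  rw [← Finset.mul_sum]
  rw [hy] at this
  rw [← mul_neg]
  congr 1
  linarith

/-- The coordinates are non-positively correlated: by exchangeability the products of distinct
coordinates have a common mean, and multiplying Σ y = 0 by one coordinate shows that it is not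
positive. Only the diagonal terms of the expanded square survive as an upper bound. -/
theorem Exchangeable.integral_partialSum_sq_le {k : ℕ} {ρ : Measure (Fin k → ℝ)}
    (hρ : Exchangeable ρ) (h2 : ∀ i, MemLp (fun y => y i) 2 ρ) (hz : ∀ᵐ y ∂ρ, ∑ i, y i = 0)
    (m : ℕ) : ∫ y, partialSum y m ^ 2 ∂ρ ≤ ∑ i, ∫ y, y i ^ 2 ∂ρ := by
  have hinteg : ∀ i j, Integrable (fun y : Fin k → ℝ => y i * y j) ρ := fun i j =>
    (h2 i).integrable_mul (h2 j)
  have hoff : ∀ i j : Fin k, i ≠ j → ∫ y, y i * y j ∂ρ ≤ 0 := by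
    intro i j hij
    have heq : ∀ l ∈ Finset.univ.erase i, ∫ y, y i * y l ∂ρ = ∫ y, y i * y j ∂ρ := by
      intro l hl
      have hli : l ≠ i := Finset.ne_of_mem_erase hl
      rw [← hρ.integral_comp (Equiv.swap j l) (g := fun y => y i * y j) (by fun_prop)]
      simp [Equiv.swap_apply_of_ne_of_ne hij hli.symm]
    have hzero : ∑ l, ∫ y, y i * y l ∂ρ = 0 := by
      rw [← integral_finsetSum _ fun l _ => hinteg i l]
      refine integral_eq_zero_of_ae ?_
      filter_upwards [hz] with y hy
      rw [← Finset.mul_sum, hy, mul_zero, Pi.zero_apply]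
    rw [← Finset.add_sum_erase _ _ (Finset.mem_univ i), Finset.sum_congr rfl heq,
      Finset.sum_const, nsmul_eq_mul] at hzero
    have hpos : 0 < ((Finset.univ.erase i).card : ℝ) := by
      exact_mod_cast Finset.card_pos.2 ⟨j, by simp [hij.symm]⟩
    have hsq : 0 ≤ ∫ y, y i * y i ∂ρ := integral_nonneg fun y => mul_self_nonneg _
    by_contra! h
    nlinarith [mul_pos hpos h]
  have hexp : ∀ y : Fin k → ℝ, partialSum y m ^ 2
      = ∑ i ∈ Finset.univ.filter (fun i : Fin k => (i : ℕ) < m),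
        ∑ j ∈ Finset.univ.filter (fun j : Fin k => (j : ℕ) < m), y i * y j := by
    intro y
    rw [partialSum, sq, Finset.sum_mul_sum]
  simp_rw [hexp]
  rw [integral_finsetSum _ fun i _ => integrable_finsetSum _ fun j _ => hinteg i j]
  calc ∑ i ∈ Finset.univ.filter (fun i : Fin k => (i : ℕ) < m),
        ∫ y, ∑ j ∈ Finset.univ.filter (fun j : Fin k => (j : ℕ) < m), y i * y j ∂ρ
      ≤ ∑ i ∈ Finset.univ.filter (fun i : Fin k => (i : ℕ) < m), ∫ y, y i ^ 2 ∂ρ := by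
        refine Finset.sum_le_sum fun i hi => ?_
        rw [integral_finsetSum _ fun j _ => hinteg i j, ← Finset.add_sum_erase _ _ hi]
        have : ∑ j ∈ (Finset.univ.filter fun j : Fin k => (j : ℕ) < m).erase i,
            ∫ y, y i * y j ∂ρ ≤ 0 :=
          Finset.sum_nonpos fun j hj => hoff i j (Finset.ne_of_mem_erase hj).symm
        simp only [sq]
        linarith
    _ ≤ ∑ i, ∫ y, y i ^ 2 ∂ρ :=
        Finset.sum_le_sum_of_subset_of_nonneg (Finset.filter_subset _ _)
          fun i _ _ => integral_nonneg fun y => sq_nonneg _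

/-- The pathwise form of Doob's maximal inequality. -/
theorem sq_partialSups_le (a : ℕ → ℝ) (n : ℕ) :
    partialSups a n ^ 2 ≤ 2 * (partialSups a n * a n)
      - 2 * ∑ i ∈ Finset.range n, partialSups a i * (a (i + 1) - a i) := by
  induction n with
  | zero => simp; nlinarith [sq_nonneg (a 0)]
  | succ n ih =>
    rw [Finset.sum_range_succ, ← Order.succ_eq_add_one, partialSups_succ, Order.succ_eq_add_one]
    -- When a new maximum M' = a(n+1) replaces M, the slack is (M' - M)²; otherwise the two sides
    -- change consistently.
    rcases le_total (partialSups a n) (a (n + 1)) with h | h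
    · rw [sup_eq_right.2 h]
      nlinarith [sq_nonneg (a (n + 1) - partialSups a n)]
    · rw [sup_eq_left.2 h]
      nlinarith

/-- The martingale associated with sampling without replacement. -/
noncomputable def samplingMartingale {k : ℕ} (c : ℝ) (y : Fin k → ℝ) (m : ℕ) : ℝ :=
  c * partialSum y m / ((k : ℝ) - m)

theorem measurable_partialSups_samplingMartingale {k : ℕ} (c : ℝ) (n : ℕ) :
    Measurable fun y : Fin k → ℝ => partialSups (samplingMartingale c y) n := by
  induction n with
  | zero =>
    simp only [partialSups_zero]
    unfold samplingMartingale
    fun_prop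
  | succ n ih =>
    simp only [← Order.succ_eq_add_one, partialSups_succ]
    refine ih.sup ?_
    unfold samplingMartingale
    fun_prop

theorem memLp_samplingMartingale {k : ℕ} {ρ : Measure (Fin k → ℝ)}
    (h2 : ∀ i, MemLp (fun y => y i) 2 ρ) (c : ℝ) (m : ℕ) :
    MemLp (fun y => samplingMartingale c y m) 2 ρ := by
  have := (memLp_partialSum h2 m).const_mul (c / ((k : ℝ) - m))
  refine this.congr_norm (by unfold samplingMartingale; fun_prop) (ae_of_all _ fun y => ?_)
  simp only [samplingMartingale]
  congr 1
  ring

theorem memLp_partialSups_samplingMartingale {k : ℕ} {ρ : Measure (Fin k → ℝ)}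
    (h2 : ∀ i, MemLp (fun y => y i) 2 ρ) (c : ℝ) (n : ℕ) :
    MemLp (fun y => partialSups (samplingMartingale c y) n) 2 ρ := by
  induction n with
  | zero => simpa only [partialSups_zero] using memLp_samplingMartingale h2 c 0
  | succ n ih =>
    simp only [← Order.succ_eq_add_one, partialSups_succ]
    exact ih.sup (memLp_samplingMartingale h2 c _)

/-- Doob's L² inequality without filtrations. In the integrated form of `sq_partialSups_le` the
martingale transform has mean zero: the running maximum up to i is unchanged by permutations that
fix the first i coordinates, so `Exchangeable.integral_mul_next` applies. -/
theorem Exchangeable.integral_partialSups_sq_le {k : ℕ} {ρ : Measure (Fin k → ℝ)}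
    (hρ : Exchangeable ρ) (h2 : ∀ i, MemLp (fun y => y i) 2 ρ) (hz : ∀ᵐ y ∂ρ, ∑ i, y i = 0)
    (c : ℝ) {n : ℕ} (hn : n < k) :
    ∫ y, partialSups (samplingMartingale c y) n ^ 2 ∂ρ
      ≤ 4 * (c / ((k : ℝ) - n)) ^ 2 * ∑ i, ∫ y, y i ^ 2 ∂ρ := by
  set M : ℕ → (Fin k → ℝ) → ℝ := fun i y => partialSups (samplingMartingale c y) i with hM
  set T : ℕ → (Fin k → ℝ) → ℝ := fun i y => samplingMartingale c y i with hT
  have hM2 : ∀ i, MemLp (M i) 2 ρ := memLp_partialSups_samplingMartingale h2 c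
  have hT2 : ∀ i, MemLp (T i) 2 ρ := memLp_samplingMartingale h2 c
  have hMT : ∀ i j, Integrable (fun y => M i y * T j y) ρ := fun i j =>
    (hM2 i).integrable_mul (hT2 j)
  have hmart : ∀ i ∈ Finset.range n, ∫ y, M i y * (T (i + 1) y - T i y) ∂ρ = 0 := by
    intro i hi
    have hik : i + 1 < k := by have := Finset.mem_range.1 hi; omega
    have hpos : (0 : ℝ) < (k : ℝ) - (i + 1) := by
      have : ((i + 1 : ℕ) : ℝ) < k := by exact_mod_cast hik
      push_cast at this
      linarith
    have hpos' : (0 : ℝ) < (k : ℝ) - i := by linarith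
    set i' : Fin k := ⟨i, by omega⟩
    have hnext := hρ.integral_mul_next h2 hz i' (g := M i)
      (measurable_partialSups_samplingMartingale c i) (hM2 i) (by
        intro τ hτ y
        simp only [hM]
        rw [partialSups_eq_sup'_range, partialSups_eq_sup'_range]
        refine Finset.sup'_congr _ rfl fun j hj => ?_
        have hj : j ≤ i := by simpa [Nat.lt_succ_iff] using hj
        simp only [samplingMartingale]
        rw [partialSum_comp_of_fix y fun a ha => hτ a ?_]
        exact Fin.lt_def.2 (lt_of_lt_of_le ha hj))
    have hi1 : Integrable (fun y => M i y * y i') ρ := (hM2 i).integrable_mul (h2 i')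
    have hi2 : Integrable (fun y => M i y * partialSum y i) ρ :=
      (hM2 i).integrable_mul (memLp_partialSum h2 i)
    have hexp : ∀ y, M i y * (T (i + 1) y - T i y)
        = c / ((k : ℝ) - (i + 1)) * (M i y * y i')
          + c / (((k : ℝ) - (i + 1)) * ((k : ℝ) - i)) * (M i y * partialSum y i) := by
      intro y
      have hs : partialSum y (i + 1) = partialSum y i + y i' := partialSum_succ y i'
      simp only [hT, samplingMartingale, hs]
      push_cast
      field_simp
      ring
    simp_rw [hexp]
    rw [integral_add (hi1.const_mul _) (hi2.const_mul _), integral_const_mul, integral_const_mul]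
    have hn' : ((k : ℝ) - i) * ∫ y, M i y * y i' ∂ρ = -∫ y, M i y * partialSum y i ∂ρ := hnext
    have : ∫ y, M i y * partialSum y i ∂ρ = -(((k : ℝ) - i) * ∫ y, M i y * y i' ∂ρ) := by linarith
    rw [this]
    field_simp
    ring
  have hMTT : ∀ i, Integrable (fun y => M i y * (T (i + 1) y - T i y)) ρ := fun i =>
    (hM2 i).integrable_mul ((hT2 (i + 1)).sub (hT2 i))
  have hsumint : Integrable (fun y => ∑ i ∈ Finset.range n, M i y * (T (i + 1) y - T i y)) ρ :=
    integrable_finsetSum _ fun i _ => hMTT i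
  have hMM : Integrable (fun y => M n y ^ 2) ρ := (hM2 n).integrable_sq
  have hTT : Integrable (fun y => T n y ^ 2) ρ := (hT2 n).integrable_sq
  have h1 : ∫ y, M n y ^ 2 ∂ρ ≤ 2 * ∫ y, M n y * T n y ∂ρ := by
    calc ∫ y, M n y ^ 2 ∂ρ ≤ ∫ y, (2 * (M n y * T n y)
          - 2 * ∑ i ∈ Finset.range n, M i y * (T (i + 1) y - T i y)) ∂ρ :=
          integral_mono hMM (((hMT n n).const_mul 2).sub (hsumint.const_mul 2))
            fun y => sq_partialSups_le (samplingMartingale c y) n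
      _ = 2 * ∫ y, M n y * T n y ∂ρ := by
          rw [integral_sub ((hMT n n).const_mul 2) (hsumint.const_mul 2), integral_const_mul,
            integral_const_mul, integral_finsetSum _ fun i _ => hMTT i, Finset.sum_eq_zero hmart]
          ring
  -- Young's inequality 2MT ≤ M²/2 + 2T²; absorbing half of the left side yields Doob's constant 4.
  have h3 : 2 * ∫ y, M n y * T n y ∂ρ ≤ 1 / 2 * ∫ y, M n y ^ 2 ∂ρ + 2 * ∫ y, T n y ^ 2 ∂ρ := by
    rw [← integral_const_mul, ← integral_const_mul, ← integral_const_mul,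
      ← integral_add (hMM.const_mul _) (hTT.const_mul _)]
    refine integral_mono ((hMT n n).const_mul 2) ((hMM.const_mul _).add (hTT.const_mul _))
      fun y => ?_
    simp only
    nlinarith [sq_nonneg (M n y - 2 * T n y)]
  have h4 : ∫ y, T n y ^ 2 ∂ρ ≤ (c / ((k : ℝ) - n)) ^ 2 * ∑ i, ∫ y, y i ^ 2 ∂ρ := by
    have : ∀ y, T n y ^ 2 = (c / ((k : ℝ) - n)) ^ 2 * partialSum y n ^ 2 := by
      intro y
      simp only [hT, samplingMartingale]
      ring
    simp_rw [this]
    rw [integral_const_mul]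
    gcongr
    exact hρ.integral_partialSum_sq_le h2 hz n
  linarith

/-- A maximal inequality for sampling without replacement. -/
theorem Exchangeable.exists_majorant_of_sum_eq_zero {k : ℕ} (hk : 0 < k)
    {ρ : Measure (Fin k → ℝ)} (hρ : Exchangeable ρ) (h2 : ∀ i, MemLp (fun y => y i) 2 ρ)
    (hz : ∀ᵐ y ∂ρ, ∑ i, y i = 0) :
    ∃ G : (Fin k → ℝ) → ℝ, Measurable G ∧ Integrable G ρ ∧ (∀ y, 0 ≤ G y) ∧
      (∀ y, ∑ i, y i = 0 → ∀ m ≤ k, partialSum y m ^ 2 ≤ G y) ∧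
      ∫ y, G y ∂ρ ≤ 64 * ∑ i, ∫ y, y i ^ 2 ∂ρ := by
  -- The martingale degenerates as m approaches k, so it is used only up to k/2, where the
  -- denominator k - m is at least k/2. Later partial sums are reached from the other end.
  set n := k / 2 with hn
  have hnk : n < k := Nat.div_lt_self hk one_lt_two
  have hk0 : (0 : ℝ) < k := by exact_mod_cast hk
  have hhalf : (k : ℝ) / 2 ≤ (k : ℝ) - n := by
    have : (n : ℝ) ≤ k / 2 := by
      rw [hn]; exact Nat.cast_div_le
    linarith
  set M : ℝ → (Fin k → ℝ) → ℝ := fun c y => partialSups (samplingMartingale c y) n with hM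
  have hMm : ∀ c, Measurable (M c) := fun c => measurable_partialSups_samplingMartingale c n
  have hMi : ∀ c, Integrable (fun y => M c y ^ 2) ρ := fun c =>
    (memLp_partialSups_samplingMartingale h2 c n).integrable_sq
  have hrev : ∀ c, Integrable (fun y => M c (y ∘ Fin.revPerm) ^ 2) ρ := by
    intro c
    have h := hMi c
    rw [← hρ Fin.revPerm, integrable_map_measure ((hMm c).pow_const 2).aestronglyMeasurable
      (measurable_comp_perm _).aemeasurable] at h
    exact h
  have hM0 : ∀ c y, 0 ≤ M c y := by
    intro c y
    have := le_partialSups_of_le (samplingMartingale c y) (Nat.zero_le n)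
    simpa [samplingMartingale, partialSum_zero] using this
  have hbound : ∀ c y, ∀ m ≤ n, c * partialSum y m ≤ k * M c y := by
    intro c y m hm
    have h := le_partialSups_of_le (samplingMartingale c y) hm
    have hmk : (0 : ℝ) < (k : ℝ) - m := by
      have : (m : ℝ) ≤ n := by exact_mod_cast hm
      linarith
    simp only [samplingMartingale] at h
    rw [div_le_iff₀ hmk] at h
    refine h.trans ?_
    rw [mul_comm]
    have := hM0 c y
    have hm0 : (0 : ℝ) ≤ m := Nat.cast_nonneg m
    exact mul_le_mul_of_nonneg_right (by linarith) this
  -- The running maximum is one-sided; c = 1 and c = -1 cover both signs of the partial sum.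
  have hsq : ∀ y, ∀ m ≤ n, partialSum y m ^ 2 ≤ (k : ℝ) ^ 2 * (M 1 y ^ 2 + M (-1) y ^ 2) := by
    intro y m hm
    have h1 := hbound 1 y m hm
    have h2 := hbound (-1) y m hm
    have h3 := mul_nonneg hk0.le (hM0 1 y)
    have h4 := mul_nonneg hk0.le (hM0 (-1) y)
    rcases le_total 0 (partialSum y m) with h | h
    · nlinarith
    · nlinarith
  refine ⟨fun y => (k : ℝ) ^ 2 * (M 1 y ^ 2 + M (-1) y ^ 2 + (M 1 (y ∘ Fin.revPerm) ^ 2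
    + M (-1) (y ∘ Fin.revPerm) ^ 2)), ?_, ?_, ?_, ?_, ?_⟩
  · have hr : Measurable fun y : Fin k → ℝ => y ∘ Fin.revPerm := by fun_prop
    have h1 := hMm 1
    have h2 := hMm (-1)
    have h3 := (hMm 1).comp hr
    have h4 := (hMm (-1)).comp hr
    simp only [Function.comp_def] at h3 h4 ⊢
    fun_prop
  · exact (((hMi 1).add (hMi (-1))).add ((hrev 1).add (hrev (-1)))).const_mul _
  · intro y; positivity
  · intro y hy m hm
    rcases le_or_gt m n with h | h
    · refine (hsq y m h).trans ?_
      refine mul_le_mul_of_nonneg_left ?_ (by positivity)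
      exact le_add_of_nonneg_right (by positivity)
    -- As the total is zero, the partial sum up to m is minus the sum of the last k - m coordinates,
    -- that is, of the first k - m in reversed order.
    · have hkm : k - m ≤ n := by omega
      have h5 := partialSum_rev y (show k - m ≤ k by omega)
      rw [Nat.sub_sub_self hm] at h5
      have h6 := partialSum_add_sum_ge y m
      rw [← h5, hy] at h6
      have h7 := hsq (y ∘ Fin.revPerm) _ hkm
      have h8 : partialSum y m ^ 2 = partialSum (y ∘ Fin.revPerm) (k - m) ^ 2 := by
        rw [eq_neg_of_add_eq_zero_left h6, neg_sq]
      rw [h8]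
      refine h7.trans ?_
      refine mul_le_mul_of_nonneg_left ?_ (by positivity)
      exact le_add_of_nonneg_left (by positivity)
  · have hr : ∀ c, ∫ y, M c (y ∘ Fin.revPerm) ^ 2 ∂ρ = ∫ y, M c y ^ 2 ∂ρ := fun c =>
      hρ.integral_comp Fin.revPerm (g := fun y => M c y ^ 2) ((hMm c).pow_const 2)
    have hQ : 0 ≤ ∑ i, ∫ y, y i ^ 2 ∂ρ :=
      Finset.sum_nonneg fun i _ => integral_nonneg fun y => sq_nonneg _
    -- The factor 16 is Doob's 4 times the 4 from k - n ≥ k/2; the two signs and the two directions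
    -- make it 64.
    have hle : ∀ c : ℝ, c ^ 2 = 1 → (k : ℝ) ^ 2 * ∫ y, M c y ^ 2 ∂ρ
        ≤ 16 * ∑ i, ∫ y, y i ^ 2 ∂ρ := by
      intro c hc
      have h := hρ.integral_partialSups_sq_le h2 hz c hnk
      have h' : (c / ((k : ℝ) - n)) ^ 2 ≤ 4 / (k : ℝ) ^ 2 := by
        rw [div_pow, hc, div_le_div_iff₀ (by nlinarith) (by positivity)]
        nlinarith
      calc (k : ℝ) ^ 2 * ∫ y, M c y ^ 2 ∂ρ
          ≤ (k : ℝ) ^ 2 * (4 * (4 / (k : ℝ) ^ 2) * ∑ i, ∫ y, y i ^ 2 ∂ρ) := by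
            gcongr
            refine h.trans ?_
            gcongr
        _ = _ := by field_simp; ring
    have hi1 : Integrable (fun y => M 1 y ^ 2 + M (-1) y ^ 2) ρ := (hMi 1).add (hMi (-1))
    have hi2 : Integrable (fun y => M 1 (y ∘ Fin.revPerm) ^ 2 + M (-1) (y ∘ Fin.revPerm) ^ 2) ρ :=
      (hrev 1).add (hrev (-1))
    rw [integral_const_mul, integral_add hi1 hi2,
      integral_add (hMi 1) (hMi (-1)), integral_add (hrev 1) (hrev (-1)), hr, hr]
    have h1 := hle 1 (by norm_num)
    have h2 := hle (-1) (by norm_num)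
    linarith

/-- A maximal inequality for the partial sums of exchangeable random variables. -/
theorem Exchangeable.exists_majorant {k : ℕ} (hk : 0 < k) {ρ : Measure (Fin k → ℝ)}
    (hρ : Exchangeable ρ) (h2 : ∀ i, MemLp (fun y => y i) 2 ρ) :
    ∃ G : (Fin k → ℝ) → ℝ, Measurable G ∧ (∀ y, ∀ m ≤ k, partialSum y m ^ 2 ≤ G y) ∧
      ∫⁻ y, ENNReal.ofReal (G y) ∂ρ ≤ 128 * ∫⁻ y, ENNReal.ofReal (∑ i, y i ^ 2) ∂ρ
        + 2 * ∫⁻ y, ENNReal.ofReal ((∑ i, y i) ^ 2) ∂ρ := by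
  have hk0 : (0 : ℝ) < k := by exact_mod_cast hk
  -- Centring commutes with permutations, hence preserves exchangeability, and it does not increase
  -- the sum of squares.
  set φ : (Fin k → ℝ) → (Fin k → ℝ) := fun y i => y i - (∑ j, y j) / k with hφ
  have hφm : Measurable φ := by
    refine measurable_pi_lambda _ fun i => ?_
    simp only [hφ]
    fun_prop
  have hφz : ∀ y, ∑ i, φ y i = 0 := by
    intro y
    simp only [hφ, Finset.sum_sub_distrib, Finset.sum_const, Finset.card_univ, Fintype.card_fin,
      nsmul_eq_mul]
    field_simp
    ring
  have hφτ : ∀ (τ : Equiv.Perm (Fin k)) y, φ (y ∘ τ) = φ y ∘ τ := by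
    intro τ y
    ext i
    simp [hφ, Equiv.sum_comp τ y]
  have hφρ : Exchangeable (ρ.map φ) := by
    intro τ
    rw [Measure.map_map (by fun_prop) hφm]
    conv_rhs => rw [← hρ τ]
    rw [Measure.map_map hφm (by fun_prop)]
    congr 1
    ext1 y
    exact (hφτ τ y).symm
  have hsum2 : MemLp (fun y : Fin k → ℝ => ∑ j, y j) 2 ρ := memLp_finsetSum _ fun i _ => h2 i
  have hφ2 : ∀ i, MemLp (fun y => φ y i) 2 ρ := by
    intro i
    have := (h2 i).sub (hsum2.const_mul (k : ℝ)⁻¹)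
    refine this.congr_norm (by fun_prop) (ae_of_all _ fun y => ?_)
    simp [hφ, div_eq_inv_mul]
  obtain ⟨G, hGm, hGi, hG0, hGb, hGint⟩ := hφρ.exists_majorant_of_sum_eq_zero hk
    (fun i => (memLp_map_measure_iff
      (measurable_pi_apply i).aestronglyMeasurable hφm.aemeasurable).2 (hφ2 i))
    ((ae_map_iff hφm.aemeasurable (measurableSet_eq_fun (by fun_prop) (by fun_prop))).2
      (ae_of_all _ hφz))
  have hGφ : Integrable (fun y => G (φ y)) ρ := hGi.comp_measurable hφm
  have hsq2 : ∀ i, Integrable (fun y : Fin k → ℝ => y i ^ 2) ρ := fun i => (h2 i).integrable_sq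
  refine ⟨fun y => 2 * G (φ y) + 2 * (∑ i, y i) ^ 2, by fun_prop, ?_, ?_⟩
  · intro y m hm
    have h := hGb (φ y) (hφz y) m hm
    have hps : partialSum y m = partialSum (φ y) m + m / k * ∑ i, y i := by
      have hcard : ((Finset.univ.filter fun i : Fin k => (i : ℕ) < m).card : ℝ) = m := by
        rw [Fin.card_filter_val_lt, min_eq_right hm]
      simp only [partialSum, hφ, Finset.sum_sub_distrib, Finset.sum_const, nsmul_eq_mul, hcard]
      ring
    have hmk : ((m : ℝ) / k) ^ 2 ≤ 1 := by
      have : (m : ℝ) / k ≤ 1 := by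
        rw [div_le_one hk0]; exact_mod_cast hm
      exact pow_le_one₀ (by positivity) this
    rw [hps]
    calc (partialSum (φ y) m + m / k * ∑ i, y i) ^ 2
        ≤ 2 * partialSum (φ y) m ^ 2 + 2 * (((m : ℝ) / k) ^ 2 * (∑ i, y i) ^ 2) := by
          nlinarith [sq_nonneg (partialSum (φ y) m - m / k * ∑ i, y i)]
      _ ≤ 2 * G (φ y) + 2 * (1 * (∑ i, y i) ^ 2) := by gcongr
      _ = _ := by ring
  · have hQ : ∑ i, ∫ y, φ y i ^ 2 ∂ρ ≤ ∫ y, ∑ i, y i ^ 2 ∂ρ := by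
      rw [← integral_finsetSum _ fun i _ => (hφ2 i).integrable_sq]
      refine integral_mono (integrable_finsetSum _ fun i _ => (hφ2 i).integrable_sq)
        (integrable_finsetSum _ fun i _ => hsq2 i) fun y => ?_
      have : ∑ i, φ y i ^ 2 = ∑ i, y i ^ 2 - (∑ i, y i) ^ 2 / k := by
        simp only [hφ, sub_sq, Finset.sum_add_distrib, Finset.sum_sub_distrib, ← Finset.mul_sum,
          ← Finset.sum_mul, Finset.sum_const, Finset.card_univ, Fintype.card_fin, nsmul_eq_mul]
        field_simp
        ring
      simp only [this]
      have : 0 ≤ (∑ i, y i) ^ 2 / k := by positivity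
      linarith
    have hGint' : ∫ y, G (φ y) ∂ρ ≤ 64 * ∫ y, ∑ i, y i ^ 2 ∂ρ := by
      rw [integral_map hφm.aemeasurable hGm.aestronglyMeasurable] at hGint
      refine hGint.trans ?_
      gcongr
      refine le_trans (le_of_eq ?_) hQ
      refine Finset.sum_congr rfl fun i _ => ?_
      rw [integral_map hφm.aemeasurable ((measurable_pi_apply i).pow_const 2).aestronglyMeasurable]
    have hi : Integrable (fun y => 2 * G (φ y) + 2 * (∑ i, y i) ^ 2) ρ :=
      (hGφ.const_mul 2).add (hsum2.integrable_sq.const_mul 2)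
    rw [← ofReal_integral_eq_lintegral_ofReal hi (ae_of_all _ fun y => by
          have := hG0 (φ y)
          simp only [Pi.zero_apply]
          positivity),
      ← ofReal_integral_eq_lintegral_ofReal (integrable_finsetSum _ fun i _ => hsq2 i)
        (ae_of_all _ fun y => by simp only [Pi.zero_apply]; positivity),
      ← ofReal_integral_eq_lintegral_ofReal hsum2.integrable_sq
        (ae_of_all _ fun y => sq_nonneg _)]
    rw [show (128 : ℝ≥0∞) = ENNReal.ofReal 128 by simp, show (2 : ℝ≥0∞) = ENNReal.ofReal 2 by simp,
      ← ENNReal.ofReal_mul (by norm_num), ← ENNReal.ofReal_mul (by norm_num),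
      ← ENNReal.ofReal_add (mul_nonneg (by norm_num) (integral_nonneg fun y => by
          simp only [Pi.zero_apply]; positivity))
        (mul_nonneg (by norm_num) (integral_nonneg fun y => sq_nonneg _))]
    refine ENNReal.ofReal_le_ofReal ?_
    rw [integral_add (hGφ.const_mul 2) (hsum2.integrable_sq.const_mul 2), integral_const_mul,
      integral_const_mul]
    linarith

end Exchangeable

/-! ### Order statistics of a finite sample. -/

section OrderStatistics

/-- The order statistics of a tuple, in increasing order. -/
noncomputable def ordStat {k : ℕ} (z : Fin k → ℝ) (j : Fin k) : ℝ := z (Tuple.sort z j)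

theorem ordStat_eq_of_monotone {k : ℕ} {z : Fin k → ℝ} {σ : Equiv.Perm (Fin k)}
    (h : Monotone (z ∘ σ)) (j : Fin k) : z (σ j) = ordStat z j :=
  congrFun (Tuple.comp_sort_eq_comp_iff_monotone.2 h) j

theorem sum_ordStat {k : ℕ} (z : Fin k → ℝ) (f : ℝ → ℝ) : ∑ j, f (ordStat z j) = ∑ i, f (z i) :=
  Equiv.sum_comp (Tuple.sort z) fun i => f (z i)

theorem ordStat_le_iff {k : ℕ} (z : Fin k → ℝ) (j : Fin k) (c : ℝ) :
    ordStat z j ≤ c ↔ (j : ℕ) < (Finset.univ.filter fun i => z i ≤ c).card := by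
  have h := Tuple.lt_card_le_iff_apply_le_of_monotone (j := j) (a := c) (Tuple.monotone_sort z)
  rw [show ordStat z j ≤ c ↔ (z ∘ Tuple.sort z) j ≤ c from Iff.rfl, ← h,
    show (Finset.univ.filter fun i => z i ≤ c) = (Finset.univ.filter
      fun i => (z ∘ Tuple.sort z) i ≤ c).map (Tuple.sort z).toEmbedding from ?_, Finset.card_map]
  ext i
  simp only [Finset.mem_filter, Finset.mem_univ, true_and, Finset.mem_map, Function.comp_apply,
    Equiv.coe_toEmbedding]
  exact ⟨fun h => ⟨(Tuple.sort z).symm i, by simpa using h, by simp⟩,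
    by rintro ⟨a, h, rfl⟩; exact h⟩

theorem ordStat_lt_iff {k : ℕ} (z : Fin k → ℝ) (j : Fin k) (c : ℝ) :
    ordStat z j < c ↔ (j : ℕ) < (Finset.univ.filter fun i => z i < c).card := by
  have h := Tuple.lt_card_lt_iff_apply_lt_of_monotone (j := j) (a := c) (Tuple.monotone_sort z)
  rw [show ordStat z j < c ↔ (z ∘ Tuple.sort z) j < c from Iff.rfl, ← h,
    show (Finset.univ.filter fun i => z i < c) = (Finset.univ.filter
      fun i => (z ∘ Tuple.sort z) i < c).map (Tuple.sort z).toEmbedding from ?_, Finset.card_map]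
  ext i
  simp only [Finset.mem_filter, Finset.mem_univ, true_and, Finset.mem_map, Function.comp_apply,
    Equiv.coe_toEmbedding]
  exact ⟨fun h => ⟨(Tuple.sort z).symm i, by simpa using h, by simp⟩,
    by rintro ⟨a, h, rfl⟩; exact h⟩

@[fun_prop]
theorem measurable_ordStat {k : ℕ} (j : Fin k) : Measurable fun z : Fin k → ℝ => ordStat z j := by
  refine measurable_of_Iic fun c => ?_
  have : (fun z : Fin k → ℝ => ordStat z j) ⁻¹' Set.Iic c
      = {z | (j : ℝ) < ∑ i, Set.indicator (Set.Iic c) (fun _ => (1 : ℝ)) (z i)} := by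
    ext z
    simp only [Set.mem_preimage, Set.mem_Iic, Set.mem_ofPred_eq, ordStat_le_iff]
    have h : ∑ i, Set.indicator (Set.Iic c) (fun _ => (1 : ℝ)) (z i)
        = ((Finset.univ.filter fun i => z i ≤ c).card : ℝ) := by
      simp [Set.indicator_apply]
    rw [h]
    exact Nat.cast_lt.symm
  rw [this]
  refine measurableSet_lt measurable_const (Finset.measurable_fun_sum _ fun i _ => ?_)
  exact (measurable_const.indicator measurableSet_Iic).comp (measurable_pi_apply i)

theorem ordStat_neg {k : ℕ} (z : Fin k → ℝ) (j : Fin k) :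
    ordStat (fun i => -z i) j = -ordStat z j.rev := by
  have : Monotone ((fun i => -z i) ∘ (Fin.revPerm.trans (Tuple.sort z))) := by
    intro a b hab
    simp only [Function.comp_apply, Equiv.trans_apply, Fin.revPerm_apply, neg_le_neg_iff]
    exact Tuple.monotone_sort z (Fin.rev_le_rev.2 hab)
  exact (ordStat_eq_of_monotone this j).symm

theorem ordStat_const_mul {k : ℕ} (z : Fin k → ℝ) {c : ℝ} (hc : 0 ≤ c) (j : Fin k) :
    ordStat (fun i => c * z i) j = c * ordStat z j := by
  have : Monotone ((fun i => c * z i) ∘ Tuple.sort z) := fun a b hab =>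
    mul_le_mul_of_nonneg_left (Tuple.monotone_sort z hab) hc
  exact (ordStat_eq_of_monotone this j).symm

/-- The positions of the j + 1 smallest entries all qualify, whatever the ties. This pointwise count
replaces the uniformity of ranks, which would require distinct entries. -/
theorem succ_le_card_rank_le {k : ℕ} (y : Fin (k + 1) → ℝ) {j : ℕ} (hj : j ≤ k) :
    j + 1 ≤ (Finset.univ.filter fun l =>
      (Finset.univ.filter fun i => y i < y l).card ≤ j).card := by
  have h : ((Finset.univ.filter fun a : Fin (k + 1) => (a : ℕ) < j + 1).map
      (Tuple.sort y).toEmbedding) ⊆ Finset.univ.filter fun l =>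
        (Finset.univ.filter fun i => y i < y l).card ≤ j := by
    intro l hl
    obtain ⟨a, ha, rfl⟩ := Finset.mem_map.1 hl
    simp only [Finset.mem_filter, Finset.mem_univ, true_and, Equiv.coe_toEmbedding] at ha ⊢
    have := (ordStat_lt_iff y a (ordStat y a)).not.1 (lt_irrefl _)
    exact (not_lt.1 this).trans (by omega)
  have hc := Finset.card_le_card h
  rw [Finset.card_map, Fin.card_filter_val_lt] at hc
  omega

/-- On average, at least the fraction `(j + 1) / (k + 1)` of the mass lies below the order
statistic number `j`, counted from zero. -/
theorem le_integral_cdf_ordStat (γ : Measure ℝ) [IsProbabilityMeasure γ] {k : ℕ} (j : Fin k) :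
    ((j : ℝ) + 1) / (k + 1) ≤ ∫ z, cdf γ (ordStat z j) ∂(Measure.pi fun _ : Fin k => γ) := by
  -- One further independent observation is drawn; given the sample, E has probability the
  -- distribution function at the order statistic.
  set E : Set (ℝ × (Fin k → ℝ)) := {p | p.1 ≤ ordStat p.2 j} with hE
  have hEm : MeasurableSet E := measurableSet_le (by fun_prop) (by fun_prop)
  set μ := Measure.pi fun _ : Fin k => γ with hμ
  have hprod : (γ.prod μ) E = ENNReal.ofReal (∫ z, cdf γ (ordStat z j) ∂μ) := by
    rw [Measure.prod_apply_symm hEm, ofReal_integral_eq_lintegral_ofReal]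
    · refine lintegral_congr fun z => ?_
      rw [cdf_eq_real, ofReal_measureReal]
      rfl
    · refine Integrable.of_bound (C := 1) ((monotone_cdf γ).measurable.comp
        (measurable_ordStat j)).aestronglyMeasurable (ae_of_all _ fun z => ?_)
      rw [Real.norm_of_nonneg (cdf_nonneg _ _)]
      exact cdf_le_one _ _
    · exact ae_of_all _ fun z => cdf_nonneg _ _
  -- Any of the k + 1 observations may play the extra one: each event `A l` has the probability of
  -- E, and at least j + 1 of them always occur.
  set A : Fin (k + 1) → Set (Fin (k + 1) → ℝ) := fun l =>
    {y | (Finset.univ.filter fun i => y i < y l).card ≤ (j : ℕ)} with hA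
  have hAE : ∀ l, A l = MeasurableEquiv.piFinSuccAbove (fun _ => ℝ) l ⁻¹' E := by
    intro l
    ext y
    simp only [hA, hE, Set.mem_ofPred_eq, Set.mem_preimage, MeasurableEquiv.piFinSuccAbove]
    rw [← not_lt (a := ordStat _ j), ordStat_lt_iff, not_lt]
    have : (Finset.univ.filter fun i => y i < y l) = (Finset.univ.filter
        fun i => y (l.succAbove i) < y l).map (Fin.succAboveEmb l) := by
      ext i
      simp only [Finset.mem_filter, Finset.mem_univ, true_and, Finset.mem_map,
        Fin.coe_succAboveEmb]
      constructor
      · intro h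
        obtain ⟨a, rfl⟩ := Fin.exists_succAbove_eq (x := i) (y := l)
          (by rintro rfl; exact lt_irrefl _ h)
        exact ⟨a, h, rfl⟩
      · rintro ⟨a, h, rfl⟩
        exact h
    rw [this, Finset.card_map]
    rfl
  have hAm : ∀ l, MeasurableSet (A l) := fun l => by
    rw [hAE]; exact (MeasurableEquiv.measurable _) hEm
  have hAmeas : ∀ l, (Measure.pi fun _ : Fin (k + 1) => γ) (A l) = (γ.prod μ) E := by
    intro l
    rw [hAE]
    exact (measurePreserving_piFinSuccAbove (fun _ : Fin (k + 1) => γ) l).measure_preimage_equiv E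
  have hsum : ((j : ℕ) + 1 : ℝ≥0∞) ≤ ((k : ℝ≥0∞) + 1) * (γ.prod μ) E := by
    calc ((j : ℕ) + 1 : ℝ≥0∞)
          = ∫⁻ _y, ((j : ℕ) + 1 : ℝ≥0∞) ∂(Measure.pi fun _ : Fin (k + 1) => γ) := by
          simp
      _ ≤ ∫⁻ y, ∑ l, (A l).indicator 1 y ∂(Measure.pi fun _ : Fin (k + 1) => γ) := by
          refine lintegral_mono fun y => ?_
          have h := succ_le_card_rank_le y (j := j) j.2.le
          have h2 : ∑ l, (A l).indicator (1 : (Fin (k + 1) → ℝ) → ℝ≥0∞) y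
              = ((Finset.univ.filter fun l =>
                (Finset.univ.filter fun i => y i < y l).card ≤ (j : ℕ)).card : ℝ≥0∞) := by
            simp [Set.indicator_apply, hA]
          rw [h2]
          have h3 := (Nat.cast_le (α := ℝ≥0∞)).2 h
          push_cast at h3
          exact h3
      _ = ∑ l : Fin (k + 1), (γ.prod μ) E := by
          rw [lintegral_finsetSum _ fun l _ => measurable_one.indicator (hAm l)]
          refine Finset.sum_congr rfl fun l _ => ?_
          rw [lintegral_indicator_one (hAm l), hAmeas]
      _ = _ := by simp
  have hI : 0 ≤ ∫ z, cdf γ (ordStat z j) ∂μ := integral_nonneg fun z => cdf_nonneg _ _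
  rw [hprod, show ((k : ℝ≥0∞) + 1) = ENNReal.ofReal (k + 1) by
      rw [ENNReal.ofReal_add (by positivity) (by norm_num)]; simp,
    show ((j : ℕ) + 1 : ℝ≥0∞) = ENNReal.ofReal ((j : ℝ) + 1) by
      rw [ENNReal.ofReal_add (by positivity) (by norm_num)]; simp,
    ← ENNReal.ofReal_mul (by positivity), ENNReal.ofReal_le_ofReal_iff (by positivity)] at hsum
  rw [div_le_iff₀ (by positivity)]
  linarith

end OrderStatistics

/-! ### Concentration of normal order statistics at quantiles. -/

section GaussianOrderStatistics

theorem cdf_gaussianReal_sub_cdf {a b : ℝ} (hab : a ≤ b) :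
    cdf (gaussianReal 0 1) b - cdf (gaussianReal 0 1) a
      = ∫ x in Set.Ioc a b, gaussianPDFReal 0 1 x := by
  have h : (gaussianReal 0 1).real (Set.Ioc a b) = ∫ x in Set.Ioc a b, gaussianPDFReal 0 1 x := by
    rw [measureReal_def, gaussianReal_apply_eq_integral _ one_ne_zero, ENNReal.toReal_ofReal]
    exact integral_nonneg fun x => gaussianPDFReal_nonneg _ _ _
  rw [← h, cdf_eq_real, cdf_eq_real, ← Set.Iic_sdiff_Iic, measureReal_sdiff
    (Set.Iic_subset_Iic.2 hab) measurableSet_Iic]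

theorem gaussianPDFReal_anti {a b : ℝ} (ha : 0 ≤ a) (hab : a ≤ b) :
    gaussianPDFReal 0 1 b ≤ gaussianPDFReal 0 1 a := by
  unfold gaussianPDFReal
  simp only [sub_zero]
  gcongr

theorem cdf_gaussianReal_sub_le {a b c : ℝ} (hab : a ≤ b)
    (hc : ∀ x ∈ Set.Ioc a b, gaussianPDFReal 0 1 x ≤ c) :
    cdf (gaussianReal 0 1) b - cdf (gaussianReal 0 1) a ≤ c * (b - a) := by
  rw [cdf_gaussianReal_sub_cdf hab]
  calc ∫ x in Set.Ioc a b, gaussianPDFReal 0 1 x ≤ ∫ _x in Set.Ioc a b, c :=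
        setIntegral_mono_on (integrable_gaussianPDFReal 0 1).integrableOn (by simp)
          measurableSet_Ioc hc
    _ = c * (b - a) := by simp [hab, mul_comm]

theorem le_cdf_gaussianReal_sub {a b c : ℝ} (hab : a ≤ b)
    (hc : ∀ x ∈ Set.Ioc a b, c ≤ gaussianPDFReal 0 1 x) :
    c * (b - a) ≤ cdf (gaussianReal 0 1) b - cdf (gaussianReal 0 1) a := by
  rw [cdf_gaussianReal_sub_cdf hab]
  calc c * (b - a) = ∫ _x in Set.Ioc a b, c := by simp [hab, mul_comm]
    _ ≤ ∫ x in Set.Ioc a b, gaussianPDFReal 0 1 x :=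
        setIntegral_mono_on (by simp) (integrable_gaussianPDFReal 0 1).integrableOn
          measurableSet_Ioc hc

/-- The tangent inequality expressing the convexity of the positive part of the quantile
function. -/
theorem cdf_gaussianReal_le_tangent {a : ℝ} (ha : 0 ≤ a) (z : ℝ) :
    cdf (gaussianReal 0 1) z
      ≤ cdf (gaussianReal 0 1) a + gaussianPDFReal 0 1 a * (max z 0 - a) := by
  have h1 : cdf (gaussianReal 0 1) z ≤ cdf (gaussianReal 0 1) (max z 0) :=
    monotone_cdf _ (le_max_left _ _)
  refine h1.trans ?_
  have h0 : 0 ≤ max z 0 := le_max_right _ _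
  rcases le_total a (max z 0) with h | h
  · have := cdf_gaussianReal_sub_le (c := gaussianPDFReal 0 1 a) h
      fun x hx => gaussianPDFReal_anti ha hx.1.le
    linarith
  · have := le_cdf_gaussianReal_sub (c := gaussianPDFReal 0 1 a) h
      fun x hx => gaussianPDFReal_anti (h0.trans hx.1.le) hx.2
    linarith

theorem continuous_cdf_gaussianReal : Continuous (cdf (gaussianReal 0 1)) := by
  have hle : ∀ x, gaussianPDFReal 0 1 x ≤ gaussianPDFReal 0 1 0 := by
    intro x
    unfold gaussianPDFReal
    refine mul_le_mul_of_nonneg_left (Real.exp_le_exp.2 ?_) (by positivity)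
    simp only [sub_zero, NNReal.coe_one, mul_one]
    nlinarith [sq_nonneg x]
  have h : ∀ a b, a ≤ b → dist (cdf (gaussianReal 0 1) a) (cdf (gaussianReal 0 1) b)
      ≤ gaussianPDFReal 0 1 0 * dist a b := by
    intro a b hab
    rw [dist_comm, dist_comm a, Real.dist_eq, Real.dist_eq, abs_of_nonneg (sub_nonneg.2 hab),
      abs_of_nonneg (sub_nonneg.2 (monotone_cdf _ hab))]
    exact cdf_gaussianReal_sub_le hab fun x _ => hle x
  refine (LipschitzWith.of_dist_le_mul (K := ⟨gaussianPDFReal 0 1 0,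
    gaussianPDFReal_nonneg _ _ _⟩) fun a b => ?_).continuous
  rcases le_total a b with hab | hab
  · exact h a b hab
  · rw [dist_comm, dist_comm a]
    exact h b a hab

theorem exists_cdf_gaussianReal_eq {p : ℝ} (h0 : 0 < p) (h1 : p < 1) :
    ∃ a, cdf (gaussianReal 0 1) a = p := by
  obtain ⟨a, ha⟩ := ((tendsto_cdf_atBot (gaussianReal 0 1)).eventually_lt_const h0).exists
  obtain ⟨b, hb⟩ := ((tendsto_cdf_atTop (gaussianReal 0 1)).eventually_const_lt h1).exists
  exact mem_range_of_exists_le_of_exists_ge continuous_cdf_gaussianReal ⟨a, ha.le⟩ ⟨b, hb.le⟩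

theorem integrable_sq_gaussianReal : Integrable (fun x : ℝ => x ^ 2) (gaussianReal 0 1) :=
  (memLp_id_gaussianReal (μ := 0) (v := 1) 2).integrable_sq

theorem integrable_max_sq_gaussianReal :
    Integrable (fun x : ℝ => max x 0 ^ 2) (gaussianReal 0 1) :=
  integrable_sq_gaussianReal.mono' (by fun_prop) (ae_of_all _ fun x => by
    rw [Real.norm_of_nonneg (sq_nonneg _)]
    rcases le_total x 0 with h | h
    · simpa [max_eq_right h] using sq_nonneg x
    · simp [max_eq_left h])

/-- The contribution of an upper tail to the second moment of the normal distribution. -/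
theorem setIntegral_sq_tail_le {N a : ℝ} (hN : 1 ≤ N)
    (ha : (gaussianReal 0 1).real (Set.Ioi a) ≤ 1 / N) :
    ∫ x in Set.Ioi a, max x 0 ^ 2 ∂(gaussianReal 0 1) ≤ 4 * (Real.log N + 2) / N := by
  have hN0 : 0 < N := by linarith
  have hexp : Integrable (fun x : ℝ => Real.exp (x ^ 2 / 4)) (gaussianReal 0 1) := by
    refine ⟨by fun_prop, ?_⟩
    rw [hasFiniteIntegral_iff_ofReal (ae_of_all _ fun x => (Real.exp_pos _).le)]
    exact lintegral_exp_sq_gaussianReal.trans_lt (by simp)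
  have hexp2 : ∫ x, Real.exp (x ^ 2 / 4) ∂(gaussianReal 0 1) ≤ 2 := by
    have h := lintegral_exp_sq_gaussianReal
    rw [← ofReal_integral_eq_lintegral_ofReal hexp (ae_of_all _ fun x => (Real.exp_pos _).le)] at h
    exact ENNReal.ofReal_le_ofReal_iff (by norm_num) |>.1 (by simpa using h)
  -- The inequality behind the Gaussian maxima again: on an event of probability at most 1/N the
  -- constant part contributes 4 (log N)/N and the exponential part 8/N.
  have hpt : ∀ x : ℝ, max x 0 ^ 2 ≤ 4 * Real.log N + 4 / N * Real.exp (x ^ 2 / 4) := by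
    intro x
    have h := le_log_add_exp_div hN0 (x ^ 2 / 4)
    have h2 : max x 0 ^ 2 ≤ x ^ 2 := by
      rcases le_total x 0 with h | h
      · simpa [max_eq_right h] using sq_nonneg x
      · simp [max_eq_left h]
    calc _ ≤ _ := h2
      _ = 4 * (x ^ 2 / 4) := by ring
      _ ≤ 4 * (Real.log N + Real.exp (x ^ 2 / 4) / N) := by gcongr
      _ = _ := by ring
  have hic : IntegrableOn (fun _ : ℝ => 4 * Real.log N) (Set.Ioi a) (gaussianReal 0 1) :=
    integrableOn_const (by simp)
  have hie : IntegrableOn (fun x : ℝ => 4 / N * Real.exp (x ^ 2 / 4)) (Set.Ioi a)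
      (gaussianReal 0 1) := (hexp.const_mul _).integrableOn
  calc ∫ x in Set.Ioi a, max x 0 ^ 2 ∂(gaussianReal 0 1)
      ≤ ∫ x in Set.Ioi a, (4 * Real.log N + 4 / N * Real.exp (x ^ 2 / 4)) ∂(gaussianReal 0 1) :=
        setIntegral_mono integrable_max_sq_gaussianReal.integrableOn (hic.add hie) hpt
    _ = (gaussianReal 0 1).real (Set.Ioi a) * (4 * Real.log N)
        + 4 / N * ∫ x in Set.Ioi a, Real.exp (x ^ 2 / 4) ∂(gaussianReal 0 1) := by
        rw [integral_add hic hie, setIntegral_const, smul_eq_mul, integral_const_mul]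
    _ ≤ 1 / N * (4 * Real.log N) + 4 / N * 2 := by
        have := Real.log_nonneg hN
        gcongr
        exact (setIntegral_le_integral hexp (ae_of_all _ fun x => (Real.exp_pos _).le)).trans hexp2
    _ = _ := by ring

/-- A Riemann sum for the second moment of the positive part of a normal variable. -/
theorem le_sum_quantile_sq {k : ℕ} (hk : 0 < k) {q : ℕ → ℝ}
    (hq : ∀ j < k, cdf (gaussianReal 0 1) (q j) = ((j : ℝ) + 1) / (k + 1)) :
    k * ∫ x, max x 0 ^ 2 ∂(gaussianReal 0 1) - 4 * (Real.log (k + 1) + 2)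
      ≤ ∑ j ∈ Finset.range k, max (q j) 0 ^ 2 := by
  set γ := gaussianReal 0 1 with hγ
  have hinteg := integrable_max_sq_gaussianReal
  have hmono : ∀ {x y : ℝ}, x ≤ y → max x 0 ^ 2 ≤ max y 0 ^ 2 := fun {x y} h => by
    gcongr
  -- The quantiles cut the line into cells of mass 1/(k+1), on each of which the increasing
  -- integrand is at most its value at the right end.
  have hsum : ∀ n < k, ∫ x in Set.Iic (q n), max x 0 ^ 2 ∂γ
      ≤ ∑ j ∈ Finset.range (n + 1), max (q j) 0 ^ 2 / ((k : ℝ) + 1) := by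
    intro n
    induction n with
    | zero =>
      intro h
      calc ∫ x in Set.Iic (q 0), max x 0 ^ 2 ∂γ ≤ ∫ _x in Set.Iic (q 0), max (q 0) 0 ^ 2 ∂γ :=
            setIntegral_mono_on hinteg.integrableOn (by simp) measurableSet_Iic fun x hx => hmono hx
        _ = _ := by
            have := hq 0 h
            rw [cdf_eq_real] at this
            simp [this]
            ring
    | succ n ih =>
      intro h
      have h1 := hq n (by omega)
      have h2 := hq (n + 1) h
      have hlt : q n ≤ q (n + 1) := by
        by_contra! hc
        have := monotone_cdf γ hc.le
        rw [h1, h2, div_le_div_iff_of_pos_right (by positivity)] at this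
        push_cast at this
        linarith
      have hreal : γ.real (Set.Ioc (q n) (q (n + 1))) = 1 / ((k : ℝ) + 1) := by
        rw [← Set.Iic_sdiff_Iic, measureReal_sdiff (Set.Iic_subset_Iic.2 hlt) measurableSet_Iic,
          ← cdf_eq_real, ← cdf_eq_real, h1, h2]
        push_cast
        ring
      rw [Finset.sum_range_succ, ← Set.Iic_union_Ioc_eq_Iic hlt, setIntegral_union
        (Set.Iic_disjoint_Ioc le_rfl) measurableSet_Ioc hinteg.integrableOn hinteg.integrableOn]
      refine add_le_add (ih (by omega)) ?_
      calc ∫ x in Set.Ioc (q n) (q (n + 1)), max x 0 ^ 2 ∂γ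
          ≤ ∫ _x in Set.Ioc (q n) (q (n + 1)), max (q (n + 1)) 0 ^ 2 ∂γ :=
            setIntegral_mono_on hinteg.integrableOn (by simp) measurableSet_Ioc
              fun x hx => hmono hx.2
        _ = _ := by
            rw [setIntegral_const, hreal]
            simp
            ring
  -- The last cell is unbounded, so it is estimated as a tail; this is the source of the logarithm.
  have hlast : γ.real (Set.Ioi (q (k - 1))) ≤ 1 / ((k : ℝ) + 1) := by
    rw [← Set.compl_Iic, probReal_compl_eq_one_sub measurableSet_Iic, ← cdf_eq_real,
      hq _ (by omega), Nat.cast_sub hk]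
    refine le_of_eq ?_
    field_simp
    push_cast
    ring
  have htail := setIntegral_sq_tail_le (by linarith [Nat.cast_nonneg (α := ℝ) k] :
    (1 : ℝ) ≤ k + 1) hlast
  have hs := hsum (k - 1) (by omega)
  rw [Nat.sub_add_cancel hk, ← Finset.sum_div] at hs
  have htot := integral_add_compl (measurableSet_Iic (a := q (k - 1))) hinteg
  rw [Set.compl_Iic] at htot
  have h0 : 0 ≤ ∫ x, max x 0 ^ 2 ∂γ := integral_nonneg fun x => sq_nonneg _
  have hk1 : (0 : ℝ) < k + 1 := by positivity
  have h3 : ∫ x, max x 0 ^ 2 ∂γ ≤ (∑ j ∈ Finset.range k, max (q j) 0 ^ 2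
      + 4 * (Real.log (k + 1) + 2)) / ((k : ℝ) + 1) := by
    rw [add_div, ← htot]
    exact add_le_add hs htail
  rw [le_div_iff₀ hk1] at h3
  linarith

theorem memLp_eval_pi (γ : Measure ℝ) [IsProbabilityMeasure γ] (h : MemLp id 2 γ) {k : ℕ}
    (i : Fin k) : MemLp (fun z : Fin k → ℝ => z i) 2 (Measure.pi fun _ => γ) :=
  h.comp_measurePreserving (measurePreserving_eval (fun _ : Fin k => γ) i)

theorem memLp_ordStat {k : ℕ} {μ : Measure (Fin k → ℝ)} (h : ∀ i, MemLp (fun z => z i) 2 μ)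
    (j : Fin k) : MemLp (fun z => ordStat z j) 2 μ := by
  refine (memLp_finsetSum Finset.univ fun i _ => (h i).norm).mono
    (measurable_ordStat j).aestronglyMeasurable (ae_of_all _ fun z => ?_)
  rw [Real.norm_of_nonneg (Finset.sum_nonneg fun i _ => norm_nonneg _)]
  exact Finset.single_le_sum (f := fun i => ‖z i‖) (fun i _ => norm_nonneg _)
    (Finset.mem_univ (Tuple.sort z j))

/-- The positive parts of the order statistics of a normal sample are close to quantiles. -/
theorem integral_sum_max_ordStat_sub_sq_le {k : ℕ} (hk : 0 < k) {q : ℕ → ℝ}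
    (hq : ∀ j < k, cdf (gaussianReal 0 1) (q j) = ((j : ℝ) + 1) / (k + 1)) :
    ∫ z, ∑ j : Fin k, (max (ordStat z j) 0 - max (q j) 0) ^ 2
      ∂(Measure.pi fun _ : Fin k => gaussianReal 0 1) ≤ 4 * (Real.log (k + 1) + 2) := by
  set μ := Measure.pi fun _ : Fin k => gaussianReal 0 1 with hμ
  have h2 : ∀ i, MemLp (fun z : Fin k → ℝ => z i) 2 μ :=
    memLp_eval_pi _ (memLp_id_gaussianReal (μ := 0) (v := 1) 2)
  have hpos : ∀ j : Fin k, MemLp (fun z => max (ordStat z j) 0) 2 μ := fun j =>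
    (memLp_ordStat h2 j).sup (memLp_const 0)
  have hi1 : ∀ j : Fin k, Integrable (fun z => max (ordStat z j) 0) μ := fun j =>
    (hpos j).integrable (by norm_num)
  have hi2 : ∀ j : Fin k, Integrable (fun z => max (ordStat z j) 0 ^ 2) μ := fun j =>
    (hpos j).integrable_sq
  -- Integrate the tangent inequality at a = `q j`: the mean of the distribution function at the
  -- order statistic is at least (j+1)/(k+1), its value at `q j`, so the slope term has non-negative
  -- mean.
  have hjensen : ∀ j : Fin k, max (q j) 0 ≤ ∫ z, max (ordStat z j) 0 ∂μ := by
    intro j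
    rcases le_total (q j) 0 with h | h
    · rw [max_eq_right h]
      exact integral_nonneg fun z => le_max_right _ _
    · rw [max_eq_left h]
      have hc := le_integral_cdf_ordStat (gaussianReal 0 1) j
      rw [← hq j j.2] at hc
      have hle : ∫ z, cdf (gaussianReal 0 1) (ordStat z j) ∂μ ≤ ∫ z, (cdf (gaussianReal 0 1) (q j)
          + gaussianPDFReal 0 1 (q j) * (max (ordStat z j) 0 - q j)) ∂μ := by
        refine integral_mono ?_ ((integrable_const _).add
          (((hi1 j).sub (integrable_const _)).const_mul _))
          fun z => cdf_gaussianReal_le_tangent h _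
        refine Integrable.of_bound (C := 1) ((monotone_cdf _).measurable.comp
          (measurable_ordStat j)).aestronglyMeasurable (ae_of_all _ fun z => ?_)
        rw [Real.norm_of_nonneg (cdf_nonneg _ _)]
        exact cdf_le_one _ _
      have hsub : Integrable (fun z => max (ordStat z j) 0 - q j) μ :=
        (hi1 j).sub (integrable_const _)
      rw [integral_add (integrable_const _) (hsub.const_mul _),
        integral_const_mul, integral_sub (hi1 j) (integrable_const _)] at hle
      simp only [integral_const, probReal_univ, one_smul] at hle
      have hp := gaussianPDFReal_pos 0 1 (q j) one_ne_zero
      have h3 : 0 ≤ gaussianPDFReal 0 1 (q j) * (∫ z, max (ordStat z j) 0 ∂μ - q j) := by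
        linarith
      have := nonneg_of_mul_nonneg_right h3 hp
      linarith
  have hsq : ∑ j : Fin k, ∫ z, max (ordStat z j) 0 ^ 2 ∂μ
      = k * ∫ x, max x 0 ^ 2 ∂(gaussianReal 0 1) := by
    rw [← integral_finsetSum _ fun j _ => hi2 j]
    simp_rw [sum_ordStat _ fun x => max x 0 ^ 2]
    have he : ∀ i : Fin k, ∫ z : Fin k → ℝ, max (z i) 0 ^ 2 ∂μ
        = ∫ x, max x 0 ^ 2 ∂(gaussianReal 0 1) := by
      intro i
      have := (measurePreserving_eval (fun _ : Fin k => gaussianReal 0 1) i)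
      rw [← this.map_eq, integral_map (measurable_pi_apply i).aemeasurable (by fun_prop)]
    have hi : ∀ i : Fin k, Integrable (fun z : Fin k → ℝ => max (z i) 0 ^ 2) μ := fun i =>
      ((h2 i).sup (memLp_const 0)).integrable_sq
    rw [integral_finsetSum _ fun i _ => hi i]
    simp [he]
  -- Expanding the square, `hjensen` makes the cross term at most -2 max(q_j, 0)². Hence only the
  -- gap between second moments and squared quantiles has to be summed.
  have hterm : ∀ j : Fin k, ∫ z, (max (ordStat z j) 0 - max (q j) 0) ^ 2 ∂μ
      ≤ ∫ z, max (ordStat z j) 0 ^ 2 ∂μ - max (q j) 0 ^ 2 := by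
    intro j
    have hexp : ∀ z, (max (ordStat z j) 0 - max (q j) 0) ^ 2 = max (ordStat z j) 0 ^ 2
        - 2 * max (q j) 0 * max (ordStat z j) 0 + max (q j) 0 ^ 2 := fun z => by ring
    have hsub : Integrable (fun z => max (ordStat z j) 0 ^ 2
        - 2 * max (q j) 0 * max (ordStat z j) 0) μ := (hi2 j).sub ((hi1 j).const_mul _)
    simp_rw [hexp]
    rw [integral_add hsub (integrable_const _), integral_sub (hi2 j) ((hi1 j).const_mul _),
      integral_const_mul]
    simp only [integral_const, probReal_univ, one_smul]
    nlinarith [hjensen j, le_max_right (q j) 0]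
  have hi3 : ∀ j : Fin k, Integrable (fun z => (max (ordStat z j) 0 - max (q j) 0) ^ 2) μ :=
    fun j => ((hpos j).sub (memLp_const _)).integrable_sq
  rw [integral_finsetSum _ fun j _ => hi3 j]
  have h3 := Finset.sum_le_sum fun j (_ : j ∈ Finset.univ) => hterm j
  rw [Finset.sum_sub_distrib, hsq, Fin.sum_univ_eq_sum_range (fun j => max (q j) 0 ^ 2)] at h3
  have h4 := le_sum_quantile_sq hk hq
  linarith

/-- The order statistics of a standard normal sample are concentrated. -/
theorem exists_lintegral_sum_ordStat_sub_sq_le {k : ℕ} (hk : 0 < k) :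
    ∃ a : Fin k → ℝ, ∫⁻ z, ENNReal.ofReal (∑ j, (ordStat z j - a j) ^ 2)
      ∂(Measure.pi fun _ : Fin k => gaussianReal 0 1)
        ≤ ENNReal.ofReal (16 * (Real.log (k + 1) + 2)) := by
  have hex : ∀ j : ℕ, ∃ a, j < k → cdf (gaussianReal 0 1) a = ((j : ℝ) + 1) / (k + 1) := by
    intro j
    by_cases hj : j < k
    · obtain ⟨a, ha⟩ := exists_cdf_gaussianReal_eq (p := ((j : ℝ) + 1) / (k + 1)) (by positivity)
        (by
          rw [div_lt_one (by positivity)]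
          have : (j : ℝ) < k := by exact_mod_cast hj
          linarith)
      exact ⟨a, fun _ => ha⟩
    · exact ⟨0, fun h => absurd h hj⟩
  choose q hq using hex
  set μ := Measure.pi fun _ : Fin k => gaussianReal 0 1 with hμ
  have h2 : ∀ i, MemLp (fun z : Fin k → ℝ => z i) 2 μ :=
    memLp_eval_pi _ (memLp_id_gaussianReal (μ := 0) (v := 1) 2)
  set A : (Fin k → ℝ) → ℝ := fun z => ∑ j : Fin k, (max (ordStat z j) 0 - max (q j) 0) ^ 2 with hA
  have hAm : Measurable A := by simp only [hA]; fun_prop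
  have hAi : Integrable A μ := integrable_finsetSum _ fun j _ =>
    (((memLp_ordStat h2 j).sup (memLp_const 0)).sub (memLp_const _)).integrable_sq
  have hAle := integral_sum_max_ordStat_sub_sq_le hk hq
  have hneg : MeasurePreserving (fun z : Fin k → ℝ => fun i => -z i) μ μ := by
    refine measurePreserving_pi _ _ fun i => ⟨by fun_prop, ?_⟩
    simpa using gaussianReal_map_neg (μ := 0) (v := 1)
  have hBi : Integrable (fun z => A (fun i => -z i)) μ := hneg.integrable_comp_of_integrable hAi
  have hBle : ∫ z, A (fun i => -z i) ∂μ = ∫ z, A z ∂μ := by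
    conv_rhs => rw [← hneg.map_eq]
    rw [integral_map hneg.measurable.aemeasurable hAm.aestronglyMeasurable]
  -- This is `q j` itself, as the normal quantiles are antisymmetric; the split form avoids proving
  -- so. The negative parts are the positive parts of the reflected sample, in reversed order.
  refine ⟨fun j => max (q j) 0 - max (q j.rev) 0, ?_⟩
  have hpt : ∀ z : Fin k → ℝ, ∑ j : Fin k, (ordStat z j - (max (q j) 0 - max (q j.rev) 0)) ^ 2
      ≤ 2 * A z + 2 * A (fun i => -z i) := by
    intro z
    have hB : A (fun i => -z i)
        = ∑ j : Fin k, (max (-ordStat z j) 0 - max (q j.rev) 0) ^ 2 := by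
      simp only [hA, ordStat_neg]
      rw [← Equiv.sum_comp Fin.revPerm]
      simp
    rw [hB]
    simp only [hA]
    rw [Finset.mul_sum, Finset.mul_sum, ← Finset.sum_add_distrib]
    refine Finset.sum_le_sum fun j _ => ?_
    have hx : ordStat z j = max (ordStat z j) 0 - max (-ordStat z j) 0 := by
      rcases le_total (ordStat z j) 0 with h | h
      · rw [max_eq_right h, max_eq_left (by linarith)]; ring
      · rw [max_eq_left h, max_eq_right (by linarith)]; ring
    set u := max (ordStat z j) 0
    set v := max (-ordStat z j) 0
    rw [hx]
    nlinarith [sq_nonneg ((u - max (q j) 0) + (v - max (q j.rev) 0))]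
  calc _ ≤ ∫⁻ z, ENNReal.ofReal (2 * A z + 2 * A (fun i => -z i)) ∂μ :=
        lintegral_mono fun z => ENNReal.ofReal_le_ofReal (hpt z)
    _ = ENNReal.ofReal (∫ z, (2 * A z + 2 * A (fun i => -z i)) ∂μ) := by
        refine (ofReal_integral_eq_lintegral_ofReal ((hAi.const_mul 2).add (hBi.const_mul 2))
          (ae_of_all _ fun z => ?_)).symm
        simp only [hA, Pi.zero_apply, Pi.add_apply]
        positivity
    _ ≤ _ := by
        refine ENNReal.ofReal_le_ofReal ?_
        rw [integral_add (hAi.const_mul 2) (hBi.const_mul 2), integral_const_mul,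
          integral_const_mul, hBle]
        simp only [hA] at *
        linarith

/-- Comonotone pairing of two normal samples, whatever their dependence: each of them is close to
the same deterministic sequence. -/
theorem exists_lintegral_sum_ordStat_sub_sq_le_of_var {k : ℕ} (hk : 0 < k) (v : ℝ≥0) :
    ∃ a : Fin k → ℝ, ∫⁻ z, ENNReal.ofReal (∑ j, (ordStat z j - a j) ^ 2)
      ∂(Measure.pi fun _ : Fin k => gaussianReal 0 v)
        ≤ ENNReal.ofReal (16 * v * (Real.log (k + 1) + 2)) := by
  obtain ⟨a, ha⟩ := exists_lintegral_sum_ordStat_sub_sq_le hk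
  have hscale : MeasurePreserving (fun z : Fin k → ℝ => fun i => √(v : ℝ) * z i)
      (Measure.pi fun _ : Fin k => gaussianReal 0 1)
      (Measure.pi fun _ : Fin k => gaussianReal 0 v) := by
    refine measurePreserving_pi _ _ fun i => ⟨by fun_prop, ?_⟩
    have h := gaussianReal_map_const_mul (μ := 0) (v := 1) (√(v : ℝ))
    have hv' : NNReal.mk (√(v : ℝ) ^ 2) (sq_nonneg _) * 1 = v := by
      ext; simp
    rwa [hv', mul_zero] at h
  refine ⟨fun j => √(v : ℝ) * a j, ?_⟩
  rw [← hscale.map_eq, lintegral_map (by fun_prop) hscale.measurable]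
  have hpt : ∀ z : Fin k → ℝ, ENNReal.ofReal (∑ j : Fin k,
      (ordStat (fun i => √(v : ℝ) * z i) j - √(v : ℝ) * a j) ^ 2)
      = ENNReal.ofReal v * ENNReal.ofReal (∑ j, (ordStat z j - a j) ^ 2) := by
    intro z
    rw [← ENNReal.ofReal_mul v.coe_nonneg, Finset.mul_sum]
    congr 1
    refine Finset.sum_congr rfl fun j _ => ?_
    rw [ordStat_const_mul z (Real.sqrt_nonneg _), ← mul_sub, mul_pow, Real.sq_sqrt v.coe_nonneg]
  simp_rw [hpt]
  rw [lintegral_const_mul _ (by fun_prop)]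
  calc _ ≤ ENNReal.ofReal v * ENNReal.ofReal (16 * (Real.log (k + 1) + 2)) := by gcongr
    _ = _ := by
      rw [← ENNReal.ofReal_mul v.coe_nonneg]
      congr 1
      ring

end GaussianOrderStatistics

/-! ### Quantile functions and the comonotonic coupling. -/

section Comonotone

theorem nonempty_setOf_le_cdf (ν : Measure ℝ) [IsProbabilityMeasure ν] {p : ℝ} (h1 : p < 1) :
    {x | p ≤ cdf ν x}.Nonempty := by
  obtain ⟨b, hb⟩ := ((tendsto_cdf_atTop ν).eventually_const_lt h1).exists
  exact ⟨b, hb.le⟩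

theorem bddBelow_setOf_le_cdf (ν : Measure ℝ) [IsProbabilityMeasure ν] {p : ℝ} (h0 : 0 < p) :
    BddBelow {x | p ≤ cdf ν x} := by
  obtain ⟨a, ha⟩ := ((tendsto_cdf_atBot ν).eventually_lt_const h0).exists
  refine ⟨a, fun x hx => ?_⟩
  by_contra! h
  exact absurd (hx.trans (monotone_cdf ν h.le)) (not_le.2 ha)

/-- Right-continuity of the distribution function puts the infimum itself into the set. -/
theorem le_cdf_leftInverse (ν : Measure ℝ) [IsProbabilityMeasure ν] {p : ℝ} (h1 : p < 1) :
    p ≤ cdf ν (leftInverse ν p) := by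
  refine ge_of_tendsto ((cdf ν).right_continuous (leftInverse ν p) |>.mono_left
    (nhdsWithin_mono _ Set.Ioi_subset_Ici_self)) ?_
  filter_upwards [self_mem_nhdsWithin] with y hy
  obtain ⟨x, hx, hxy⟩ := exists_lt_of_csInf_lt (nonempty_setOf_le_cdf ν h1) hy
  exact le_trans hx (monotone_cdf ν hxy.le)

/-- The Galois connection that carries the section. It needs 0 < p < 1: otherwise the set may be
empty or unbounded below, and `sInf` returns the default 0. -/
theorem leftInverse_le_iff (ν : Measure ℝ) [IsProbabilityMeasure ν] {p : ℝ} (h0 : 0 < p)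
    (h1 : p < 1) (y : ℝ) : leftInverse ν p ≤ y ↔ p ≤ cdf ν y :=
  ⟨fun h => (le_cdf_leftInverse ν h1).trans (monotone_cdf ν h),
    fun h => csInf_le (bddBelow_setOf_le_cdf ν h0) h⟩

theorem leftInverse_mono (ν : Measure ℝ) [IsProbabilityMeasure ν] {p q : ℝ} (h0 : 0 < p)
    (hpq : p ≤ q) (h1 : q < 1) : leftInverse ν p ≤ leftInverse ν q :=
  (leftInverse_le_iff ν h0 (hpq.trans_lt h1) _).2 (hpq.trans (le_cdf_leftInverse ν h1))

theorem measurable_leftInverse (ν : Measure ℝ) [IsProbabilityMeasure ν] :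
    Measurable (leftInverse ν) := by
  refine measurable_of_Iic fun y => ?_
  have h0 : ∀ p ≤ 0, leftInverse ν p = 0 := by
    intro p hp
    have : {x | p ≤ cdf ν x} = Set.univ := by
      ext x; simp [hp.trans (cdf_nonneg ν x)]
    rw [leftInverse, this, Real.sInf_univ]
  have h1 : ∀ p, 1 < p → leftInverse ν p = 0 := by
    intro p hp
    have : {x | p ≤ cdf ν x} = ∅ := by
      ext x; simp [(cdf_le_one ν x).trans_lt hp]
    rw [leftInverse, this, Real.sInf_empty]
  -- At p = 1 the value may be a genuine infimum or the default, but a single point is harmless for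
  -- measurability.
  have : leftInverse ν ⁻¹' Set.Iic y = (Set.Ioo 0 1 ∩ Set.Iic (cdf ν y))
      ∪ ({1} ∩ leftInverse ν ⁻¹' Set.Iic y) ∪ ((Set.Iic 0 ∪ Set.Ioi 1) ∩ {_p | 0 ≤ y}) := by
    ext p
    simp only [Set.mem_preimage, Set.mem_Iic, Set.mem_union, Set.mem_inter_iff, Set.mem_Ioo,
      Set.mem_singleton_iff, Set.mem_Ioi, Set.mem_ofPred_eq]
    rcases le_or_gt p 0 with hp | hp
    · simp [h0 p hp, hp, not_lt.2 hp, (by linarith : p ≠ 1)]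
    · rcases lt_trichotomy p 1 with hp1 | hp1 | hp1
      · simp [leftInverse_le_iff ν hp hp1, hp, hp1, hp1.ne, not_le.2 hp, not_lt.2 hp1.le]
      · subst hp1; simp
      · simp [h1 p hp1, hp1, not_lt.2 hp1.le, hp1.ne', not_le.2 hp]
  rw [this]
  refine ((measurableSet_Ioo.inter measurableSet_Iic).union ?_).union
    ((measurableSet_Iic.union measurableSet_Ioi).inter (MeasurableSet.const _))
  exact (Set.subsingleton_singleton.anti Set.inter_subset_left).measurableSet

/-- The distributional transform: a randomized version of the distribution function. -/
noncomputable def distTransform (μ : Measure ℝ) (x u : ℝ) : ℝ :=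
  μ.real (Set.Iio x) + u * μ.real {x}

theorem real_Iio_add_real_singleton (μ : Measure ℝ) [IsProbabilityMeasure μ] (x : ℝ) :
    μ.real (Set.Iio x) + μ.real {x} = cdf μ x := by
  rw [cdf_eq_real, ← Set.Iio_union_right, measureReal_union (by simp) (measurableSet_singleton x)]

theorem measurable_real_Iio (μ : Measure ℝ) [IsProbabilityMeasure μ] :
    Measurable fun x => μ.real (Set.Iio x) :=
  Monotone.measurable fun _ _ h => measureReal_mono (Set.Iio_subset_Iio h)

theorem measurable_distTransform (μ : Measure ℝ) [IsProbabilityMeasure μ] :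
    Measurable fun p : ℝ × ℝ => distTransform μ p.1 p.2 := by
  have h : ∀ x, μ.real {x} = cdf μ x - μ.real (Set.Iio x) := fun x => by
    rw [← real_Iio_add_real_singleton]; ring
  have h1 := (measurable_real_Iio μ).comp (measurable_fst : Measurable (Prod.fst : ℝ × ℝ → ℝ))
  have h2 := (monotone_cdf μ).measurable.comp (measurable_fst : Measurable (Prod.fst : ℝ × ℝ → ℝ))
  simp only [distTransform, h]
  exact h1.add (measurable_snd.mul (h2.sub h1))

theorem measurable_comonotone (μ ν : Measure ℝ) [IsProbabilityMeasure μ] [IsProbabilityMeasure ν] :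
    Measurable fun p : ℝ × ℝ => comonotone μ ν p.1 p.2 :=
  (measurable_leftInverse ν).comp (measurable_distTransform μ)

theorem distTransform_le_cdf (μ : Measure ℝ) [IsProbabilityMeasure μ] {x u : ℝ} (hu : u ≤ 1) :
    distTransform μ x u ≤ cdf μ x := by
  rw [← real_Iio_add_real_singleton, distTransform]
  gcongr
  exact mul_le_of_le_one_left measureReal_nonneg hu

theorem cdf_le_distTransform (μ : Measure ℝ) [IsProbabilityMeasure μ] {x x' u : ℝ} (h : x < x')
    (hu : 0 ≤ u) : cdf μ x ≤ distTransform μ x' u := by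
  rw [cdf_eq_real, distTransform]
  have := measureReal_mono (μ := μ) (Set.Iic_subset_Iio.2 h)
  have := mul_nonneg hu (measureReal_nonneg (μ := μ) (s := {x'}))
  linarith

theorem distTransform_mono (μ : Measure ℝ) [IsProbabilityMeasure μ] {x x' u u' : ℝ}
    (h : x < x' ∨ (x = x' ∧ u < u')) (hu : u ≤ 1) (hu' : 0 ≤ u') :
    distTransform μ x u ≤ distTransform μ x' u' := by
  rcases h with h | ⟨rfl, h⟩
  · exact (distTransform_le_cdf μ hu).trans (cdf_le_distTransform μ h hu')
  · unfold distTransform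
    gcongr

/-- Let x₀ be the p-quantile, a the mass strictly below it and m its own mass. The event always
holds below x₀, never above, and at x₀ for the fraction (p - a)/m of the uniforms. If m = 0, then a
= p. -/
theorem measure_distTransform_lt (μ : Measure ℝ) [IsProbabilityMeasure μ] {p : ℝ} (h0 : 0 < p)
    (h1 : p < 1) :
    (μ.prod (volume.restrict (Set.Icc (0 : ℝ) 1))) {q | distTransform μ q.1 q.2 < p}
      = ENNReal.ofReal p := by
  set lam : Measure ℝ := volume.restrict (Set.Icc (0 : ℝ) 1) with hlam
  have hlam1 : IsProbabilityMeasure lam := ⟨by simp [hlam]⟩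
  set x₀ := leftInverse μ p with hx₀
  set a := μ.real (Set.Iio x₀) with ha
  set m := μ.real {x₀} with hm
  have hm0 : 0 ≤ m := measureReal_nonneg
  have hge : p ≤ a + m := by
    rw [ha, hm, real_Iio_add_real_singleton]
    exact le_cdf_leftInverse μ h1
  have hle : a ≤ p := by
    have hU : Set.Iio x₀ = ⋃ n : ℕ, Set.Iic (x₀ - 1 / ((n : ℝ) + 1)) := by
      ext x
      simp only [Set.mem_Iio, Set.mem_iUnion, Set.mem_Iic]
      constructor
      · intro h
        obtain ⟨n, hn⟩ := exists_nat_one_div_lt (sub_pos.2 h)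
        exact ⟨n, by linarith⟩
      · rintro ⟨n, hn⟩
        have : (0 : ℝ) < 1 / ((n : ℝ) + 1) := by positivity
        linarith
    have hmon : Monotone fun n : ℕ => Set.Iic (x₀ - 1 / ((n : ℝ) + 1)) := by
      intro i j hij
      refine Set.Iic_subset_Iic.2 (sub_le_sub_left ?_ _)
      gcongr
    have hlim := tendsto_measure_iUnion_atTop (μ := μ) hmon
    rw [← hU] at hlim
    have hlim' := (ENNReal.tendsto_toReal (measure_ne_top μ _)).comp hlim
    refine le_of_tendsto hlim' (Eventually.of_forall fun n => ?_)
    have : cdf μ (x₀ - 1 / ((n : ℝ) + 1)) < p := by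
      rw [← not_le, ← leftInverse_le_iff μ h0 h1, not_le]
      have : (0 : ℝ) < 1 / ((n : ℝ) + 1) := by positivity
      linarith
    rw [cdf_eq_real] at this
    exact this.le
  have hset : {q : ℝ × ℝ | distTransform μ q.1 q.2 < p} =ᵐ[μ.prod lam]
      ((Set.Iio x₀ ×ˢ Set.univ) ∪ ({x₀} ×ˢ {u | a + u * m < p}) : Set (ℝ × ℝ)) := by
    have hu : ∀ᵐ q ∂(μ.prod lam), q.2 ∈ Set.Icc (0 : ℝ) 1 :=
      (Measure.quasiMeasurePreserving_snd (μ := μ) (ν := lam)).ae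
        (ae_restrict_mem measurableSet_Icc)
    filter_upwards [hu] with q hq
    refine propext ?_
    change distTransform μ q.1 q.2 < p ↔
      q ∈ ((Set.Iio x₀ ×ˢ Set.univ) ∪ ({x₀} ×ˢ {u | a + u * m < p}) : Set (ℝ × ℝ))
    simp only [Set.mem_union, Set.mem_prod, Set.mem_Iio, Set.mem_univ, and_true,
      Set.mem_singleton_iff, Set.mem_ofPred_eq]
    rcases lt_trichotomy q.1 x₀ with h | h | h
    · have : cdf μ q.1 < p := by
        rw [← not_le, ← leftInverse_le_iff μ h0 h1, not_le]; exact h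
      simp [h, (distTransform_le_cdf μ hq.2).trans_lt this]
    · simp [h, distTransform, ha, hm]
    · have := (le_cdf_leftInverse μ h1).trans (cdf_le_distTransform μ h hq.1)
      simp [h.ne', not_lt.2 h.le, this]
  have hmeas : MeasurableSet {u : ℝ | a + u * m < p} :=
    measurableSet_lt (by fun_prop) (by fun_prop)
  rw [measure_congr hset, measure_union (by
      rw [Set.disjoint_left]
      rintro q ⟨h, -⟩ ⟨h', -⟩
      exact absurd (show q.1 = x₀ from h') (ne_of_lt h))
    ((measurableSet_singleton x₀).prod hmeas), Measure.prod_prod, Measure.prod_prod, measure_univ,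
    mul_one, ← ofReal_measureReal (s := Set.Iio x₀), ← ofReal_measureReal (s := {x₀}), ← ha, ← hm]
  rcases hm0.eq_or_lt with h | h
  · rw [← h, ENNReal.ofReal_zero, zero_mul, add_zero]
    congr 1
    linarith
  · have hI : lam {u : ℝ | a + u * m < p} = ENNReal.ofReal ((p - a) / m) := by
      rw [hlam, Measure.restrict_apply hmeas]
      have : ({u : ℝ | a + u * m < p} ∩ Set.Icc 0 1 : Set ℝ) =ᵐ[volume]
          (Set.Ioo 0 ((p - a) / m) : Set ℝ) := by
        have hne : ∀ᵐ u : ℝ, u ≠ 0 := by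
          simp [ae_iff]
        have hne1 : ∀ᵐ u : ℝ, u ≠ 1 := by
          simp [ae_iff]
        filter_upwards [hne, hne1] with u hu hu1
        refine propext ?_
        change (a + u * m < p ∧ (0 ≤ u ∧ u ≤ 1)) ↔ (0 < u ∧ u < (p - a) / m)
        have hle1 : (p - a) / m ≤ 1 := by rw [div_le_one h]; linarith
        rw [lt_div_iff₀ h]
        constructor
        · rintro ⟨h1, h2, h3⟩
          exact ⟨lt_of_le_of_ne h2 (Ne.symm hu), by linarith⟩
        · rintro ⟨h1, h2⟩
          refine ⟨by linarith, h1.le, ?_⟩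
          have : u < (p - a) / m := by rwa [lt_div_iff₀ h]
          linarith
      rw [measure_congr this, Real.volume_Ioo, sub_zero]
    rw [hI, ← ENNReal.ofReal_mul hm0, ← ENNReal.ofReal_add measureReal_nonneg
      (mul_nonneg hm0 (div_nonneg (by linarith) hm0))]
    congr 1
    field_simp
    ring

/-- The strict version squeezes this one: from above with r decreasing to p, from below directly. -/
theorem measure_distTransform_le (μ : Measure ℝ) [IsProbabilityMeasure μ] {p : ℝ} (h0 : 0 ≤ p)
    (h1 : p < 1) :
    (μ.prod (volume.restrict (Set.Icc (0 : ℝ) 1))) {q | distTransform μ q.1 q.2 ≤ p}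
      = ENNReal.ofReal p := by
  refine le_antisymm ?_ ?_
  · have hlim : Tendsto (fun r : ℝ => ENNReal.ofReal r) (𝓝[>] p) (𝓝 (ENNReal.ofReal p)) :=
      (ENNReal.continuous_ofReal.tendsto p).mono_left nhdsWithin_le_nhds
    refine ge_of_tendsto hlim ?_
    filter_upwards [Ioo_mem_nhdsGT h1] with r hr
    rw [← measure_distTransform_lt μ (h0.trans_lt hr.1) hr.2]
    exact measure_mono fun q hq => lt_of_le_of_lt hq hr.1
  · rcases h0.eq_or_lt with rfl | h0
    · simp
    · rw [← measure_distTransform_lt μ h0 h1]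
      exact measure_mono fun q (hq : distTransform μ q.1 q.2 < p) => hq.le

theorem ae_distTransform_mem_Ioo (μ : Measure ℝ) [IsProbabilityMeasure μ] :
    ∀ᵐ q ∂(μ.prod (volume.restrict (Set.Icc (0 : ℝ) 1))),
      distTransform μ q.1 q.2 ∈ Set.Ioo 0 1 := by
  have hlam1 : IsProbabilityMeasure (volume.restrict (Set.Icc (0 : ℝ) 1)) := ⟨by simp⟩
  have h0 : ∀ᵐ q ∂(μ.prod (volume.restrict (Set.Icc (0 : ℝ) 1))),
      0 < distTransform μ q.1 q.2 := by
    rw [ae_iff]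
    simp only [not_lt]
    simpa using measure_distTransform_le μ le_rfl one_pos
  have h1 : ∀ᵐ q ∂(μ.prod (volume.restrict (Set.Icc (0 : ℝ) 1))),
      distTransform μ q.1 q.2 < 1 := by
    have hm : MeasurableSet {q : ℝ × ℝ | distTransform μ q.1 q.2 < 1} :=
      measurableSet_lt (measurable_distTransform μ) measurable_const
    refine (mem_ae_iff_prob_eq_one hm).2 (le_antisymm prob_le_one ?_)
    have hlim : Tendsto (fun r : ℝ => ENNReal.ofReal r) (𝓝[<] 1) (𝓝 (ENNReal.ofReal 1)) :=
      (ENNReal.continuous_ofReal.tendsto 1).mono_left nhdsWithin_le_nhds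
    rw [← ENNReal.ofReal_one]
    refine le_of_tendsto hlim ?_
    filter_upwards [Ioo_mem_nhdsLT (zero_lt_one (α := ℝ))] with r hr
    rw [← measure_distTransform_lt μ hr.1 hr.2]
    exact measure_mono fun q hq => lt_trans hq hr.2
  filter_upwards [h0, h1] with q hq hq' using ⟨hq, hq'⟩

/-- The distributional transform is uniform and almost surely inside (0, 1), where
`leftInverse_le_iff` turns the distribution function of the image into that of ν. -/
theorem map_comonotone (μ ν : Measure ℝ) [IsProbabilityMeasure μ] [IsProbabilityMeasure ν] :
    (μ.prod (volume.restrict (Set.Icc (0 : ℝ) 1))).map (fun q => comonotone μ ν q.1 q.2) = ν := by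
  have hlam1 : IsProbabilityMeasure (volume.restrict (Set.Icc (0 : ℝ) 1)) := ⟨by simp⟩
  have := Measure.isProbabilityMeasure_map
    (μ := μ.prod (volume.restrict (Set.Icc (0 : ℝ) 1))) (measurable_comonotone μ ν).aemeasurable
  refine Measure.ext_of_Iic _ _ fun y => ?_
  rw [Measure.map_apply (measurable_comonotone μ ν) measurableSet_Iic]
  have hset : (fun q : ℝ × ℝ => comonotone μ ν q.1 q.2) ⁻¹' Set.Iic y
      =ᵐ[μ.prod (volume.restrict (Set.Icc (0 : ℝ) 1))]
      {q : ℝ × ℝ | distTransform μ q.1 q.2 ≤ cdf ν y} := by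
    filter_upwards [ae_distTransform_mem_Ioo μ] with q hq
    exact propext (leftInverse_le_iff ν hq.1 hq.2 y)
  rw [measure_congr hset, ← ofReal_measureReal (μ := ν), ← cdf_eq_real]
  rcases (cdf_le_one ν y).eq_or_lt with h | h
  · rw [h, ENNReal.ofReal_one]
    have hm : MeasurableSet {q : ℝ × ℝ | distTransform μ q.1 q.2 ≤ 1} :=
      measurableSet_le (measurable_distTransform μ) measurable_const
    refine (mem_ae_iff_prob_eq_one hm).1 ?_
    filter_upwards [ae_distTransform_mem_Ioo μ] with q hq using hq.2.le
  · exact measure_distTransform_le μ (cdf_nonneg ν y) h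

end Comonotone

/-! ### Brownian bridges and their increments. -/

section BrownianBridge

variable {Ω : Type*} [MeasurableSpace Ω] {P : Measure Ω} {T : ℝ≥0} {β : ℝ≥0 → Ω → ℝ}

theorem IsBrownianBridge.hasGaussianLaw (h : IsBrownianBridge T β P) {t : ℝ≥0} (ht : t ≤ T) :
    HasGaussianLaw (β t) P :=
  h.gaussian.hasGaussianLaw_eval (⟨t, ht⟩ : Set.Iic T)

theorem IsBrownianBridge.memLp (h : IsBrownianBridge T β P) {t : ℝ≥0} (ht : t ≤ T) :
    MemLp (β t) 2 P :=
  (h.hasGaussianLaw ht).memLp_two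

theorem IsBrownianBridge.map_increment [IsProbabilityMeasure P] (h : IsBrownianBridge T β P)
    (hT : 0 < T) {s t : ℝ≥0} (hst : s ≤ t) (ht : t ≤ T) :
    ∃ v : ℝ≥0, (v : ℝ) = (t - s) * (1 - (t - s) / T) ∧
      P.map (fun ω => β t ω - β s ω) = gaussianReal 0 v := by
  have hs := hst.trans ht
  have hG : HasGaussianLaw (fun ω => β t ω - β s ω) P :=
    h.gaussian.hasGaussianLaw_fun_sub (s := ⟨t, ht⟩) (t := ⟨s, hs⟩)
  have hT0 : (0 : ℝ) < T := by exact_mod_cast hT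
  have hmean : ∫ ω, (β t ω - β s ω) ∂P = 0 := by
    rw [integral_sub ((h.memLp ht).integrable (by norm_num))
      ((h.memLp hs).integrable (by norm_num)), h.mean t ht, h.mean s hs, sub_zero]
  have hvar : Var[fun ω => β t ω - β s ω; P] = ((t : ℝ) - s) * (1 - (t - s) / T) := by
    rw [← covariance_self hG.aemeasurable, covariance_fun_sub_fun_sub (h.memLp ht) (h.memLp hs)
      (h.memLp ht) (h.memLp hs), h.cov t t le_rfl ht, covariance_comm (β t) (β s),
      h.cov s t hst ht, h.cov s s le_rfl hs]
    field_simp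
    ring
  refine ⟨Var[fun ω => β t ω - β s ω; P].toNNReal, ?_, ?_⟩
  · rw [Real.coe_toNNReal _ (variance_nonneg _ _), hvar]
  · rw [hG.map_eq_gaussianReal, hmean]

theorem IsBrownianBridge.cov_increments [IsProbabilityMeasure P] (h : IsBrownianBridge T β P)
    (hT : 0 < T) {s t s' t' : ℝ≥0} (hst : s ≤ t) (hts : t ≤ s') (hst' : s' ≤ t') (ht' : t' ≤ T) :
    cov[fun ω => β t ω - β s ω, fun ω => β t' ω - β s' ω; P]
      = -(((t : ℝ) - s) * (t' - s') / T) := by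
  have hs' := hst'.trans ht'
  have ht := hts.trans hs'
  have hs := hst.trans ht
  have hT0 : (0 : ℝ) < T := by exact_mod_cast hT
  rw [covariance_fun_sub_fun_sub (h.memLp ht) (h.memLp hs) (h.memLp ht') (h.memLp hs'),
    h.cov _ _ (hts.trans hst') ht', h.cov _ _ hts hs', h.cov _ _ ((hst.trans hts).trans hst') ht',
    h.cov _ _ (hst.trans hts) hs']
  field_simp
  ring

theorem ae_eq_zero_of_map_eq {f : Ω → ℝ} (hf : AEMeasurable f P) (h : P.map f = gaussianReal 0 0) :
    ∀ᵐ ω ∂P, f ω = 0 := by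
  rw [gaussianReal_zero_var] at h
  refine ae_of_ae_map hf (p := fun x => x = 0) ?_
  rw [h, ae_dirac_iff (measurableSet_eq)]

theorem IsBrownianBridge.ae_eq_zero (h : IsBrownianBridge T β P) {t : ℝ≥0} (ht : t = 0 ∨ t = T) :
    ∀ᵐ ω ∂P, β t ω = 0 := by
  have htT : t ≤ T := by rcases ht with rfl | rfl <;> simp
  have hG := h.hasGaussianLaw htT
  refine ae_eq_zero_of_map_eq hG.aemeasurable ?_
  have hv : Var[β t; P] = 0 := by
    rw [← covariance_self hG.aemeasurable, h.cov t t le_rfl htT]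
    rcases ht with rfl | rfl <;> simp
  rw [hG.map_eq_gaussianReal, h.mean t htT, hv]
  simp

/-- The majorant of finitely many Brownian bridges on `[0, T]`. -/
theorem exists_majorant_bridges [IsProbabilityMeasure P] {ι : Type*} [Fintype ι] [Nonempty ι]
    {β : ι → ℝ≥0 → Ω → ℝ} (hT : 0 < T) (h : ∀ i, IsBrownianBridge T (β i) P) :
    ∃ G : Ω → ℝ≥0∞, Measurable G ∧
      (∀ᵐ ω ∂P, ∀ i, ∀ t ≤ T, ENNReal.ofReal (β i t ω ^ 2) ≤ G ω) ∧
      ∫⁻ ω, G ω ∂P ≤ ENNReal.ofReal (144 * T * (Real.log (Fintype.card ι) + 2)) := by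
  refine exists_majorant_of_gaussian_increments hT (fun i t ht => (h i).measurable t ht)
    (fun i => (h i).ae_eq_zero (Or.inl rfl)) (fun i => (h i).continuous) fun i s t hst ht => ?_
  obtain ⟨v, hv, hlaw⟩ := (h i).map_increment hT hst ht
  refine ⟨v, ?_, hlaw⟩
  have hst' : (0 : ℝ) ≤ t - s := sub_nonneg.2 (by exact_mod_cast hst)
  have : (0 : ℝ) ≤ (t - s) / T := by positivity
  rw [hv]
  nlinarith

theorem nat_div_add_le_one {k j : ℕ} (hj : j < k) {s : ℝ≥0} (hs : s ≤ 1 / k) :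
    (j : ℝ≥0) / k + s ≤ 1 := by
  have hk : (0 : ℝ≥0) < k := by exact_mod_cast (Nat.zero_le j).trans_lt hj
  calc (j : ℝ≥0) / k + s ≤ j / k + 1 / k := by gcongr
    _ = (j + 1) / k := by rw [add_div]
    _ ≤ 1 := by
      rw [div_le_one hk]
      exact_mod_cast hj

/-- The majorant of the `k` pieces of duration `1/k` of a Brownian bridge on `[0, 1]`. -/
theorem exists_majorant_pieces [IsProbabilityMeasure P] {k : ℕ} (hk : 0 < k)
    (h : IsBrownianBridge 1 β P) :
    ∃ G : Ω → ℝ≥0∞, Measurable G ∧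
      (∀ᵐ ω ∂P, ∀ j : Fin k, ∀ s ≤ (1 / k : ℝ≥0),
        ENNReal.ofReal ((β ((j : ℕ) / k + s) ω - β ((j : ℕ) / k) ω) ^ 2) ≤ G ω) ∧
      ∫⁻ ω, G ω ∂P ≤ ENNReal.ofReal (144 * (1 / k) * (Real.log k + 2)) := by
  have hne : Nonempty (Fin k) := ⟨⟨0, hk⟩⟩
  have hk0 : (0 : ℝ≥0) < k := by exact_mod_cast hk
  have hle : ∀ (j : Fin k) {s : ℝ≥0}, s ≤ 1 / k → ((j : ℕ) : ℝ≥0) / k + s ≤ 1 :=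
    fun j _ hs => nat_div_add_le_one j.2 hs
  have hle0 : ∀ j : Fin k, ((j : ℕ) : ℝ≥0) / k ≤ 1 := fun j => by
    simpa using hle j (s := 0) zero_le
  have := exists_majorant_of_gaussian_increments (P := P) (T := 1 / k) (by positivity)
    (Y := fun (j : Fin k) s ω => β ((j : ℕ) / k + s) ω - β ((j : ℕ) / k) ω)
    (fun j s hs => (h.measurable _ (hle j hs)).sub (h.measurable _ (hle0 j)))
    (fun j => by simp) (fun j => ?_) (fun j s t hst ht => ?_)
  · simpa using this
  · filter_upwards [h.continuous] with ω hω
    refine ContinuousOn.sub ?_ continuousOn_const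
    exact hω.comp (f := fun s : ℝ≥0 => ((j : ℕ) : ℝ≥0) / k + s) (by fun_prop)
      fun s hs => hle j hs
  · obtain ⟨v, hv, hlaw⟩ := h.map_increment one_pos
      (add_le_add_right hst (((j : ℕ) : ℝ≥0) / k)) (hle j ht)
    refine ⟨v, ?_, ?_⟩
    · rw [hv]
      push_cast
      have hst' : (0 : ℝ) ≤ t - s := sub_nonneg.2 (by exact_mod_cast hst)
      nlinarith
    · rw [← hlaw]
      congr 1
      ext ω
      ring

theorem incr_add_mul {k : ℕ} (f : ℝ≥0 → ℝ) (c : ℝ) (i : Fin k) :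
    incr k (fun t => f t + t * c) i = incr k f i + c / k := by
  have hk : (k : ℝ) ≠ 0 := by exact_mod_cast i.pos.ne'
  simp only [incr]
  push_cast
  field_simp
  ring

/-- The increments of a Brownian bridge with an independent Gaussian drift are those of a Brownian
motion. -/
theorem map_incr_bridge_add [IsProbabilityMeasure P] {k : ℕ} (hk : 0 < k)
    (h : IsBrownianBridge 1 β P) {η : Ω → ℝ} (hη : HasLaw η (gaussianReal 0 1) P)
    (hind : IndepFun (fun ω => incr k fun t => β t ω) η P) :
    iIndepFun (fun (i : Fin k) ω => incr k (fun t => β t ω) i + η ω / k) P ∧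
    ∀ i : Fin k, P.map (fun ω => incr k (fun t => β t ω) i + η ω / k)
      = gaussianReal 0 (1 / k) := by
  have hk0 : (0 : ℝ≥0) < k := by exact_mod_cast hk
  have hkR : (0 : ℝ) < k := by exact_mod_cast hk
  have hle : ∀ i : ℕ, i ≤ k → (i : ℝ≥0) / k ≤ 1 := fun i hi => by
    rw [div_le_one hk0]; exact_mod_cast hi
  have hb : HasGaussianLaw (fun ω => incr k fun t => β t ω) P := by
    have := h.gaussian.hasGaussianLaw_increments (n := k)
      (t := fun i : Fin (k + 1) => ⟨((i : ℕ) : ℝ≥0) / k, hle i (Nat.lt_succ_iff.1 i.2)⟩)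
    convert this using 3
    simp [incr]
  have hηG : HasGaussianLaw η P := hη.hasGaussianLaw
  have hjoint := hind.hasGaussianLaw hb hηG
  let L : ((Fin k → ℝ) × ℝ) →L[ℝ] (Fin k → ℝ) := ContinuousLinearMap.pi fun i =>
    (ContinuousLinearMap.proj i).comp (ContinuousLinearMap.fst ℝ (Fin k → ℝ) ℝ)
      + (1 / (k : ℝ)) • ContinuousLinearMap.snd ℝ (Fin k → ℝ) ℝ
  have hw : HasGaussianLaw (fun ω => fun i : Fin k => incr k (fun t => β t ω) i + η ω / k) P := by
    have heq : (fun ω => fun i : Fin k => incr k (fun t => β t ω) i + η ω / k)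
        = fun ω => L ((incr k fun t => β t ω), η ω) := by
      ext ω i
      simp [L, div_eq_inv_mul]
    rw [heq]
    exact hjoint.map_fun L
  have hle1 : ∀ i : Fin k, (((i : ℕ) : ℝ≥0) + 1) / k ≤ 1 := fun i => by
    have := hle (i + 1) i.2
    push_cast at this
    exact this
  have hle2 : ∀ i : Fin k, ((i : ℕ) : ℝ≥0) / k ≤ (((i : ℕ) : ℝ≥0) + 1) / k := fun i => by
    gcongr; exact le_self_add
  have hb2 : ∀ i : Fin k, MemLp (fun ω => incr k (fun t => β t ω) i) 2 P := fun i =>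
    (h.memLp (hle1 i)).sub (h.memLp ((hle2 i).trans (hle1 i)))
  have hη2 : MemLp (fun ω => η ω / k) 2 P := by
    simpa [div_eq_mul_inv] using hηG.memLp_two.mul_const (k : ℝ)⁻¹
  have hηmean : ∫ ω, η ω ∂P = 0 := by rw [hη.integral_eq]; simp
  have hηvar : cov[fun ω => η ω / k, fun ω => η ω / k; P] = 1 / (k : ℝ) ^ 2 := by
    rw [covariance_fun_div_left, covariance_fun_div_right, covariance_self hη.aemeasurable,
      hη.variance_eq]
    simp
    field_simp
  have hcross : ∀ i : Fin k, cov[fun ω => incr k (fun t => β t ω) i, fun ω => η ω / k; P] = 0 := by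
    intro i
    have : IndepFun (fun ω => incr k (fun t => β t ω) i) (fun ω => η ω / k) P :=
      hind.comp (φ := fun y : Fin k → ℝ => y i) (ψ := fun x : ℝ => x / k)
        (measurable_pi_apply i) (by fun_prop)
    exact this.covariance_eq_zero (hb2 i) hη2
  have hcov : ∀ i j : Fin k, cov[fun ω => incr k (fun t => β t ω) i + η ω / k,
      fun ω => incr k (fun t => β t ω) j + η ω / k; P]
      = cov[fun ω => incr k (fun t => β t ω) i, fun ω => incr k (fun t => β t ω) j; P]
        + 1 / (k : ℝ) ^ 2 := by
    intro i j
    have e1 : (fun ω => incr k (fun t => β t ω) i + η ω / k)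
      = (fun ω => incr k (fun t => β t ω) i) + fun ω => η ω / k := rfl
    have e2 : (fun ω => incr k (fun t => β t ω) j + η ω / k)
      = (fun ω => incr k (fun t => β t ω) j) + fun ω => η ω / k := rfl
    rw [e1, e2, covariance_add_left (hb2 i) hη2 ((hb2 j).add hη2),
      covariance_add_right (hb2 i) (hb2 j) hη2, covariance_add_right hη2 (hb2 j) hη2,
      hcross i, covariance_comm (fun ω => η ω / k), hcross j, hηvar]
    ring
  have hlt : ∀ i j : Fin k, i < j → cov[fun ω => incr k (fun t => β t ω) i,
      fun ω => incr k (fun t => β t ω) j; P] = -(1 / (k : ℝ) ^ 2) := by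
    intro i j hij
    have hmid : (((i : ℕ) : ℝ≥0) + 1) / k ≤ ((j : ℕ) : ℝ≥0) / k := by
      gcongr
      exact_mod_cast hij
    have := h.cov_increments one_pos (hle2 i) hmid (hle2 j) (hle1 j)
    simp only [incr]
    rw [this]
    push_cast
    field_simp
    ring
  have hne : ∀ i j : Fin k, i ≠ j → cov[fun ω => incr k (fun t => β t ω) i,
      fun ω => incr k (fun t => β t ω) j; P] = -(1 / (k : ℝ) ^ 2) := by
    intro i j hij
    rcases lt_or_gt_of_ne hij with h | h
    · exact hlt i j h
    · rw [covariance_comm]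
      exact hlt j i h
  -- The covariance -1/k² of distinct bridge increments is cancelled by the variance 1/k² of the
  -- drift; jointly Gaussian uncorrelated variables are independent.
  refine ⟨hw.iIndepFun_of_covariance_eq_zero fun i j hij => ?_, fun i => ?_⟩
  · rw [hcov, hne i j hij]
    ring
  · have hi := hw.eval (X := fun (i : Fin k) ω => incr k (fun t => β t ω) i + η ω / k) i
    obtain ⟨v, hv, hlaw⟩ := h.map_increment one_pos (hle2 i) (hle1 i)
    have hlaw' : P.map (fun ω => incr k (fun t => β t ω) i) = gaussianReal 0 v := hlaw
    have hbL : HasLaw (fun ω => incr k (fun t => β t ω) i) (gaussianReal 0 v) P :=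
      ⟨(hb2 i).aestronglyMeasurable.aemeasurable, hlaw'⟩
    have hm : ∫ ω, (incr k (fun t => β t ω) i + η ω / k) ∂P = 0 := by
      rw [integral_add ((hb2 i).integrable (by norm_num)) (hη2.integrable (by norm_num)),
        integral_div, hηmean, hbL.integral_eq]
      simp
    -- The bridge contributes (1/k)(1 - 1/k) and the drift 1/k².
    have hvar : Var[fun ω => incr k (fun t => β t ω) i + η ω / k; P] = 1 / k := by
      rw [← covariance_self hi.aemeasurable, hcov, covariance_self hbL.aemeasurable,
        hbL.variance_eq, variance_id_gaussianReal, hv]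
      push_cast
      field_simp
      ring
    rw [hi.map_eq_gaussianReal, hm, hvar]
    congr 1
    ext
    simp

end BrownianBridge

/-! ### Matching two samples in order. -/

section Matching

open Classical in
/-- The numbers `w i` in the order of the pairs `(x i, u i)`, written so as to be measurable and
equivariant: the sum has a single term when there are no ties. -/
noncomputable def matched {k : ℕ} (x u w : Fin k → ℝ) (i : Fin k) : ℝ :=
  ∑ σ : Equiv.Perm (Fin k), if IsReordering x u w σ then w (σ i) else 0

theorem matched_eq {k : ℕ} {x u w : Fin k → ℝ} (hw : Function.Injective w)
    (hu : Function.Injective u) (i : Fin k) : matched x u w i = w (reordering x u w i) := by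
  classical
  obtain ⟨σ, hσ, huniq⟩ := existsUnique_isReordering x u w hw hu
  have hr : reordering x u w = σ := by
    unfold reordering
    have hex : ∃ σ, IsReordering x u w σ := ⟨σ, hσ⟩
    rw [dif_pos hex]
    exact huniq _ hex.choose_spec
  rw [hr]
  unfold matched
  rw [Finset.sum_eq_single σ]
  · rw [if_pos hσ]
  · intro τ _ hτ
    rw [if_neg fun h => hτ (huniq τ h)]
  · simp

theorem isReordering_reordering {k : ℕ} {x u w : Fin k → ℝ} (hw : Function.Injective w)
    (hu : Function.Injective u) : IsReordering x u w (reordering x u w) := by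
  have hex : ∃ σ, IsReordering x u w σ := (existsUnique_isReordering x u w hw hu).exists
  unfold reordering
  rw [dif_pos hex]
  exact hex.choose_spec

theorem isReordering_comp_iff {k : ℕ} (x u w : Fin k → ℝ) (σ τ : Equiv.Perm (Fin k)) :
    IsReordering (x ∘ τ) (u ∘ τ) w (τ.trans σ) ↔ IsReordering x u w σ := by
  constructor
  · intro h i j hij
    have := h (τ.symm i) (τ.symm j) (fun e => hij (τ.symm.injective e))
    simpa using this
  · intro h i j hij
    exact h (τ i) (τ j) (fun e => hij (τ.injective e))

/-- Reindexing the sum over permutations by composition with τ. No permutation is chosen, so the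
identity holds everywhere, ties included. -/
theorem matched_comp {k : ℕ} (x u w : Fin k → ℝ) (τ : Equiv.Perm (Fin k)) (i : Fin k) :
    matched (x ∘ τ) (u ∘ τ) w i = matched x u w (τ i) := by
  classical
  unfold matched
  refine (Fintype.sum_equiv (Equiv.mulRight τ) _ _ fun σ => ?_).symm
  simp only [Equiv.coe_mulRight, Equiv.Perm.mul_def, isReordering_comp_iff, Equiv.trans_apply]

theorem measurableSet_isReordering {k : ℕ} {α : Type*} [MeasurableSpace α]
    {x u w : α → Fin k → ℝ} (hx : Measurable x) (hu : Measurable u) (hw : Measurable w)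
    (σ : Equiv.Perm (Fin k)) : MeasurableSet {a | IsReordering (x a) (u a) (w a) σ} := by
  simp only [IsReordering]
  refine measurableSet_setOfPred.2 (Measurable.forall fun i => Measurable.forall fun j => ?_)
  have hx' : ∀ i, Measurable fun a => x a i := fun i => (measurable_pi_apply i).comp hx
  have hu' : ∀ i, Measurable fun a => u a i := fun i => (measurable_pi_apply i).comp hu
  have hw' : ∀ i, Measurable fun a => w a i := fun i => (measurable_pi_apply i).comp hw
  refine Measurable.imp measurable_const (Measurable.iff ?_ (.or ?_ (.and ?_ ?_))) <;>
    refine measurableSet_setOfPred.1 ?_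
  · exact measurableSet_lt (hw' _) (hw' _)
  · exact measurableSet_lt (hx' _) (hx' _)
  · exact measurableSet_eq_fun (hx' _) (hx' _)
  · exact measurableSet_lt (hu' _) (hu' _)

theorem measurable_matched {k : ℕ} {α : Type*} [MeasurableSpace α]
    {x u w : α → Fin k → ℝ} (hx : Measurable x) (hu : Measurable u) (hw : Measurable w)
    (i : Fin k) : Measurable fun a => matched (x a) (u a) (w a) i := by
  unfold matched
  refine Finset.measurable_fun_sum _ fun σ _ => ?_
  exact Measurable.ite (measurableSet_isReordering hx hu hw σ)
    ((measurable_pi_apply _).comp hw) measurable_const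

/-- The sum of squared differences of two samples that are matched in order. -/
theorem sum_sq_sub_eq_ordStat {k : ℕ} {x u w ξ : Fin k → ℝ} (hu : Function.Injective u)
    {σ : Equiv.Perm (Fin k)} (hσ : IsReordering x u w σ)
    (hξ : ∀ i j, (x i < x j ∨ (x i = x j ∧ u i < u j)) → ξ i ≤ ξ j) :
    ∑ i, (w (σ i) - ξ i) ^ 2 = ∑ j, (ordStat w j - ordStat ξ j) ^ 2 := by
  set g : Fin k → ℝ ×ₗ ℝ := fun i => toLex (x i, u i) with hg
  -- Read along the lexicographic order of the pairs (x, u), both ξ and the permuted w increase, so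
  -- they list their order statistics.
  set s := Tuple.sort g with hs
  have hlex : ∀ a b, a < b → (x (s a) < x (s b) ∨ (x (s a) = x (s b) ∧ u (s a) < u (s b))) := by
    intro a b hab
    have h := Tuple.monotone_sort g hab.le
    simp only [Function.comp_apply, hg, Prod.Lex.toLex_le_toLex] at h
    rcases h with h | ⟨h, h'⟩
    · exact Or.inl h
    · exact Or.inr ⟨h, lt_of_le_of_ne h' fun e => hab.ne (s.injective (hu e))⟩
  have hm1 : Monotone (ξ ∘ s) := by
    intro a b hab
    rcases hab.eq_or_lt with rfl | h
    · exact le_rfl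
    · exact hξ _ _ (hlex a b h)
  have hm2 : Monotone (w ∘ (s.trans σ)) := by
    intro a b hab
    rcases hab.eq_or_lt with rfl | h
    · exact le_rfl
    · exact ((hσ _ _ fun e => h.ne (s.injective e)).2 (hlex a b h)).le
  rw [← Equiv.sum_comp s]
  refine Finset.sum_congr rfl fun j _ => ?_
  rw [← ordStat_eq_of_monotone hm1, ← ordStat_eq_of_monotone hm2]
  rfl

end Matching

/-! ### Independence and joint law of the sources. -/

section Independence

/-- By Fubini the diagonal is a null set of the product law, each of its sections being a single
point. -/
theorem ae_ne_of_indepFun {Ω : Type*} [MeasurableSpace Ω] {P : Measure Ω} [IsProbabilityMeasure P]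
    {f g : Ω → ℝ} (hf : Measurable f) (hg : Measurable g) (h : IndepFun f g P)
    (hatom : ∀ x, P.map g {x} = 0) : ∀ᵐ ω ∂P, f ω ≠ g ω := by
  have hm : MeasurableSet {p : ℝ × ℝ | p.1 = p.2} :=
    measurableSet_eq_fun measurable_fst measurable_snd
  have hlaw := (indepFun_iff_map_prod_eq_prod_map_map hf.aemeasurable hg.aemeasurable).1 h
  have hnull : (P.map fun ω => (f ω, g ω)) {p : ℝ × ℝ | p.1 = p.2} = 0 := by
    rw [hlaw, Measure.measure_prod_null hm]
    refine ae_of_all _ fun x => ?_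
    have : Prod.mk x ⁻¹' {p : ℝ × ℝ | p.1 = p.2} = {x} := by
      ext y; simp [eq_comm]
    simp only [this, hatom, Pi.zero_apply]
  rw [Measure.map_apply (hf.prodMk hg) hm] at hnull
  rw [ae_iff]
  simpa using hnull

theorem ae_injective_of_iIndepFun {Ω : Type*} [MeasurableSpace Ω] {P : Measure Ω}
    [IsProbabilityMeasure P] {k : ℕ} {f : Fin k → Ω → ℝ} (hf : ∀ i, Measurable (f i))
    (h : iIndepFun f P) (hatom : ∀ i x, P.map (f i) {x} = 0) :
    ∀ᵐ ω ∂P, Function.Injective fun i => f i ω := by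
  have h1 : ∀ i j, i ≠ j → ∀ᵐ ω ∂P, f i ω ≠ f j ω := fun i j hij =>
    ae_ne_of_indepFun (hf i) (hf j) (h.indepFun hij) (hatom j)
  have h2 : ∀ᵐ ω ∂P, ∀ i j, i ≠ j → f i ω ≠ f j ω :=
    ae_all_iff.2 fun i => ae_all_iff.2 fun j => by
      by_cases hij : i = j
      · exact ae_of_all _ fun ω h => absurd hij h
      · filter_upwards [h1 i j hij] with ω hω _ using hω
  filter_upwards [h2] with ω hω i j hij
  by_contra hne
  exact hω i j hne hij

variable {Ω : Type*} {k : ℕ} {R : Ingredients Ω k} {X : ℝ≥0 → Ω → ℝ}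

theorem Ingredients.measurable_incr_levy (R : Ingredients Ω k) (X : ℝ≥0 → Ω → ℝ) :
    Measurable[R.sigma X .levy] fun ω => incr k fun t => X t ω := by
  have h : Measurable fun f : ℝ≥0 → ℝ => incr k f := by
    refine measurable_pi_lambda _ fun i => ?_
    unfold incr
    fun_prop
  exact h.comp (comap_measurable _)

theorem Ingredients.measurable_apply_levy (R : Ingredients Ω k) (X : ℝ≥0 → Ω → ℝ) (t : ℝ≥0) :
    Measurable[R.sigma X .levy] (X t) :=
  (measurable_pi_apply t).comp (comap_measurable (fun ω (t : ℝ≥0) => X t ω))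

theorem Ingredients.measurable_incr_bridge (R : Ingredients Ω k) (X : ℝ≥0 → Ω → ℝ) :
    Measurable[R.sigma X .bridge] fun ω => incr k fun t => R.bridge t ω := by
  have hle : ∀ i : Fin k, (((i : ℕ) : ℝ≥0) + 1) / k ≤ 1 := fun i => by
    have hk0 : (0 : ℝ≥0) < k := by exact_mod_cast i.pos
    rw [div_le_one hk0]
    exact_mod_cast i.2
  have hle' : ∀ i : Fin k, ((i : ℕ) : ℝ≥0) / k ≤ 1 := fun i => by
    refine le_trans ?_ (hle i)
    gcongr
    exact le_self_add
  have h : Measurable fun (f : Set.Iic (1 : ℝ≥0) → ℝ) (i : Fin k) =>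
      f ⟨_, hle i⟩ - f ⟨_, hle' i⟩ := by
    fun_prop
  exact h.comp (comap_measurable (fun ω (t : Set.Iic (1 : ℝ≥0)) => R.bridge t ω))

theorem Ingredients.measurable_of_mem {α : Type*} [MeasurableSpace α] {f : Ω → α} {s : Source k}
    {S : Set (Source k)} (hs : s ∈ S) (hf : Measurable[R.sigma X s] f) :
    Measurable[⨆ s ∈ S, R.sigma X s] f :=
  hf.mono (le_biSup (R.sigma X) hs) le_rfl

theorem Ingredients.measurable_uniforms_of_mem {S : Set (Source k)}
    (hS : ∀ i, Source.uniforms i ∈ S) :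
    Measurable[⨆ s ∈ S, R.sigma X s] fun ω => fun i => R.Us i ω := by
  have h : ∀ i, Measurable[⨆ s ∈ S, R.sigma X s] (R.Us i) := fun i =>
    Ingredients.measurable_of_mem (s := .uniforms i) (hS i) (comap_measurable (R.Us i))
  generalize (⨆ s ∈ S, R.sigma X s) = m at h ⊢
  exact measurable_pi_lambda _ h

theorem Ingredients.measurable_bridge_uniform_of_mem {S : Set (Source k)}
    (h1 : Source.bridge ∈ S) (h2 : Source.uniform ∈ S) :
    Measurable[⨆ s ∈ S, R.sigma X s] fun ω => ((incr k fun t => R.bridge t ω), R.U ω) := by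
  have hb := Ingredients.measurable_of_mem (X := X) h1 (R.measurable_incr_bridge X)
  have hU : Measurable[⨆ s ∈ S, R.sigma X s] R.U :=
    Ingredients.measurable_of_mem (s := .uniform) h2 (comap_measurable R.U)
  generalize (⨆ s ∈ S, R.sigma X s) = m at hb hU ⊢
  exact hb.prodMk hU

theorem Ingredients.measurable_uniforms_bridge_of_mem {S : Set (Source k)}
    (hS : ∀ i, Source.uniforms i ∈ S) (h1 : Source.bridge ∈ S) (h2 : Source.uniform ∈ S) :
    Measurable[⨆ s ∈ S, R.sigma X s] fun ω => ((fun i => R.Us i ω),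
      (incr k fun t => R.bridge t ω), R.U ω) := by
  have hu := Ingredients.measurable_uniforms_of_mem (R := R) (X := X) hS
  have hb := Ingredients.measurable_bridge_uniform_of_mem (R := R) (X := X) h1 h2
  generalize (⨆ s ∈ S, R.sigma X s) = m at hu hb ⊢
  exact hu.prodMk hb

theorem Ingredients.measurable_endpoint_of_mem {S : Set (Source k)}
    (hh : Measurable (Function.uncurry R.h)) (h1 : Source.levy ∈ S) (h2 : Source.uniform ∈ S) :
    Measurable[⨆ s ∈ S, R.sigma X s] fun ω => R.h (X 1 ω) (R.U ω) := by
  have hx := Ingredients.measurable_of_mem (X := X) h1 (R.measurable_apply_levy X 1)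
  have hU : Measurable[⨆ s ∈ S, R.sigma X s] R.U :=
    Ingredients.measurable_of_mem (s := .uniform) h2 (comap_measurable R.U)
  generalize (⨆ s ∈ S, R.sigma X s) = m at hx hU ⊢
  exact hh.comp (hx.prodMk hU)

variable [mΩ : MeasurableSpace Ω] {P : Measure Ω}

theorem IsLevyProcess.iIndepFun_incr (hX : IsLevyProcess X P) (k : ℕ) :
    iIndepFun (fun (i : Fin k) ω => incr k (fun t => X t ω) i) P := by
  have h := hX.indep k (fun i => ((i : ℕ) : ℝ≥0) / k) fun i j hij => by
    dsimp only
    gcongr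
    exact hij
  simpa [incr] using h

theorem IsLevyProcess.measurable_incr (hX : IsLevyProcess X P) (i : Fin k) :
    Measurable fun ω => incr k (fun t => X t ω) i :=
  (hX.measurable _).sub (hX.measurable _)

theorem IsLevyProcess.map_incr (hX : IsLevyProcess X P) (i : Fin k) :
    P.map (fun ω => incr k (fun t => X t ω) i) = P.map (X (1 / k)) := by
  have h := (hX.stationary ((i : ℕ) / k) (1 / k)).map_eq
  rw [← h]
  simp only [incr, add_div]

theorem sum_incr {k : ℕ} (hk : 0 < k) (f : ℝ≥0 → ℝ) : ∑ i : Fin k, incr k f i = f 1 - f 0 := by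
  have hk0 : (k : ℝ≥0) ≠ 0 := by exact_mod_cast hk.ne'
  have h : ∀ i : Fin k, incr k f i
      = f (((i : ℕ) + 1 : ℕ) / k) - f (((i : ℕ) : ℝ≥0) / k) := fun i => by
    simp [incr]
  simp_rw [h]
  rw [Fin.sum_univ_eq_sum_range (fun i => f (((i + 1 : ℕ) : ℝ≥0) / k) - f ((i : ℝ≥0) / k)),
    Finset.sum_range_sub (fun i => f ((i : ℝ≥0) / k))]
  simp [hk0]

theorem Ingredients.Valid.sigma_le (hR : R.Valid X P) (hX : IsLevyProcess X P) (s : Source k) :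
    R.sigma X s ≤ mΩ := by
  cases s with
  | levy => exact (measurable_pi_lambda _ hX.measurable).comap_le
  | uniform => exact hR.measurable_U.comap_le
  | uniforms i => exact (hR.measurable_Us i).comap_le
  | bridge => exact (measurable_pi_lambda _ fun t : Set.Iic (1 : ℝ≥0) =>
      hR.bridge.measurable t t.2).comap_le
  | bridges i => exact (measurable_pi_lambda _ fun t : Set.Iic (1 / k : ℝ≥0) =>
      (hR.bridges i).measurable t t.2).comap_le

theorem Ingredients.Valid.indepFun (hR : R.Valid X P) (hX : IsLevyProcess X P)
    {α β : Type*} [MeasurableSpace α] [MeasurableSpace β] {f : Ω → α} {g : Ω → β}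
    {S T : Set (Source k)} (hST : Disjoint S T) (hf : Measurable[⨆ s ∈ S, R.sigma X s] f)
    (hg : Measurable[⨆ s ∈ T, R.sigma X s] g) : IndepFun f g P := by
  rw [IndepFun_iff_Indep]
  exact indep_of_indep_of_le (indep_iSup_of_disjoint (hR.sigma_le hX) hR.indep hST)
    hf.comap_le hg.comap_le

theorem map_eq_of_isUniform {f : Ω → ℝ} (h : pdf.IsUniform f (Set.Icc 0 1) P) :
    P.map f = volume.restrict (Set.Icc (0 : ℝ) 1) := by
  rw [h, ProbabilityTheory.cond]
  simp

/-- The joint law of the sources of the reordering coupling. -/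
theorem Ingredients.Valid.map_sources [IsProbabilityMeasure P] (hR : R.Valid X P)
    (hX : IsLevyProcess X P) :
    P.map (fun ω => ((incr k fun t => X t ω), (fun i => R.Us i ω),
      (incr k fun t => R.bridge t ω), R.U ω))
      = (Measure.pi fun _ : Fin k => P.map (X (1 / k))).prod
        ((Measure.pi fun _ : Fin k => volume.restrict (Set.Icc (0 : ℝ) 1)).prod
          (P.map fun ω => ((incr k fun t => R.bridge t ω), R.U ω))) := by
  have mx : Measurable fun ω => incr k fun t => X t ω :=
    (R.measurable_incr_levy X).mono (hR.sigma_le hX _) le_rfl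
  have mb : Measurable fun ω => incr k fun t => R.bridge t ω :=
    (R.measurable_incr_bridge X).mono (hR.sigma_le hX _) le_rfl
  have mu : Measurable fun ω => fun i => R.Us i ω := measurable_pi_lambda _ hR.measurable_Us
  have i1 : IndepFun (fun ω => incr k fun t => X t ω) (fun ω => ((fun i => R.Us i ω),
      (incr k fun t => R.bridge t ω), R.U ω)) P :=
    hR.indepFun hX (S := {.levy}) (T := {.levy}ᶜ) disjoint_compl_right
      (Ingredients.measurable_of_mem (s := .levy) (by simp) (R.measurable_incr_levy X))
      (Ingredients.measurable_uniforms_bridge_of_mem (by simp) (by simp) (by simp))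
  have i2 : IndepFun (fun ω => fun i => R.Us i ω)
      (fun ω => ((incr k fun t => R.bridge t ω), R.U ω)) P :=
    hR.indepFun hX (S := Set.range .uniforms) (T := (Set.range .uniforms)ᶜ) disjoint_compl_right
      (Ingredients.measurable_uniforms_of_mem (by simp))
      (Ingredients.measurable_bridge_uniform_of_mem (by simp) (by simp))
  have i3 : iIndepFun R.Us P := by
    have hinj : Function.Injective (Source.uniforms : Fin k → Source k) := fun a b h => by
      cases h; rfl
    exact hR.indep.precomp hinj
  rw [(indepFun_iff_map_prod_eq_prod_map_map mx.aemeasurable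
      (mu.prodMk (mb.prodMk hR.measurable_U)).aemeasurable).1 i1,
    (indepFun_iff_map_prod_eq_prod_map_map mu.aemeasurable
      (mb.prodMk hR.measurable_U).aemeasurable).1 i2,
    i3.map_fun_eq_pi_map fun i => (hR.measurable_Us i).aemeasurable]
  have hx := (hX.iIndepFun_incr k).map_fun_eq_pi_map fun i => (hX.measurable_incr i).aemeasurable
  simp only [hX.map_incr] at hx
  simp only [map_eq_of_isUniform (hR.uniforms _)]
  rw [← hx]

theorem Ingredients.Valid.indepFun_bridge_endpoint [IsProbabilityMeasure P] (hR : R.Valid X P)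
    (hX : IsLevyProcess X P) :
    IndepFun (fun ω => incr k fun t => R.bridge t ω) (fun ω => R.h (X 1 ω) (R.U ω)) P := by
  exact hR.indepFun hX (S := {.bridge}) (T := {.bridge}ᶜ) disjoint_compl_right
    (Ingredients.measurable_of_mem (s := .bridge) (by simp) (R.measurable_incr_bridge X))
    (Ingredients.measurable_endpoint_of_mem hR.measurable_h (by simp) (by simp))

theorem map_comp_perm_pi (γ : Measure ℝ) [IsProbabilityMeasure γ] (τ : Equiv.Perm (Fin k)) :
    MeasurePreserving (fun y : Fin k → ℝ => y ∘ τ) (Measure.pi fun _ => γ)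
      (Measure.pi fun _ => γ) := by
  have := (measurePreserving_piCongrLeft (α := fun _ : Fin k => ℝ) (fun _ => γ) τ.symm)
  convert this using 1
  ext y i
  have h := Equiv.piCongrLeft_apply_apply (P := fun _ : Fin k => ℝ) τ.symm y (τ i)
  simp only [Equiv.symm_apply_apply] at h
  exact h.symm

end Independence

/-! ### Differences of increments: exchangeability and sum of squares. -/

section Discrepancy

theorem _root_.Measurable.comonotone {α : Type*} [MeasurableSpace α] {f g : α → ℝ}
    (hf : Measurable f) (hg : Measurable g) (μ ν : Measure ℝ) [IsProbabilityMeasure μ]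
    [IsProbabilityMeasure ν] : Measurable fun a => comonotone μ ν (f a) (g a) := by
  have h := (measurable_comonotone μ ν).comp (hf.prodMk hg)
  simpa only [Function.comp_def] using h

instance isProbabilityMeasure_volume_restrict_Icc :
    IsProbabilityMeasure ((volume : Measure ℝ).restrict (Set.Icc 0 1)) :=
  ⟨by simp⟩

variable {Ω : Type*} {k : ℕ}

/-- The differences between the increments of the two couplings, as a function of the increments
of the Lévy process, of the uniforms, and of the increments of the Brownian bridge. -/
noncomputable def Ingredients.discrepancy (R : Ingredients Ω k) (μ : Measure ℝ)
    (q : (Fin k → ℝ) × (Fin k → ℝ) × (Fin k → ℝ) × ℝ) (i : Fin k) : ℝ :=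
  matched q.1 q.2.1 (fun j => q.2.2.1 j + R.h (∑ l, q.1 l) q.2.2.2 / k) i
    - comonotone μ (gaussianReal 0 (1 / k)) (q.1 i) (q.2.1 i)

theorem Ingredients.measurable_discrepancy (R : Ingredients Ω k) (μ : Measure ℝ)
    [IsProbabilityMeasure μ] (hh : Measurable (Function.uncurry R.h)) :
    Measurable (R.discrepancy μ) := by
  refine measurable_pi_lambda _ fun i => Measurable.sub ?_ ?_
  · refine measurable_matched measurable_fst (measurable_fst.comp measurable_snd)
      (measurable_pi_lambda _ fun j => ?_) i
    have h1 : Measurable fun q : (Fin k → ℝ) × (Fin k → ℝ) × (Fin k → ℝ) × ℝ => ∑ l, q.1 l := by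
      fun_prop
    have h2 : Measurable fun q : (Fin k → ℝ) × (Fin k → ℝ) × (Fin k → ℝ) × ℝ => q.2.2.2 := by
      fun_prop
    have h3 := hh.comp (h1.prodMk h2)
    have h4 : Measurable fun q : (Fin k → ℝ) × (Fin k → ℝ) × (Fin k → ℝ) × ℝ => q.2.2.1 j := by
      fun_prop
    exact h4.add (h3.div_const _)
  · exact Measurable.comonotone (by fun_prop) (by fun_prop) _ _

/-- The end-point enters only through the sum of the increments, which is symmetric. The sample to
be rearranged thus stays fixed while the order imposed on it is permuted. -/
theorem Ingredients.discrepancy_comp (R : Ingredients Ω k) (μ : Measure ℝ)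
    (x u : Fin k → ℝ) (p : (Fin k → ℝ) × ℝ) (τ : Equiv.Perm (Fin k)) :
    R.discrepancy μ (x ∘ τ, u ∘ τ, p) = R.discrepancy μ (x, u, p) ∘ τ := by
  ext i
  simp only [Ingredients.discrepancy, matched_comp, Function.comp_apply]
  rw [Equiv.sum_comp τ x]

theorem Ingredients.exchangeable_discrepancy (R : Ingredients Ω k) (μ γ : Measure ℝ)
    [IsProbabilityMeasure μ] [IsProbabilityMeasure γ] (κ : Measure ((Fin k → ℝ) × ℝ))
    [IsProbabilityMeasure κ] (hh : Measurable (Function.uncurry R.h)) :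
    Exchangeable (((Measure.pi fun _ : Fin k => μ).prod
      ((Measure.pi fun _ : Fin k => γ).prod κ)).map (R.discrepancy μ)) := by
  intro τ
  have hT := (map_comp_perm_pi μ τ).prod ((map_comp_perm_pi γ τ).prod (MeasurePreserving.id κ))
  have hD := R.measurable_discrepancy μ hh
  rw [Measure.map_map (measurable_comp_perm τ) hD]
  conv_rhs => rw [← hT.map_eq]
  rw [Measure.map_map hD hT.measurable]
  congr 1
  ext1 q
  exact (R.discrepancy_comp μ q.1 q.2.1 q.2.2 τ).symm

theorem Ingredients.incr_W' (R : Ingredients Ω k) (X : ℝ≥0 → Ω → ℝ) (ω : Ω) (i : Fin k) :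
    incr k (fun t => R.W' X t ω) i
      = incr k (fun t => R.bridge t ω) i + R.h (X 1 ω) (R.U ω) / k :=
  incr_add_mul (fun t => R.bridge t ω) (R.h (X 1 ω) (R.U ω)) i

variable {R : Ingredients Ω k} {X : ℝ≥0 → Ω → ℝ} [MeasurableSpace Ω] {P : Measure Ω}

theorem Ingredients.Valid.measurable_endpoint (hR : R.Valid X P) (hX : IsLevyProcess X P) :
    Measurable fun ω => R.h (X 1 ω) (R.U ω) :=
  hR.measurable_h.comp ((hX.measurable 1).prodMk hR.measurable_U)

theorem Ingredients.Valid.measurable_incr_bridge (hR : R.Valid X P) (hX : IsLevyProcess X P) :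
    Measurable fun ω => incr k fun t => R.bridge t ω :=
  (R.measurable_incr_bridge X).mono (hR.sigma_le hX _) le_rfl

theorem Ingredients.Valid.measurable_incr_W' (hR : R.Valid X P) (hX : IsLevyProcess X P) :
    Measurable fun ω => incr k fun t => R.W' X t ω := by
  refine measurable_pi_lambda _ fun i => ?_
  simp only [R.incr_W' X]
  exact ((measurable_pi_apply i).comp (hR.measurable_incr_bridge hX)).add
    ((hR.measurable_endpoint hX).div_const _)

theorem Ingredients.Valid.indepFun_levy_uniforms (hR : R.Valid X P) (hX : IsLevyProcess X P) :
    IndepFun (fun ω => incr k fun t => X t ω) (fun ω => fun i => R.Us i ω) P :=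
  hR.indepFun hX (S := {.levy}) (T := {.levy}ᶜ) disjoint_compl_right
    (Ingredients.measurable_of_mem (s := .levy) (by simp) (R.measurable_incr_levy X))
    (Ingredients.measurable_uniforms_of_mem (by simp))

theorem Ingredients.Valid.iIndepFun_uniforms (hR : R.Valid X P) : iIndepFun R.Us P := by
  have hinj : Function.Injective (Source.uniforms : Fin k → Source k) := fun a b h => by
    cases h; rfl
  exact hR.indep.precomp hinj

variable [IsProbabilityMeasure P]

theorem Ingredients.Valid.map_increment_uniform (hR : R.Valid X P) (hX : IsLevyProcess X P)
    (i : Fin k) : P.map (fun ω => (incr k (fun t => X t ω) i, R.Us i ω))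
      = (P.map (X (1 / k))).prod (volume.restrict (Set.Icc (0 : ℝ) 1)) := by
  have h := (hR.indepFun_levy_uniforms hX).comp (measurable_pi_apply i) (measurable_pi_apply i)
  have h' := (indepFun_iff_map_prod_eq_prod_map_map (hX.measurable_incr i).aemeasurable
    (hR.measurable_Us i).aemeasurable).1 h
  rw [← map_eq_of_isUniform (hR.uniforms i), ← hX.map_incr i]
  exact h'

theorem Ingredients.Valid.measurable_xi (hR : R.Valid X P) (hX : IsLevyProcess X P) (i : Fin k) :
    Measurable (R.xi X P i) := by
  have := Measure.isProbabilityMeasure_map (μ := P) (hX.measurable (1 / k)).aemeasurable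
  unfold Ingredients.xi
  exact (hX.measurable_incr i).comonotone (hR.measurable_Us i) _ _

/-- The pairs (increment, uniform) are i.i.d. with the product law required by `map_comonotone`,
which then applies in each coordinate. -/
theorem Ingredients.Valid.map_xi (hR : R.Valid X P) (hX : IsLevyProcess X P) :
    P.map (fun ω i => R.xi X P i ω) = Measure.pi fun _ : Fin k => gaussianReal 0 (1 / k) := by
  have := Measure.isProbabilityMeasure_map (μ := P) (hX.measurable (1 / k)).aemeasurable
  set μ := P.map (X (1 / k)) with hμ
  set γ : Measure ℝ := volume.restrict (Set.Icc (0 : ℝ) 1) with hγ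
  have mx : Measurable fun ω => incr k fun t => X t ω :=
    measurable_pi_lambda _ fun i => hX.measurable_incr i
  have mu : Measurable fun ω => fun i => R.Us i ω := measurable_pi_lambda _ hR.measurable_Us
  have hlaw := (indepFun_iff_map_prod_eq_prod_map_map mx.aemeasurable mu.aemeasurable).1
    (hR.indepFun_levy_uniforms hX)
  have hx := (hX.iIndepFun_incr k).map_fun_eq_pi_map fun i => (hX.measurable_incr i).aemeasurable
  have hu := hR.iIndepFun_uniforms.map_fun_eq_pi_map fun i => (hR.measurable_Us i).aemeasurable
  simp only [hX.map_incr] at hx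
  simp only [map_eq_of_isUniform (hR.uniforms _)] at hu
  have e : MeasurePreserving (MeasurableEquiv.arrowProdEquivProdArrow ℝ ℝ (Fin k)).symm
      ((Measure.pi fun _ => μ).prod (Measure.pi fun _ => γ)) (Measure.pi fun _ => μ.prod γ) :=
    (measurePreserving_arrowProdEquivProdArrow ℝ ℝ (Fin k) (fun _ => μ) (fun _ => γ)).symm
  have c : MeasurePreserving (fun (a : Fin k → ℝ × ℝ) i =>
      comonotone μ (gaussianReal 0 (1 / k)) (a i).1 (a i).2)
      (Measure.pi fun _ => μ.prod γ) (Measure.pi fun _ => gaussianReal 0 (1 / k)) :=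
    measurePreserving_pi (fun _ => μ.prod γ) (fun _ => gaussianReal 0 (1 / k)) fun _ =>
      ⟨measurable_comonotone μ _, map_comonotone μ _⟩
  have p : MeasurePreserving (fun ω => ((incr k fun t => X t ω), (fun i => R.Us i ω))) P
      ((Measure.pi fun _ => μ).prod (Measure.pi fun _ => γ)) := by
    refine ⟨mx.prodMk mu, ?_⟩
    rw [hlaw, ← hu, ← hx]
  exact ((c.comp e).comp p).map_eq

theorem Ingredients.Valid.law_incr_W' (hk : 0 < k) (hR : R.Valid X P) (hX : IsLevyProcess X P) :
    iIndepFun (fun (i : Fin k) ω => incr k (fun t => R.W' X t ω) i) P ∧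
      ∀ i : Fin k, P.map (fun ω => incr k (fun t => R.W' X t ω) i) = gaussianReal 0 (1 / k) := by
  have h := map_incr_bridge_add hk hR.bridge hR.endpoint (hR.indepFun_bridge_endpoint hX)
  simpa only [← Ingredients.incr_W'] using h

theorem Ingredients.Valid.map_incr_W' (hk : 0 < k) (hR : R.Valid X P) (hX : IsLevyProcess X P) :
    P.map (fun ω => incr k fun t => R.W' X t ω)
      = Measure.pi fun _ : Fin k => gaussianReal 0 (1 / k) := by
  obtain ⟨h1, h2⟩ := hR.law_incr_W' hk hX
  have h := h1.map_fun_eq_pi_map fun i =>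
    ((measurable_pi_apply i).comp (hR.measurable_incr_W' hX)).aemeasurable
  exact h.trans (congrArg Measure.pi (funext h2))

theorem Ingredients.Valid.ae_injective_Us (hR : R.Valid X P) :
    ∀ᵐ ω ∂P, Function.Injective fun i => R.Us i ω :=
  ae_injective_of_iIndepFun hR.measurable_Us hR.iIndepFun_uniforms fun i x => by
    rw [map_eq_of_isUniform (hR.uniforms i)]
    exact measure_singleton x

theorem Ingredients.Valid.ae_injective_incr_W' (hk : 0 < k) (hR : R.Valid X P)
    (hX : IsLevyProcess X P) :
    ∀ᵐ ω ∂P, Function.Injective (incr k fun t => R.W' X t ω) := by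
  obtain ⟨h1, h2⟩ := hR.law_incr_W' hk hX
  refine ae_injective_of_iIndepFun
    (fun i => (measurable_pi_apply i).comp (hR.measurable_incr_W' hX)) h1 fun i x => ?_
  have hv : (1 / k : ℝ≥0) ≠ 0 := by positivity
  have := nullSingletonClass_gaussianReal (μ := 0) hv
  refine (congrArg (fun m : Measure ℝ => m {x}) (h2 i)).trans ?_
  exact measure_singleton x

/-- The distributional transform respects the lexicographic order of (increment, uniform), and
almost surely takes values in (0, 1), where the quantile function is monotone. -/
theorem Ingredients.Valid.ae_xi_mono (hR : R.Valid X P) (hX : IsLevyProcess X P) :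
    ∀ᵐ ω ∂P, ∀ i j : Fin k, (incr k (fun t => X t ω) i < incr k (fun t => X t ω) j ∨
      (incr k (fun t => X t ω) i = incr k (fun t => X t ω) j ∧ R.Us i ω < R.Us j ω)) →
      R.xi X P i ω ≤ R.xi X P j ω := by
  have := Measure.isProbabilityMeasure_map (μ := P) (hX.measurable (1 / k)).aemeasurable
  have h1 : ∀ i : Fin k, ∀ᵐ ω ∂P, distTransform (P.map (X (1 / k))) (incr k (fun t => X t ω) i)
      (R.Us i ω) ∈ Set.Ioo 0 1 := fun i => by
    have h := ae_distTransform_mem_Ioo (P.map (X (1 / k)))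
    rw [← hR.map_increment_uniform hX i] at h
    exact ae_of_ae_map ((hX.measurable_incr i).prodMk (hR.measurable_Us i)).aemeasurable h
  have h2 : ∀ i : Fin k, ∀ᵐ ω ∂P, R.Us i ω ∈ Set.Icc (0 : ℝ) 1 := fun i => by
    refine ae_of_ae_map (hR.measurable_Us i).aemeasurable (p := (· ∈ Set.Icc (0 : ℝ) 1)) ?_
    rw [map_eq_of_isUniform (hR.uniforms i)]
    exact ae_restrict_mem measurableSet_Icc
  filter_upwards [ae_all_iff.2 h1, ae_all_iff.2 h2] with ω h1 h2 i j hij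
  exact leftInverse_mono _ (h1 i).1
    (distTransform_mono _ hij (h2 i).2 (h2 j).1) (h1 j).2

/-- The differences between the increments of the two couplings. -/
theorem Ingredients.Valid.ae_discrepancy_eq (hk : 0 < k) (hR : R.Valid X P)
    (hX : IsLevyProcess X P) :
    ∀ᵐ ω ∂P, ∀ i, R.discrepancy (P.map (X (1 / k))) ((incr k fun t => X t ω),
        (fun i => R.Us i ω), (incr k fun t => R.bridge t ω), R.U ω) i
      = incr k (fun t => R.W' X t ω) (R.perm X ω i) - R.xi X P i ω := by
  filter_upwards [hR.ae_injective_Us, hR.ae_injective_incr_W' hk hX, hX.zero] with ω hu hw h0 i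
  -- As X(0) = 0, the drift in the symmetric expression is the actual one, h(X(1), U).
  have hs : ∑ l : Fin k, incr k (fun t => X t ω) l = X 1 ω := by
    rw [sum_incr hk, h0, sub_zero]
  have hw' : (fun j => incr k (fun t => R.bridge t ω) j + R.h (X 1 ω) (R.U ω) / k)
      = incr k fun t => R.W' X t ω := by
    ext j
    exact (R.incr_W' X ω j).symm
  simp only [Ingredients.discrepancy, hs, hw', matched_eq hw hu]
  rfl

/-- The two samples depend on each other in a complicated way, but matching them in order leaves
only their order statistics. Each vector of these is compared with the same deterministic vector,
and 64 = 2 · (16 + 16). -/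
theorem Ingredients.Valid.lintegral_sum_sq_le (hk : 0 < k) (hR : R.Valid X P)
    (hX : IsLevyProcess X P) :
    ∫⁻ ω, ENNReal.ofReal (∑ i, R.discrepancy (P.map (X (1 / k))) ((incr k fun t => X t ω),
        (fun i => R.Us i ω), (incr k fun t => R.bridge t ω), R.U ω) i ^ 2) ∂P
      ≤ ENNReal.ofReal (64 * (1 / k) * (Real.log (k + 1) + 2)) := by
  obtain ⟨a, ha⟩ := exists_lintegral_sum_ordStat_sub_sq_le_of_var hk (1 / k)
  set L : ℝ := 16 * ((1 / k : ℝ≥0) : ℝ) * (Real.log (k + 1) + 2) with hL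
  have mo : Measurable fun z : Fin k → ℝ => ENNReal.ofReal (∑ j, (ordStat z j - a j) ^ 2) := by
    refine ENNReal.measurable_ofReal.comp (Finset.measurable_fun_sum _ fun j _ => ?_)
    exact ((measurable_ordStat j).sub_const _).pow_const _
  have mξ : Measurable fun ω i => R.xi X P i ω := measurable_pi_lambda _ (hR.measurable_xi hX)
  have h1 : ∫⁻ ω, ENNReal.ofReal
      (∑ j, (ordStat (incr k fun t => R.W' X t ω) j - a j) ^ 2) ∂P ≤ ENNReal.ofReal L := by
    rw [← hR.map_incr_W' hk hX, lintegral_map mo (hR.measurable_incr_W' hX)] at ha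
    exact ha
  have h2 : ∫⁻ ω, ENNReal.ofReal
      (∑ j, (ordStat (fun i => R.xi X P i ω) j - a j) ^ 2) ∂P ≤ ENNReal.ofReal L := by
    rw [← hR.map_xi hX, lintegral_map mo mξ] at ha
    exact ha
  calc _ ≤ ∫⁻ ω, (2 * ENNReal.ofReal
        (∑ j, (ordStat (incr k fun t => R.W' X t ω) j - a j) ^ 2)
        + 2 * ENNReal.ofReal (∑ j, (ordStat (fun i => R.xi X P i ω) j - a j) ^ 2)) ∂P := by
        refine lintegral_mono_ae ?_
        filter_upwards [hR.ae_discrepancy_eq hk hX, hR.ae_injective_Us,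
          hR.ae_injective_incr_W' hk hX, hR.ae_xi_mono hX] with ω hd hu hw hξ
        simp only [hd]
        have hσ : IsReordering (incr k fun t => X t ω) (fun i => R.Us i ω)
            (incr k fun t => R.W' X t ω) (R.perm X ω) := isReordering_reordering hw hu
        rw [sum_sq_sub_eq_ordStat hu hσ hξ]
        have e2 : (2 : ℝ≥0∞) = ENNReal.ofReal 2 := by simp
        rw [e2, ← ENNReal.ofReal_mul (by norm_num), ← ENNReal.ofReal_mul (by norm_num),
          ← ENNReal.ofReal_add (by positivity) (by positivity), Finset.mul_sum, Finset.mul_sum,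
          ← Finset.sum_add_distrib]
        refine ENNReal.ofReal_le_ofReal (Finset.sum_le_sum fun j _ => ?_)
        nlinarith [sq_nonneg ((ordStat (incr k fun t => R.W' X t ω) j - a j)
          + (ordStat (fun i => R.xi X P i ω) j - a j))]
    _ ≤ 2 * ENNReal.ofReal L + 2 * ENNReal.ofReal L := by
        have n1 : Measurable fun ω => ENNReal.ofReal
            (∑ j, (ordStat (incr k fun t => R.W' X t ω) j - a j) ^ 2) :=
          mo.comp (hR.measurable_incr_W' hX)
        have n2 : Measurable fun ω => ENNReal.ofReal
            (∑ j, (ordStat (fun i => R.xi X P i ω) j - a j) ^ 2) := mo.comp mξ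
        rw [lintegral_add_left (n1.const_mul _), lintegral_const_mul _ n1,
          lintegral_const_mul _ n2]
        gcongr
    _ = _ := by
        have hlog : 0 ≤ Real.log (k + 1) := Real.log_nonneg (by simp)
        have hL0 : 0 ≤ L := by positivity
        have e2 : (2 : ℝ≥0∞) = ENNReal.ofReal 2 := by simp
        rw [e2, ← ENNReal.ofReal_mul (by norm_num), ← ENNReal.ofReal_add (by positivity)
          (by positivity)]
        congr 1
        rw [hL]
        push_cast
        ring

theorem memLp_two_of_lintegral_sum_sq {ρ : Measure (Fin k → ℝ)}
    (h : ∫⁻ y, ENNReal.ofReal (∑ i, y i ^ 2) ∂ρ < ∞) (i : Fin k) :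
    MemLp (fun y => y i) 2 ρ := by
  rw [memLp_two_iff_integrable_sq (measurable_pi_apply i).aestronglyMeasurable]
  refine ⟨((measurable_pi_apply i).pow_const 2).aestronglyMeasurable, ?_⟩
  rw [hasFiniteIntegral_iff_ofReal (ae_of_all _ fun y => sq_nonneg _)]
  refine lt_of_le_of_lt (lintegral_mono fun y => ENNReal.ofReal_le_ofReal ?_) h
  exact Finset.single_le_sum (f := fun i => y i ^ 2) (fun j _ => sq_nonneg _) (Finset.mem_univ i)

/-- A square-integrable bound on the partial sums of the differences of increments. -/
theorem Ingredients.Valid.exists_majorant_partialSum (hk : 0 < k) (hR : R.Valid X P)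
    (hX : IsLevyProcess X P) :
    ∃ G : Ω → ℝ≥0∞, Measurable G ∧
      (∀ᵐ ω ∂P, ∀ m ≤ k, ENNReal.ofReal (partialSum
        (fun i => incr k (fun t => R.W' X t ω) (R.perm X ω i) - R.xi X P i ω) m ^ 2) ≤ G ω) ∧
      ∫⁻ ω, G ω ∂P ≤ ENNReal.ofReal (8192 * (1 / k) * (Real.log (k + 1) + 2))
        + 2 * ∫⁻ ω, ENNReal.ofReal ((∑ i,
          (incr k (fun t => R.W' X t ω) (R.perm X ω i) - R.xi X P i ω)) ^ 2) ∂P := by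
  have := Measure.isProbabilityMeasure_map (μ := P) (hX.measurable (1 / k)).aemeasurable
  have mx : Measurable fun ω => incr k fun t => X t ω :=
    measurable_pi_lambda _ fun i => hX.measurable_incr i
  have mu : Measurable fun ω => fun i => R.Us i ω := measurable_pi_lambda _ hR.measurable_Us
  have mbU : Measurable fun ω => ((incr k fun t => R.bridge t ω), R.U ω) :=
    (hR.measurable_incr_bridge hX).prodMk hR.measurable_U
  have := Measure.isProbabilityMeasure_map (μ := P) mbU.aemeasurable
  have hD := R.measurable_discrepancy (P.map (X (1 / k))) hR.measurable_h
  have ms := mx.prodMk (mu.prodMk mbU)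
  have hex := R.exchangeable_discrepancy (P.map (X (1 / k))) (volume.restrict (Set.Icc (0 : ℝ) 1))
    (P.map fun ω => ((incr k fun t => R.bridge t ω), R.U ω)) hR.measurable_h
  rw [← hR.map_sources hX, Measure.map_map hD ms] at hex
  have hsq := hR.lintegral_sum_sq_le hk hX
  have m1 : Measurable fun y : Fin k → ℝ => ENNReal.ofReal (∑ i, y i ^ 2) := by fun_prop
  have m2 : Measurable fun y : Fin k → ℝ => ENNReal.ofReal ((∑ i, y i) ^ 2) := by fun_prop
  have hsq' : ∫⁻ y, ENNReal.ofReal (∑ i, y i ^ 2) ∂(P.map (R.discrepancy (P.map (X (1 / k))) ∘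
      fun ω => ((incr k fun t => X t ω), (fun i => R.Us i ω), (incr k fun t => R.bridge t ω),
        R.U ω))) ≤ ENNReal.ofReal (64 * (1 / k) * (Real.log (k + 1) + 2)) := by
    rw [lintegral_map m1 (hD.comp ms)]
    exact hsq
  -- Square integrability comes from the bound on the sum of squares, so no moments of X are needed.
  -- Multiplying that bound by 128 gives 8192 = 128 · 64.
  obtain ⟨G, mG, hG, hGi⟩ := hex.exists_majorant hk
    (memLp_two_of_lintegral_sum_sq (hsq'.trans_lt ENNReal.ofReal_lt_top))
  have mG' : Measurable fun y => ENNReal.ofReal (G y) := mG.ennreal_ofReal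
  rw [lintegral_map mG' (hD.comp ms),
    lintegral_map m2 (hD.comp ms)] at hGi
  refine ⟨_, mG'.comp (hD.comp ms), ?_, hGi.trans ?_⟩
  · filter_upwards [hR.ae_discrepancy_eq hk hX] with ω hω m hm
    rw [← funext hω]
    exact ENNReal.ofReal_le_ofReal (hG _ m hm)
  · have hlog : 0 ≤ Real.log (k + 1) := Real.log_nonneg (by simp)
    refine add_le_add ?_ (le_of_eq ?_)
    · refine (mul_le_mul_right hsq' _).trans (le_of_eq ?_)
      have e : (128 : ℝ≥0∞) = ENNReal.ofReal 128 := by simp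
      rw [e, ← ENNReal.ofReal_mul (by norm_num)]
      congr 1
      ring
    · congr 1
      refine lintegral_congr_ae ?_
      filter_upwards [hR.ae_discrepancy_eq hk hX] with ω hω
      rw [← funext hω]
      rfl

end Discrepancy

/-! ### From increments to whole paths. -/

section Paths

variable {k : ℕ}

theorem concat_natCast_div (hk : 0 < k) (f : Fin k → ℝ≥0 → ℝ) (m : ℕ) :
    concat f ((m : ℝ≥0) / k) = partialSum (fun j => f j (1 / k)) m := by
  have hk0 : (0 : ℝ≥0) < k := by exact_mod_cast hk
  unfold concat partialSum
  rw [Finset.sum_filter]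
  refine Finset.sum_congr rfl fun j _ => ?_
  have h1 : ((j : ℕ) + 1 : ℝ≥0) / k ≤ (m : ℝ≥0) / k ↔ (j : ℕ) < m := by
    rw [div_le_div_iff_of_pos_right hk0]
    exact_mod_cast Nat.succ_le_iff
  have h2 : ((j : ℕ) : ℝ≥0) / k < (m : ℝ≥0) / k ↔ (j : ℕ) < m := by
    rw [div_lt_div_iff_of_pos_right hk0]
    exact_mod_cast Iff.rfl
  simp only [h1, h2]
  split_ifs <;> rfl

theorem concat_one (hk : 0 < k) (f : Fin k → ℝ≥0 → ℝ) : concat f 1 = ∑ j, f j (1 / k) := by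
  have hk0 : (k : ℝ≥0) ≠ 0 := by exact_mod_cast hk.ne'
  have h := concat_natCast_div hk f k
  rwa [div_self hk0, partialSum_self] at h

theorem exists_mem_subinterval (hk : 0 < k) {t : ℝ≥0} (h0 : 0 < t) (h1 : t ≤ 1) :
    ∃ i : Fin k, ((i : ℕ) : ℝ≥0) / k < t ∧ t ≤ ((i : ℕ) + 1) / k := by
  have hk0 : (0 : ℝ≥0) < k := by exact_mod_cast hk
  have hpos : 0 < ⌈t * k⌉₊ := Nat.ceil_pos.2 (by positivity)
  have hle : ⌈t * k⌉₊ ≤ k := Nat.ceil_le.2 (mul_le_of_le_one_left hk0.le h1)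
  refine ⟨⟨⌈t * k⌉₊ - 1, by omega⟩, ?_, ?_⟩
  · rw [div_lt_iff₀ hk0]
    exact Nat.lt_ceil.1 (by simp only; omega)
  · rw [le_div_iff₀ hk0]
    have h := Nat.le_ceil (t * k)
    have e : (((⌈t * k⌉₊ - 1 : ℕ) : ℝ≥0) + 1) = (⌈t * k⌉₊ : ℝ≥0) := by
      exact_mod_cast Nat.sub_add_cancel hpos
    simp only
    rwa [e]

/-- Convexity of the square: a linear interpolation is bounded by its values at the nodes. -/
theorem ofReal_sq_interpolate_le {S d θ : ℝ} {G : ℝ≥0∞} (h0 : 0 ≤ θ) (h1 : θ ≤ 1)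
    (hS : ENNReal.ofReal (S ^ 2) ≤ G) (hd : ENNReal.ofReal ((S + d) ^ 2) ≤ G) :
    ENNReal.ofReal ((S + θ * d) ^ 2) ≤ G := by
  have key : (S + θ * d) ^ 2 ≤ max (S ^ 2) ((S + d) ^ 2) := by
    have e : (S + θ * d) ^ 2 ≤ (1 - θ) * S ^ 2 + θ * (S + d) ^ 2 := by
      nlinarith [mul_nonneg (mul_nonneg h0 (sub_nonneg.2 h1)) (sq_nonneg d)]
    have := mul_le_mul_of_nonneg_left (le_max_left (S ^ 2) ((S + d) ^ 2)) (sub_nonneg.2 h1)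
    have := mul_le_mul_of_nonneg_left (le_max_right (S ^ 2) ((S + d) ^ 2)) h0
    linarith
  refine (ENNReal.ofReal_le_ofReal key).trans ?_
  rcases max_choice (S ^ 2) ((S + d) ^ 2) with h | h <;> rw [h] <;> assumption

theorem ofReal_sq_decomposition_le {a y y' b θ : ℝ} {A Y B : ℝ≥0∞} (h0 : 0 ≤ θ) (h1 : θ ≤ 1)
    (ha : ENNReal.ofReal (a ^ 2) ≤ A) (hy : ENNReal.ofReal (y ^ 2) ≤ Y)
    (hy' : ENNReal.ofReal (y' ^ 2) ≤ Y) (hb : ENNReal.ofReal (b ^ 2) ≤ B) :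
    ENNReal.ofReal ((a + (y - θ * y') - b) ^ 2) ≤ 3 * A + 12 * Y + 3 * B := by
  have key : (a + (y - θ * y') - b) ^ 2 ≤ 3 * a ^ 2 + (6 * y ^ 2 + 6 * y' ^ 2) + 3 * b ^ 2 := by
    have e : (θ * y') ^ 2 ≤ y' ^ 2 := by
      rw [mul_pow]
      exact mul_le_of_le_one_left (sq_nonneg _) (pow_le_one₀ h0 h1)
    nlinarith [sq_nonneg (a - (y - θ * y')), sq_nonneg (a + b), sq_nonneg ((y - θ * y') + b),
      sq_nonneg (y + θ * y')]
  refine (ENNReal.ofReal_le_ofReal key).trans ?_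
  rw [ENNReal.ofReal_add (by positivity) (by positivity),
    ENNReal.ofReal_add (by positivity) (by positivity),
    ENNReal.ofReal_add (by positivity) (by positivity),
    ENNReal.ofReal_mul (by norm_num), ENNReal.ofReal_mul (by norm_num),
    ENNReal.ofReal_mul (by norm_num), ENNReal.ofReal_mul (by norm_num)]
  simp only [ENNReal.ofReal_ofNat]
  calc _ ≤ 3 * A + (6 * Y + 6 * Y) + 3 * B := by gcongr
    _ = _ := by
      rw [← add_mul]
      norm_num

variable {Ω : Type*} (R : Ingredients Ω k) (X : ℝ≥0 → Ω → ℝ)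

/-- Subtracting the chord removes the linear drift, so the remainder involves the Brownian bridge
alone. -/
theorem Ingredients.W'_piece (hk : 0 < k) (ω : Ω) (j : Fin k) (s : ℝ≥0) :
    R.W' X ((j : ℕ) / k + s) ω - R.W' X ((j : ℕ) / k) ω
      = (k * s) * incr k (fun t => R.W' X t ω) j
        + ((R.bridge ((j : ℕ) / k + s) ω - R.bridge ((j : ℕ) / k) ω)
          - (k * s) * (R.bridge ((j : ℕ) / k + 1 / k) ω - R.bridge ((j : ℕ) / k) ω)) := by
  have hk0 : (k : ℝ) ≠ 0 := by exact_mod_cast hk.ne'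
  rw [R.incr_W' X]
  simp only [Ingredients.W', incr, add_div]
  push_cast
  field_simp
  ring

theorem Ingredients.W_natCast_div (hk : 0 < k) (ω : Ω) (m : ℕ) :
    R.W X (m / k) ω
      = partialSum (fun i => incr k (fun t => R.W' X t ω) (R.perm X ω i)) m := by
  unfold Ingredients.W
  rw [concat_natCast_div hk]
  simp only [incr, add_div]

theorem Ingredients.W_one (hk : 0 < k) (ω : Ω) :
    R.W X 1 ω = ∑ j, incr k (fun t => R.W' X t ω) j := by
  unfold Ingredients.W
  rw [concat_one hk, ← Equiv.sum_comp (R.perm X ω) (incr k fun t => R.W' X t ω)]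
  simp only [incr, add_div]

variable [MeasurableSpace Ω] (P : Measure Ω)

theorem Ingredients.What_natCast_div (hk : 0 < k) {ω : Ω} (hβ : ∀ i, R.bridges i (1 / k) ω = 0)
    (m : ℕ) : R.What X P (m / k) ω = partialSum (fun i => R.xi X P i ω) m := by
  have hk0 : (k : ℝ) ≠ 0 := by exact_mod_cast hk.ne'
  unfold Ingredients.What
  rw [concat_natCast_div hk]
  congr 1
  ext i
  rw [hβ i, zero_add]
  push_cast
  rw [mul_one_div_cancel hk0, one_mul]

theorem partialSum_sub (y z : Fin k → ℝ) (m : ℕ) :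
    partialSum y m - partialSum z m = partialSum (fun i => y i - z i) m :=
  (Finset.sum_sub_distrib _ _).symm

/-- Three terms of different nature: the interpolated partial sums of the differences, a piece of
the large bridge minus its chord, and a small bridge. The majorants for the pieces are uniform over
all k positions, so the random position π(i) does no harm. -/
theorem Ingredients.W_sub_What (hk : 0 < k) {ω : Ω} (hβ : ∀ i, R.bridges i (1 / k) ω = 0)
    (i : Fin k) {t : ℝ≥0} (h1 : ((i : ℕ) : ℝ≥0) / k < t) (h2 : t ≤ ((i : ℕ) + 1) / k) :
    R.W X t ω - R.What X P t ω
      = (partialSum (fun i => incr k (fun t => R.W' X t ω) (R.perm X ω i) - R.xi X P i ω) i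
          + (k * (t - (i : ℕ) / k : ℝ≥0))
            * (incr k (fun t => R.W' X t ω) (R.perm X ω i) - R.xi X P i ω))
        + ((R.bridge ((R.perm X ω i : ℕ) / k + (t - (i : ℕ) / k)) ω
            - R.bridge ((R.perm X ω i : ℕ) / k) ω)
          - (k * (t - (i : ℕ) / k : ℝ≥0)) * (R.bridge ((R.perm X ω i : ℕ) / k + 1 / k) ω
            - R.bridge ((R.perm X ω i : ℕ) / k) ω))
        - R.bridges i (t - (i : ℕ) / k) ω := by
  have e1 : R.W X t ω = R.W X ((i : ℕ) / k) ω + (R.W' X ((R.perm X ω i : ℕ) / k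
      + (t - (i : ℕ) / k)) ω - R.W' X ((R.perm X ω i : ℕ) / k) ω) := concat_step _ i t h1 h2
  have e2 : R.What X P t ω = R.What X P ((i : ℕ) / k) ω + (R.bridges i (t - (i : ℕ) / k) ω
      + k * (t - (i : ℕ) / k : ℝ≥0) * R.xi X P i ω) := concat_step _ i t h1 h2
  rw [e1, e2, R.W_natCast_div X hk, R.What_natCast_div X P hk hβ, R.W'_piece X hk,
    ← partialSum_sub]
  ring

variable {R X P}

theorem Ingredients.Valid.ae_bridges_eq_zero (hR : R.Valid X P) :
    ∀ᵐ ω ∂P, ∀ i, R.bridges i (1 / k) ω = 0 :=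
  ae_all_iff.2 fun i => (hR.bridges i).ae_eq_zero (Or.inr rfl)

theorem Ingredients.Valid.measurable_W_one (hk : 0 < k) (hR : R.Valid X P)
    (hX : IsLevyProcess X P) : Measurable (R.W X 1) := by
  have h : R.W X 1 = fun ω => ∑ j, incr k (fun t => R.W' X t ω) j := funext (R.W_one X hk)
  rw [h]
  exact Finset.measurable_fun_sum _ fun j _ =>
    (measurable_pi_apply j).comp (hR.measurable_incr_W' hX)

/-- The small bridges vanish at 1/k, so the sum is W(1) - Ŵ(1), and one passes through X(1). This is
where the end errors enter. -/
theorem Ingredients.Valid.lintegral_sq_sum_le (hk : 0 < k) (hR : R.Valid X P)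
    (hX : IsLevyProcess X P) :
    ∫⁻ ω, ENNReal.ofReal ((∑ i,
        (incr k (fun t => R.W' X t ω) (R.perm X ω i) - R.xi X P i ω)) ^ 2) ∂P
      ≤ 2 * endError P X (R.W X) + 2 * endError P X (R.What X P) := by
  have hk0 : (k : ℝ≥0) ≠ 0 := by exact_mod_cast hk.ne'
  have hm : Measurable fun ω => ENNReal.ofReal (|X 1 ω - R.W X 1 ω| ^ 2) :=
    (((hX.measurable 1).sub (hR.measurable_W_one hk hX)).abs.pow_const 2).ennreal_ofReal
  unfold endError
  rw [← lintegral_const_mul _ hm, ← lintegral_const_mul' _ _ (by simp),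
    ← lintegral_add_left (hm.const_mul _)]
  refine lintegral_mono_ae ?_
  filter_upwards [hR.ae_bridges_eq_zero] with ω hβ
  have e1 := R.W_natCast_div X hk ω k
  have e2 := R.What_natCast_div X P hk hβ k
  rw [div_self hk0, partialSum_self] at e1 e2
  rw [Finset.sum_sub_distrib, ← e1, ← e2, sq_abs, sq_abs]
  have e : (2 : ℝ≥0∞) = ENNReal.ofReal 2 := by simp
  rw [e, ← ENNReal.ofReal_mul (by norm_num), ← ENNReal.ofReal_mul (by norm_num),
    ← ENNReal.ofReal_add (by positivity) (by positivity)]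
  refine ENNReal.ofReal_le_ofReal ?_
  nlinarith [sq_nonneg ((X 1 ω - R.W X 1 ω) + (X 1 ω - R.What X P 1 ω))]

variable [IsProbabilityMeasure P]

/-- The distance between the two couplings is controlled by the errors at the end-points. -/
theorem Ingredients.Valid.exists_majorant_sub (hk : 0 < k) (hR : R.Valid X P)
    (hX : IsLevyProcess X P) :
    ∃ G : Ω → ℝ≥0∞, Measurable G ∧
      (∀ᵐ ω ∂P, ∀ t ≤ 1, ENNReal.ofReal (|R.W X t ω - R.What X P t ω| ^ 2) ≤ G ω) ∧
      ∫⁻ ω, G ω ∂P ≤ 12 * endError P X (R.W X) + 12 * endError P X (R.What X P)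
        + ENNReal.ofReal (26736 * ((1 / k) * (Real.log (k + 1) + 2))) := by
  have hk0 : (0 : ℝ≥0) < k := by exact_mod_cast hk
  have : Nonempty (Fin k) := ⟨⟨0, hk⟩⟩
  obtain ⟨G₁, m₁, h₁, i₁⟩ := hR.exists_majorant_partialSum hk hX
  obtain ⟨G₂, m₂, h₂, i₂⟩ := exists_majorant_pieces hk hR.bridge
  obtain ⟨G₃, m₃, h₃, i₃⟩ := exists_majorant_bridges (show (0 : ℝ≥0) < 1 / k by positivity)
    hR.bridges
  refine ⟨fun ω => 3 * G₁ ω + 12 * G₂ ω + 3 * G₃ ω, by fun_prop, ?_, ?_⟩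
  · filter_upwards [h₁, h₂, h₃, hR.ae_bridges_eq_zero] with ω h₁ h₂ h₃ hβ t ht
    rw [sq_abs]
    rcases eq_or_lt_of_le (zero_le (a := t)) with rfl | h0
    · have e1 : R.W X 0 ω = 0 := concat_zero _
      have e2 : R.What X P 0 ω = 0 := concat_zero _
      simp [e1, e2]
    · obtain ⟨i, hi, hi'⟩ := exists_mem_subinterval hk h0 ht
      rw [R.W_sub_What X P hk hβ i hi hi']
      have hs : t - (i : ℕ) / k ≤ 1 / (k : ℝ≥0) := by
        rw [tsub_le_iff_left, ← add_div]
        exact hi'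
      have hθ : (k : ℝ) * ((t - (i : ℕ) / k : ℝ≥0) : ℝ) ≤ 1 := by
        have h := mul_le_mul_right hs (k : ℝ≥0)
        rw [mul_one_div_cancel hk0.ne'] at h
        exact_mod_cast h
      have hθ0 : 0 ≤ (k : ℝ) * ((t - (i : ℕ) / k : ℝ≥0) : ℝ) := by positivity
      refine ofReal_sq_decomposition_le hθ0 hθ (ofReal_sq_interpolate_le hθ0 hθ
        (h₁ i i.2.le) ?_) (h₂ _ _ hs) (h₂ _ _ le_rfl) (h₃ i _ hs)
      have h := h₁ (i + 1) i.2
      rwa [partialSum_succ] at h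
  · set L : ℝ := (1 / k) * (Real.log (k + 1) + 2) with hL
    have hlog0 : 0 ≤ Real.log (k + 1) := Real.log_nonneg (by simp)
    have hL0 : 0 ≤ L := by positivity
    have hlog : Real.log k ≤ Real.log (k + 1) :=
      Real.log_le_log (by exact_mod_cast hk) (by simp)
    have b₁ : ∫⁻ ω, G₁ ω ∂P ≤ ENNReal.ofReal (8192 * L)
        + 2 * (2 * endError P X (R.W X) + 2 * endError P X (R.What X P)) := by
      rw [hL, ← mul_assoc]
      exact i₁.trans (by gcongr; exact hR.lintegral_sq_sum_le hk hX)
    have b₂ : ∫⁻ ω, G₂ ω ∂P ≤ ENNReal.ofReal (144 * L) := by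
      refine i₂.trans (ENNReal.ofReal_le_ofReal ?_)
      rw [hL, ← mul_assoc]
      gcongr
    have b₃ : ∫⁻ ω, G₃ ω ∂P ≤ ENNReal.ofReal (144 * L) := by
      refine i₃.trans (ENNReal.ofReal_le_ofReal ?_)
      rw [hL, ← mul_assoc, Fintype.card_fin]
      push_cast
      gcongr
    rw [lintegral_add_right _ (m₃.const_mul _), lintegral_add_right _ (m₂.const_mul _),
      lintegral_const_mul _ m₁, lintegral_const_mul _ m₂, lintegral_const_mul _ m₃]
    have e : ∀ c : ℝ, 0 ≤ c → ENNReal.ofReal (c * L) = ENNReal.ofReal c * ENNReal.ofReal L :=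
      fun c hc => ENNReal.ofReal_mul hc
    rw [e _ (by norm_num)]
    rw [e _ (by norm_num)] at b₁ b₂ b₃
    simp only [ENNReal.ofReal_ofNat] at b₁ b₂ b₃ ⊢
    -- The coefficient of L is 3 · 8192 + 12 · 144 + 3 · 144 = 26736.
    calc _ ≤ 3 * (8192 * ENNReal.ofReal L
          + 2 * (2 * endError P X (R.W X) + 2 * endError P X (R.What X P)))
          + 12 * (144 * ENNReal.ofReal L) + 3 * (144 * ENNReal.ofReal L) := by gcongr
      _ = _ := by ring

end Paths

/-! ### Comparison of errors and conclusion. -/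

section Errors

variable {Ω : Type*} [MeasurableSpace Ω] {P : Measure Ω} {X Y Z : ℝ≥0 → Ω → ℝ}

theorem endError_le_supError : endError P X Y ≤ supError P X Y :=
  lintegral_mono fun ω => le_iSup₂_of_le (f := fun t (_ : t ∈ Set.Icc (0 : ℝ≥0) 1) =>
    ENNReal.ofReal (|X t ω - Y t ω| ^ 2)) 1 (by simp) le_rfl

/-- A supremum over uncountably many times need not be measurable; additivity of the integral is
used only against the measurable majorant. -/
theorem supError_le_of_majorant {G : Ω → ℝ≥0∞} (mG : Measurable G)
    (hG : ∀ᵐ ω ∂P, ∀ t ≤ 1, ENNReal.ofReal (|Y t ω - Z t ω| ^ 2) ≤ G ω) :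
    supError P X Z ≤ 2 * supError P X Y + 2 * ∫⁻ ω, G ω ∂P := by
  unfold supError
  rw [← lintegral_const_mul' _ _ (by simp), ← lintegral_const_mul _ mG,
    ← lintegral_add_right _ (mG.const_mul _)]
  refine lintegral_mono_ae ?_
  filter_upwards [hG] with ω hω
  refine iSup₂_le fun t ht => ?_
  have h1 : ENNReal.ofReal (|X t ω - Y t ω| ^ 2)
      ≤ ⨆ t ∈ Set.Icc (0 : ℝ≥0) 1, ENNReal.ofReal (|X t ω - Y t ω| ^ 2) :=
    le_iSup₂_of_le (f := fun t (_ : t ∈ Set.Icc (0 : ℝ≥0) 1) =>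
      ENNReal.ofReal (|X t ω - Y t ω| ^ 2)) t ht le_rfl
  refine le_trans ?_ (add_le_add (mul_le_mul_right h1 2) (mul_le_mul_right (hω t ht.2) 2))
  have e : (2 : ℝ≥0∞) = ENNReal.ofReal 2 := by simp
  rw [e, ← ENNReal.ofReal_mul (by norm_num), ← ENNReal.ofReal_mul (by norm_num),
    ← ENNReal.ofReal_add (by positivity) (by positivity), sq_abs, sq_abs, sq_abs]
  refine ENNReal.ofReal_le_ofReal ?_
  nlinarith [sq_nonneg ((X t ω - Y t ω) - (Y t ω - Z t ω))]

variable [IsProbabilityMeasure P] {k : ℕ} {R : Ingredients Ω k}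

theorem Ingredients.Valid.supError_W_le (hk : 0 < k) (hR : R.Valid X P)
    (hX : IsLevyProcess X P) :
    supError P X (R.W X) ≤ 24 * endError P X (R.W X) + 26 * supError P X (R.What X P)
      + ENNReal.ofReal (53472 * ((1 / k) * (Real.log (k + 1) + 2))) := by
  obtain ⟨G, mG, hG, hi⟩ := hR.exists_majorant_sub hk hX
  have h := supError_le_of_majorant (X := X) (Y := R.What X P) (Z := R.W X) mG (by
    simpa only [abs_sub_comm] using hG)
  refine h.trans ((add_le_add_right (mul_le_mul_right hi 2) _).trans ?_)
  rw [ENNReal.ofReal_mul (by norm_num),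
    ENNReal.ofReal_mul (p := 53472) (by norm_num)]
  simp only [ENNReal.ofReal_ofNat]
  set L := ENNReal.ofReal ((1 / k) * (Real.log (k + 1) + 2))
  calc _ ≤ 2 * supError P X (R.What X P) + 2 * (12 * endError P X (R.W X)
        + 12 * supError P X (R.What X P) + 26736 * L) := by
        gcongr
        exact endError_le_supError
    _ = _ := by ring

theorem Ingredients.Valid.supError_What_le (hk : 0 < k) (hR : R.Valid X P)
    (hX : IsLevyProcess X P) :
    supError P X (R.What X P) ≤ 24 * endError P X (R.What X P) + 26 * supError P X (R.W X)
      + ENNReal.ofReal (53472 * ((1 / k) * (Real.log (k + 1) + 2))) := by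
  obtain ⟨G, mG, hG, hi⟩ := hR.exists_majorant_sub hk hX
  have h := supError_le_of_majorant (X := X) (Y := R.W X) (Z := R.What X P) mG hG
  refine h.trans ((add_le_add_right (mul_le_mul_right hi 2) _).trans ?_)
  rw [ENNReal.ofReal_mul (by norm_num),
    ENNReal.ofReal_mul (p := 53472) (by norm_num)]
  simp only [ENNReal.ofReal_ofNat]
  set L := ENNReal.ofReal ((1 / k) * (Real.log (k + 1) + 2))
  calc _ ≤ 2 * supError P X (R.W X) + 2 * (12 * supError P X (R.W X)
        + 12 * endError P X (R.What X P) + 26736 * L) := by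
        gcongr
        exact endError_le_supError
    _ = _ := by ring

/-- For m ≥ 3 one has log m ≥ 1 and m + 1 ≤ m², so log (m + 1) + 2 ≤ 4 log m. -/
theorem inv_mul_log_le {m : ℕ} (hm : 3 ≤ m) {c e : ℝ} (hc : 0 < c)
    (h : c ≤ e * m / Real.log m) :
    (1 / m : ℝ) * (Real.log (m + 1) + 2) ≤ 4 / c * e := by
  have hm3 : (3 : ℝ) ≤ m := by exact_mod_cast hm
  have hlog : 1 ≤ Real.log m := by
    rw [Real.le_log_iff_exp_le (by positivity)]
    exact (Real.exp_one_lt_d9.le.trans (by norm_num)).trans hm3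
  have hlog2 : Real.log (m + 1) ≤ 2 * Real.log m := by
    have := Real.log_le_log (by positivity) (show (m : ℝ) + 1 ≤ m ^ 2 by nlinarith)
    rwa [Real.log_pow] at this
  rw [le_div_iff₀ (by positivity)] at h
  rw [one_div, inv_mul_le_iff₀ (by positivity), div_mul_eq_mul_div, mul_div_assoc',
    le_div_iff₀ hc]
  nlinarith

theorem IsBigOSeq.of_le {a b d : ℕ → ℝ≥0∞} {ε : ℕ → ℝ} {k : ℕ → ℕ}
    (hk : Tendsto k atTop atTop)
    (hεk : ∃ c > 0, ∀ᶠ n in atTop, c ≤ ε n * k n / Real.log (k n))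
    (ha : IsBigOSeq a ε) (hb : IsBigOSeq b ε)
    (h : ∀ n, d n ≤ 24 * a n + 26 * b n
      + ENNReal.ofReal (53472 * ((1 / k n) * (Real.log (k n + 1) + 2)))) : IsBigOSeq d ε := by
  obtain ⟨c, hc, hck⟩ := hεk
  obtain ⟨C₁, h₁⟩ := ha
  obtain ⟨C₂, h₂⟩ := hb
  refine ⟨24 * C₁ + 26 * C₂ + Real.toNNReal (53472 * (4 / c)), ?_⟩
  filter_upwards [hck, h₁, h₂, hk.eventually_ge_atTop 3] with n hc' h₁ h₂ h3
  refine (h n).trans ?_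
  have h4 : ENNReal.ofReal (53472 * ((1 / k n) * (Real.log (k n + 1) + 2)))
      ≤ ENNReal.ofReal (53472 * (4 / c)) * ENNReal.ofReal (ε n) := by
    rw [← ENNReal.ofReal_mul (by positivity), mul_assoc]
    refine ENNReal.ofReal_le_ofReal ?_
    gcongr 53472 * ?_
    exact inv_mul_log_le h3 hc hc'
  calc _ ≤ 24 * (C₁ * ENNReal.ofReal (ε n)) + 26 * (C₂ * ENNReal.ofReal (ε n))
        + ENNReal.ofReal (53472 * (4 / c)) * ENNReal.ofReal (ε n) := by gcongr
    _ = _ := by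
        push_cast
        rw [← ENNReal.ofReal]
        ring

end Errors

end LevyCoupling

theorem theorem3p1 {Ω : ℕ → Type*} [∀ n, MeasurableSpace (Ω n)]
    (P : ∀ n, Measure (Ω n)) [∀ n, IsProbabilityMeasure (P n)]
    (X : ∀ n, ℝ≥0 → Ω n → ℝ) (hX : ∀ n, LevyCoupling.IsLevyProcess (X n) (P n))
    (k : ℕ → ℕ) (hk : ∀ n, 1 ≤ k n) (hk_lim : Tendsto k atTop atTop)
    (R : ∀ n, LevyCoupling.Ingredients (Ω n) (k n)) (hR : ∀ n, (R n).Valid (X n) (P n))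
    (ε : ℕ → ℝ) (hε : Antitone ε) (hε_lim : Tendsto ε atTop (𝓝 0))
    (hεk : ∃ c > 0, ∀ᶠ n in atTop, c ≤ ε n * k n / Real.log (k n)) :
    (LevyCoupling.IsBigOSeq
        (fun n => LevyCoupling.endError (P n) (X n) ((R n).W (X n))) ε →
      LevyCoupling.IsBigOSeq
        (fun n => LevyCoupling.supError (P n) (X n) ((R n).What (X n) (P n))) ε →
      LevyCoupling.IsBigOSeq
        (fun n => LevyCoupling.supError (P n) (X n) ((R n).W (X n))) ε) ∧
    (LevyCoupling.IsBigOSeq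
        (fun n => LevyCoupling.endError (P n) (X n) ((R n).What (X n) (P n))) ε →
      LevyCoupling.IsBigOSeq
        (fun n => LevyCoupling.supError (P n) (X n) ((R n).W (X n))) ε →
      LevyCoupling.IsBigOSeq
        (fun n => LevyCoupling.supError (P n) (X n) ((R n).What (X n) (P n))) ε) :=
  ⟨fun ha hb => ha.of_le hk_lim hεk hb fun n => (hR n).supError_W_le (hk n) (hX n),
    fun ha hb => ha.of_le hk_lim hεk hb fun n => (hR n).supError_What_le (hk n) (hX n)⟩
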